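/- **Setting.** Let $\mathbf m=(m_\ell)_{\ell\ge1}$ be a bounded sequence of integers $m_\ell\ge 2$, let $m^*=\max_\ell m_\ell$, and let $T_{\mathbf m}$ be the rooted tree whose vertices are the words $a_k\cdots a_1$ with $0\le a_i<m_i$. Let $\Pi$ be the group of automorphisms $\langle id,\dots,id\rangle\sigma$, $\sigma\in \mathrm{Sym}(m_1)$, which permute the subtrees of the root. Let $\rho=\rho_1$ be given by $\rho_\ell=\langle\rho_{\ell+1},\tau_{\ell+1},\dots,\tau_{\ell+1}\rangle$ (indexed from the first level down), where $\tau_\ell$ is the cyclic permutation of $\{0,\dots,m_\ell-1\}$; that is, $\rho$ applies the cyclic permutation to the digit following the first nonzero digit. Let $H=\{\rho^i\}_{0\le i<k}$, $k=\mathrm{lcm}(m_2,m_3,\dots)$, and let the piecewise mother group $\mathcal M_{\mathbf m}$ be generated by $H$ and $\Pi$. It acts from the right on infinite strings $\cdots a_2a_1$; let $o$ be the all-zero string and $S$ its orbit. Let $G_1,G_2,\dots$ be independent with law the even mixture of the uniform measures on $\Pi$ and on $H$, let $Y_n=G_1\cdots G_n$ and $T=\min\{i\ge1: o.Y_i=o\}$.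 Let $\Lambda$ be an infinite group with a finite symmetric generating set $A$, and let $\mu$ be a finitely supported symmetric probability measure on $\Lambda$ whose support generates $\Lambda$. Let $\Lambda\wr_S\mathcal M_{\mathbf m}$ be the semidirect product of the group of finitely supported functions $S\to\Lambda$ with $\mathcal M_{\mathbf m}$, with $(\ell,g)(\ell',g')=(\ell\cdot\ell'(\,\cdot\,.g),gg')$. For $L\in\Lambda$ let $\bar L$ be the element $(\ell,1)$ with $\ell(o)=L$ and $\ell(s)=1$ for $s\ne o$. Let $X_n=\prod_{i=1}^n\bar L_iG_i\bar L_i'$ be the switch-walk-switch walk, where $L_i,L_i'$ have law $\mu$ and all $L_i,G_i,L'_i$ are independent. Let $|X_n|$ be the word norm with respect to the generating set $\{\bar a: a\in A\}\cup\Pi\cup H$, and let $H(X_n)=-\sum_x P(X_n=x)\log P(X_n=x)$. Let $R_n=L_1\cdots L_n$ be the random walk on $\Lambda$ with step law $\mu$, let $|\cdot|$ on $\Lambda$ be the word norm of $A$, and for integers $n\ge0$ put $$\overline\lambda(n)=\max_{k\le n}\mathbb E|R_k|,\qquad \underline\lambda(n)=\inf_{k\ge n}\mathbb E|R_k|,\qquad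 h(n)=H(R_n),$$ extended to real arguments $\ge 0$ by linear interpolation between the integers. **Statement.** For every $n\ge0$, every real $p$ with $0<p\le P(T>n)$ and every real $q\ge\sum_{i=0}^nP(T>i)$, $$\mathbb E|X_n|\succeq np\,\underline\lambda(1/p),\qquad \mathbb E|X_n|\preceq q\,\overline\lambda(n/q),$$ $$H(X_n)\succeq np\,h(1/p),\qquad H(X_n)\preceq q\big(h(n/q)+\log(n+1)\big).$$ The implicit constants do not depend on $n$, $p$, $q$, and depend on $\mathbf m$ only through $m^*$. In the first, third and fourth bound they depend on nothing but $m^*$; in the second bound, $\mathbb E|X_n|\preceq q\overline\lambda(n/q)$, they may depend also on the data $(\Lambda,A,\mu)$ fixed at the outset. -/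

import Mathlib

noncomputable section

namespace SwitchWalk

/-! Random walks on groups, through their laws -/

/-- The law of `n` independent samples `(a₁, …, aₙ)` from `ν`, as a list of length `n`. -/
def iid {α : Type*} (ν : PMF α) : ℕ → PMF (List α)
  | 0 => PMF.pure []
  | n + 1 => ν.bind fun a => (iid ν n).map fun l => a :: l

/-- The law of `g₁ g₂ ⋯ gₙ`, where the `gᵢ` are independent samples from `ν`. -/
def walkLaw {G : Type*} [Group G] (ν : PMF G) (n : ℕ) : PMF G :=
  (iid ν n).map List.prod

/-- The word norm with respect to a symmetric generating set `A`. -/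
def wordNorm {G : Type*} [Group G] (A : Set G) (g : G) : ℕ :=
  sInf {n | ∃ l : List G, l.length = n ∧ (∀ x ∈ l, x ∈ A) ∧ l.prod = g}

/-- The expected word norm of the `n`-th position of the random walk with step law `ν`
(all the step laws below are finitely supported, so the sum is finite). -/
def meanNorm {G : Type*} [Group G] (A : Set G) (ν : PMF G) (n : ℕ) : ℝ :=
  ∑' g, (walkLaw ν n g).toReal * (wordNorm A g : ℝ)

/-- The entropy `-∑ P(g) log P(g)` of the `n`-th position of the random walk with step law `ν`
(again a finite sum for finitely supported `ν`). -/
def walkEntropy {G : Type*} [Group G] (ν : PMF G) (n : ℕ) : ℝ :=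
  ∑' g, Real.negMulLog (walkLaw ν n g).toReal

/-- Linear interpolation of a sequence between the integers. -/
def interp (f : ℕ → ℝ) (x : ℝ) : ℝ :=
  f ⌊x⌋₊ + (x - ⌊x⌋₊) * (f (⌊x⌋₊ + 1) - f ⌊x⌋₊)

/-- `max_{k ≤ n} E|R_k|`, interpolated linearly. -/
def upperSpeed {G : Type*} [Group G] (A : Set G) (ν : PMF G) : ℝ → ℝ :=
  interp fun n => sSup (meanNorm A ν '' Set.Iic n)

/-- `inf_{k ≥ n} E|R_k|`, interpolated linearly. -/
def lowerSpeed {G : Type*} [Group G] (A : Set G) (ν : PMF G) : ℝ → ℝ :=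
  interp fun n => sInf (meanNorm A ν '' Set.Ici n)

/-- `H(R_n)`, interpolated linearly. -/
def entropyFun {G : Type*} [Group G] (ν : PMF G) : ℝ → ℝ :=
  interp (walkEntropy ν)

/-! Permutational wreath products -/

section Wreath

variable (Λ Γ S : Type*) [Group Λ] [Group Γ] [MulAction Γ S]

/-- The finitely supported functions from `S` to `Λ`, with pointwise multiplication. -/
def Lamps : Subgroup (S → Λ) where
  carrier := {f | (Function.mulSupport f).Finite}
  one_mem' := by simp
  mul_mem' {f g} hf hg := (hf.union hg).subset (Function.mulSupport_mul f g)
  inv_mem' {f} hf := by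
    change (Function.mulSupport f⁻¹).Finite
    rw [Function.mulSupport_inv]
    exact hf

/-- `Γ` permutes the coordinates. With the right action `s.g = g⁻¹ • s`, the function `ℓ` is
sent by `g` to `s ↦ ℓ (s.g)`. -/
def permuteLamps : Γ →* MulAut (Lamps Λ S) where
  toFun g :=
    { toFun := fun f => ⟨fun s => f.1 (g⁻¹ • s),
        f.2.preimage (MulAction.injective g⁻¹).injOn⟩
      invFun := fun f => ⟨fun s => f.1 (g • s), f.2.preimage (MulAction.injective g).injOn⟩
      left_inv := fun f => by ext s; simp
      right_inv := fun f => by ext s; simp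
      map_mul' := fun f f' => rfl }
  map_one' := by ext f s; simp
  map_mul' g g' := by ext f s; simp [mul_smul]

/-- The permutational wreath product: pairs `(ℓ, g)` multiplied by
`(ℓ, g) (ℓ', g') = (ℓ · (s ↦ ℓ' (s.g)), g g')`. -/
abbrev PermWreath : Type _ := Lamps Λ S ⋊[permuteLamps Λ Γ S] Γ

variable {Λ S}

open Classical in
/-- The element `(ℓ, 1)` with `ℓ o = a` and `ℓ s = 1` for `s ≠ o`. -/
def switch (o : S) (a : Λ) : PermWreath Λ Γ S :=
  SemidirectProduct.inl ⟨Pi.mulSingle o a,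
    (Set.finite_singleton o).subset Pi.mulSupport_mulSingle_subset⟩

variable {Γ}

/-- The step law of the switch-walk-switch walk: the law of `L̄ G L̄'`, where `L`, `G`, `L'` are
independent, `L` and `L'` have law `μ`, and `G` has law `γ`. -/
def swsStep (o : S) (μ : PMF Λ) (γ : PMF Γ) : PMF (PermWreath Λ Γ S) :=
  μ.bind fun a => γ.bind fun g => μ.bind fun b =>
    PMF.pure (switch Γ o a * SemidirectProduct.inr g * switch Γ o b)

/-- The generators of the wreath product: switches by elements of `A`, and elements of `B ⊆ Γ`. -/
def wreathGens (o : S) (A : Set Λ) (B : Set Γ) : Set (PermWreath Λ Γ S) :=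
  switch Γ o '' A ∪ (SemidirectProduct.inr : Γ →* PermWreath Λ Γ S) '' B

/-- `P(T > n)`, where `T = min {i ≥ 1 | o.(g₁ ⋯ gᵢ) = o}` is the first return time to `o` for
independent `gᵢ` of law `γ`; the right action is `o.g = g⁻¹ • o`. -/
def returnTail (o : S) (γ : PMF Γ) (n : ℕ) : ℝ :=
  ((iid γ n).toOuterMeasure
    {l | ∀ i : ℕ, 1 ≤ i → i ≤ n → (l.take i).prod⁻¹ • o ≠ o}).toReal

end Wreath

/-! Piecewise mother groups -/

/-- A bounded sequence of degrees at least two; `m.deg i` is the degree of level `i`, that is,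
`m_{i+1}` if the sequence is numbered from one. -/
structure DegreeSeq where
  deg : ℕ → ℕ
  two_le : ∀ i, 2 ≤ deg i
  bounded : BddAbove (Set.range deg)

namespace DegreeSeq

variable (m : DegreeSeq)

/-- The maximal degree. -/
def maxDeg : ℕ := sSup (Set.range m.deg)

/-- The infinite strings `⋯ a₃ a₂ a₁`, that is, the boundary of the spherically symmetric rooted
tree with degree sequence `m`; the digit `x i` is `a_{i+1}`. A rooted automorphism of the tree is
determined by the permutation of the boundary that it induces, and composition corresponds to
composition, so groups of rooted automorphisms are taken as groups of permutations of the
boundary. -/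
abbrev Ray : Type := ∀ i, Fin (m.deg i)

/-- The all-zero ray. -/
def zeroRay : m.Ray := fun i => ⟨0, lt_of_lt_of_le Nat.zero_lt_two (m.two_le i)⟩

/-- The automorphism `⟨id, …, id⟩ σ`, which permutes the subtrees of the root. -/
def rootPerm (σ : Equiv.Perm (Fin (m.deg 0))) : Equiv.Perm m.Ray where
  toFun x := Function.update x 0 (σ (x 0))
  invFun x := Function.update x 0 (σ.symm (x 0))
  left_inv x := by simp
  right_inv x := by simp

variable {m} in
/-- The first nonzero digit of `x` is `x i`. -/
def FirstNonzero (x : m.Ray) (i : ℕ) : Prop :=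
  (∀ j < i, (x j : ℕ) = 0) ∧ (x i : ℕ) ≠ 0

open Classical in
/-- Apply a permutation of the digits of each level to the digit that follows the first nonzero
digit, and leave all other digits alone. -/
def twist (τ : ∀ i, Equiv.Perm (Fin (m.deg i))) (x : m.Ray) : m.Ray
  | 0 => x 0
  | i + 1 => if FirstNonzero x i then τ (i + 1) (x (i + 1)) else x (i + 1)

theorem firstNonzero_twist (τ : ∀ i, Equiv.Perm (Fin (m.deg i))) (x : m.Ray) (i : ℕ) :
    FirstNonzero (m.twist τ x) i ↔ FirstNonzero x i := by
  have keep : ∀ j, (∀ k < j, (x k : ℕ) = 0) → m.twist τ x j = x j := by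
    intro j hj
    cases j with
    | zero => rfl
    | succ j =>
      have : ¬ FirstNonzero x j := fun h => h.2 (hj j (Nat.lt_succ_self j))
      simp [twist, this]
  have low : ∀ j, (∀ k < j, (m.twist τ x k : ℕ) = 0) → ∀ k < j, (x k : ℕ) = 0 := by
    intro j
    induction j with
    | zero => intro _ k hk; omega
    | succ j ih =>
      intro h k hk
      have h' := ih fun k hk => h k (by omega)
      rcases Nat.lt_succ_iff_lt_or_eq.mp hk with hk | rfl
      · exact h' k hk
      · rw [← keep k h']; exact h k hk
  constructor
  · rintro ⟨h1, h2⟩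
    have h := low i h1
    exact ⟨h, by rwa [← keep i h]⟩
  · rintro ⟨h1, h2⟩
    refine ⟨fun j hj => ?_, by rwa [keep i h1]⟩
    rw [keep j fun k hk => h1 k (hk.trans hj)]
    exact h1 j hj

/-- The automorphism `ρ` with `ρ_ℓ = ⟨ρ_{ℓ+1}, τ_{ℓ+1}, …, τ_{ℓ+1}⟩`, where `τ_ℓ` is the cyclic
permutation of `{0, …, m_ℓ - 1}`: it fixes the digits up to and including the first nonzero one,
and adds one to the next digit. -/
def rho : Equiv.Perm m.Ray where
  toFun := m.twist fun i => finRotate (m.deg i)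
  invFun := m.twist fun i => (finRotate (m.deg i)).symm
  left_inv x := by
    funext i
    cases i with
    | zero => rfl
    | succ i =>
      by_cases h : FirstNonzero x i
      · simp only [twist.eq_2, firstNonzero_twist, h, if_true]
        exact Equiv.symm_apply_apply _ _
      · simp [twist.eq_2, firstNonzero_twist, h]
  right_inv x := by
    funext i
    cases i with
    | zero => rfl
    | succ i =>
      by_cases h : FirstNonzero x i
      · simp only [twist.eq_2, firstNonzero_twist, h, if_true]
        exact Equiv.apply_symm_apply _ _
      · simp [twist.eq_2, firstNonzero_twist, h]

/-- The piecewise mother group: the group generated by all `⟨id, …, id⟩ σ` and the powers of `ρ`. -/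
def motherGroup : Subgroup (Equiv.Perm m.Ray) :=
  Subgroup.closure (Set.range m.rootPerm ∪ {m.rho})

/-- `⟨id, …, id⟩ σ` as an element of the mother group. -/
def rootElt (σ : Equiv.Perm (Fin (m.deg 0))) : m.motherGroup :=
  ⟨m.rootPerm σ, Subgroup.subset_closure (Or.inl ⟨σ, rfl⟩)⟩

/-- `ρ` as an element of the mother group. -/
def rhoElt : m.motherGroup :=
  ⟨m.rho, Subgroup.subset_closure (Or.inr rfl)⟩

/-- The least common multiple of `m₂, m₃, …`, which is the order of `ρ`. -/
def period : ℕ := sInf {k | 0 < k ∧ ∀ i, m.deg (i + 1) ∣ k}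

theorem period_pos : 0 < m.period := by
  have h : {k | 0 < k ∧ ∀ i, m.deg (i + 1) ∣ k}.Nonempty :=
    ⟨(m.maxDeg).factorial, Nat.factorial_pos _, fun i =>
      Nat.dvd_factorial (lt_of_lt_of_le Nat.zero_lt_two (m.two_le _))
        (le_csSup m.bounded ⟨i + 1, rfl⟩)⟩
  exact (Nat.sInf_mem h).1

/-- The step law on the mother group: with probability one half each, a uniform element of
`Π = {⟨id, …, id⟩ σ}` or a uniform element of the cyclic group `H = {ρ^i | 0 ≤ i < k}`. -/
def motherStep : PMF m.motherGroup :=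
  (PMF.uniformOfFintype Bool).bind fun b =>
    if b then (PMF.uniformOfFintype (Equiv.Perm (Fin (m.deg 0)))).map m.rootElt
    else (PMF.uniformOfFinset (Finset.range m.period)
      (Finset.nonempty_range_iff.mpr m.period_pos.ne')).map fun i => m.rhoElt ^ i

/-- The generating set `Π ∪ H` of the mother group. -/
def motherGens : Set m.motherGroup :=
  Set.range m.rootElt ∪ Set.range fun i : ℕ => m.rhoElt ^ i

/-- The orbit of the all-zero ray under the mother group. -/
abbrev Site : Type := MulAction.orbit m.motherGroup m.zeroRay

/-- The root of the orbit: the all-zero ray. -/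
def rootSite : m.Site := ⟨m.zeroRay, MulAction.mem_orbit_self _⟩

/-- `P(T > n)` for the first return time `T` of the all-zero ray. -/
def tail (n : ℕ) : ℝ := returnTail m.rootSite m.motherStep n

end DegreeSeq

/-- The wreath product of `Λ` with the mother group, over the orbit of the all-zero ray. -/
abbrev MotherWreath (Λ : Type*) [Group Λ] (m : DegreeSeq) : Type _ :=
  PermWreath Λ m.motherGroup m.Site

/-- The step law of the switch-walk-switch walk `X_n`, with switches of law `μ`. -/
def walkStep {Λ : Type*} [Group Λ] (m : DegreeSeq) (μ : PMF Λ) : PMF (MotherWreath Λ m) :=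
  swsStep m.rootSite μ m.motherStep

/-- The generating set of the wreath product that consists of the switches by elements of `A`
and of the elements of `Π` and `H`. -/
def walkGens {Λ : Type*} [Group Λ] (m : DegreeSeq) (A : Set Λ) : Set (MotherWreath Λ m) :=
  wreathGens m.rootSite A m.motherGens

end SwitchWalk

end

noncomputable section

namespace SwitchWalk

open Finset

/-! ### Expectation and entropy of finitely supported laws -/

section Expectation

variable {α β δ : Type*}

/-! Condition on the steps `w` in the base group. The lamps are then independent, and the lamp at
`s` is a position of the random walk on `Λ` at time `switches o w s` (`isLampLaw_pathLaw`). So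
everything reduces to the local times of the inverted orbit `visited o w`. The switches total `2n`.
The mean number of visited sites is `∑ P(T > i)`, hence at most `q` (`pexp_card_visited`). The mean
number of visits to any one site, times `P(T > n)`, is at most one, so the sum of the squared local
times has mean `O(n/p)` (`pexp_sum_sq_visits_mul_le`).

Lower bounds: the word norm dominates the sum of the lamp norms, and the entropy dominates the
conditional entropy given the steps. Both are sums of a nonnegative subadditive sequence over the
local times. By the second moment, enough of the total is spent at sites with `O(1/p)` switches,
where subadditivity gives a linear comparison (`mul_interp_le_pexp_sum`). Upper bounds: the same
sums are estimated by cutting each local time into pieces of length about `n/q`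
(`pexp_sum_le_mul_interp`), and the cost of the base path is added.

This cost is controlled by a Kraft inequality. Since `ρ` acts on the subtree at `0` as `ρ` and on
the others as a root permutation, the product and the inverted orbit of a word are coded by a finite
tree, branching only while at least two sites remain. Its length is linear in the number of sites,
with constants that involve only the maximal degree (`sum_siteWeight_pow_le_one`). For the entropy
this bounds the information in the product, the orbit and the numbers of switches
(`ent_pathData_le`).

For the speed, a short word with the same product must cover the inverted orbit. Replace the lamps
by fair coins: the entropy of the resulting walk is `O(q)`, without a logarithm. A Lipschitz
function of a symmetric walk has mean at most `1 + 2√(n · entropy)` (`pexp_walkLaw_le_sqrt`), so the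
covering word has mean length `O(1 + √(nq))`, where `√(nq) = q√(n/q)`. This is absorbed by the
lamps, because on an infinite group `max_{k ≤ t} E|R_k| ≥ c√t` (`exists_sqrt_le_runMax`). The last
fact comes from the regular representation. Without a spectral gap, almost harmonic vectors give
cocycles that grow diffusively, like martingales; with a gap, the lazy averaging operator is a
strict contraction and the running maximum grows linearly. Only `c` depends on `(Λ, A, μ)`. -/

/-- The expectation of `f` under `p`. -/
def pexp (p : PMF α) (f : α → ℝ) : ℝ := ∑' a, (p a).toReal * f a

/-- The entropy of `p`. -/
def ent (p : PMF α) : ℝ := ∑' a, Real.negMulLog (p a).toReal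

theorem ent_eq_pexp (p : PMF α) : ent p = pexp p fun a => -Real.log (p a).toReal := by
  unfold ent pexp
  refine tsum_congr fun a => ?_
  rw [Real.negMulLog]; ring

theorem toReal_ne_zero_iff (p : PMF α) (a : α) : (p a).toReal ≠ 0 ↔ a ∈ p.support := by
  rw [PMF.mem_support_iff, Ne, ENNReal.toReal_eq_zero_iff]
  simp [p.apply_ne_top a]

theorem toReal_pos_of_mem {p : PMF α} {a : α} (h : a ∈ p.support) : 0 < (p a).toReal :=
  lt_of_le_of_ne ENNReal.toReal_nonneg ((toReal_ne_zero_iff p a).2 h).symm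

theorem toReal_le_one (p : PMF α) (a : α) : (p a).toReal ≤ 1 :=
  ENNReal.toReal_le_of_le_ofReal zero_le_one (by simpa using p.coe_le_one a)

theorem pexp_eq_sum {p : PMF α} (s : Finset α) (hs : p.support ⊆ s) (f : α → ℝ) :
    pexp p f = ∑ a ∈ s, (p a).toReal * f a := by
  refine tsum_eq_sum fun a ha => ?_
  have : a ∉ p.support := fun h => ha (hs h)
  rw [PMF.mem_support_iff, not_not] at this
  simp [this]

theorem sum_toReal_eq_one {p : PMF α} (s : Finset α) (hs : p.support ⊆ s) :
    ∑ a ∈ s, (p a).toReal = 1 := by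
  have h : ∑' a, p a = ∑ a ∈ s, p a := tsum_eq_sum fun a ha => by
    by_contra h
    exact ha (hs h)
  rw [← ENNReal.toReal_sum fun a _ => p.apply_ne_top a, ← h, p.tsum_coe, ENNReal.toReal_one]

theorem pexp_congr {p : PMF α} {f g : α → ℝ} (h : ∀ a ∈ p.support, f a = g a) :
    pexp p f = pexp p g := by
  refine tsum_congr fun a => ?_
  by_cases ha : a ∈ p.support
  · rw [h a ha]
  · rw [PMF.mem_support_iff, not_not] at ha
    simp [ha]

theorem pexp_mono {p : PMF α} (hp : p.support.Finite) {f g : α → ℝ}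
    (h : ∀ a ∈ p.support, f a ≤ g a) : pexp p f ≤ pexp p g := by
  rw [pexp_eq_sum hp.toFinset (by simp), pexp_eq_sum hp.toFinset (by simp)]
  refine sum_le_sum fun a ha => mul_le_mul_of_nonneg_left (h a (by simpa using ha)) ?_
  exact ENNReal.toReal_nonneg

theorem pexp_nonneg {p : PMF α} {f : α → ℝ} (h : ∀ a, 0 ≤ f a) : 0 ≤ pexp p f :=
  tsum_nonneg fun a => mul_nonneg ENNReal.toReal_nonneg (h a)

theorem pexp_const {p : PMF α} (hp : p.support.Finite) (c : ℝ) : pexp p (fun _ => c) = c := by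
  rw [pexp_eq_sum hp.toFinset (by simp), ← sum_mul, sum_toReal_eq_one _ (by simp), one_mul]

theorem pexp_add {p : PMF α} (hp : p.support.Finite) (f g : α → ℝ) :
    pexp p (fun a => f a + g a) = pexp p f + pexp p g := by
  simp only [pexp_eq_sum hp.toFinset (show p.support ⊆ hp.toFinset by simp), mul_add,
    sum_add_distrib]

theorem pexp_sub {p : PMF α} (hp : p.support.Finite) (f g : α → ℝ) :
    pexp p (fun a => f a - g a) = pexp p f - pexp p g := by
  simp only [pexp_eq_sum hp.toFinset (show p.support ⊆ hp.toFinset by simp), mul_sub,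
    sum_sub_distrib]

theorem pexp_mul_left (p : PMF α) (c : ℝ) (f : α → ℝ) :
    pexp p (fun a => c * f a) = c * pexp p f := by
  unfold pexp
  rw [← tsum_mul_left]
  exact tsum_congr fun a => by ring

theorem pexp_mul_right (p : PMF α) (c : ℝ) (f : α → ℝ) :
    pexp p (fun a => f a * c) = pexp p f * c := by
  rw [mul_comm, ← pexp_mul_left]
  simp only [mul_comm]

theorem pexp_sum {ι : Type*} {p : PMF α} (hp : p.support.Finite) (s : Finset ι)
    (f : ι → α → ℝ) : pexp p (fun a => ∑ i ∈ s, f i a) = ∑ i ∈ s, pexp p (f i) := by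
  simp only [pexp_eq_sum hp.toFinset (show p.support ⊆ hp.toFinset by simp), mul_sum]
  exact sum_comm

theorem pexp_pure (a : α) (f : α → ℝ) : pexp (PMF.pure a) f = f a := by
  rw [pexp_eq_sum {a} (by simp)]
  simp

theorem finite_support_bind {p : PMF α} {k : α → PMF β} (hp : p.support.Finite)
    (hk : ∀ a ∈ p.support, (k a).support.Finite) : (p.bind k).support.Finite := by
  rw [PMF.support_bind]
  exact hp.biUnion hk

theorem finite_support_map {p : PMF α} (f : α → β) (hp : p.support.Finite) :
    (p.map f).support.Finite := by
  rw [PMF.support_map]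
  exact hp.image f

theorem finite_support_pure (a : α) : (PMF.pure a).support.Finite := by simp

theorem bind_toReal {p : PMF α} (k : α → PMF β) (hp : p.support.Finite) (b : β) :
    (p.bind k b).toReal = pexp p fun a => (k a b).toReal := by
  rw [PMF.bind_apply, tsum_eq_sum (s := hp.toFinset), ENNReal.toReal_sum,
    pexp_eq_sum hp.toFinset (by simp)]
  · simp
  · exact fun a _ => ENNReal.mul_ne_top (p.apply_ne_top a) ((k a).apply_ne_top b)
  · intro a ha
    simp only [Set.Finite.mem_toFinset, PMF.mem_support_iff, not_not] at ha
    simp [ha]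

theorem pexp_bind {p : PMF α} {k : α → PMF β} (hp : p.support.Finite)
    (hk : ∀ a ∈ p.support, (k a).support.Finite) (f : β → ℝ) :
    pexp (p.bind k) f = pexp p fun a => pexp (k a) f := by
  have hb := finite_support_bind hp hk
  rw [pexp_eq_sum hb.toFinset (by simp)]
  simp only [bind_toReal k hp, ← pexp_mul_right]
  rw [← pexp_sum hp]
  refine pexp_congr fun a ha => ?_
  rw [pexp_eq_sum hb.toFinset]
  intro b hb'
  simp only [Set.Finite.coe_toFinset, PMF.support_bind, Set.mem_iUnion]
  exact ⟨a, ha, hb'⟩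

theorem pexp_map {p : PMF α} (g : α → β) (hp : p.support.Finite) (f : β → ℝ) :
    pexp (p.map g) f = pexp p fun a => f (g a) := by
  rw [PMF.map, pexp_bind hp (by simp)]
  simp [pexp_pure]

theorem pexp_comm {p : PMF α} {q : PMF β} (hp : p.support.Finite) (hq : q.support.Finite)
    (f : α → β → ℝ) :
    pexp p (fun a => pexp q fun b => f a b) = pexp q fun b => pexp p fun a => f a b := by
  simp only [pexp_eq_sum hp.toFinset (show p.support ⊆ hp.toFinset by simp),
    pexp_eq_sum hq.toFinset (show q.support ⊆ hq.toFinset by simp), mul_sum]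
  rw [sum_comm]
  exact sum_congr rfl fun b _ => sum_congr rfl fun a _ => by ring

theorem sq_pexp_le {p : PMF α} (hp : p.support.Finite) (f : α → ℝ) :
    (pexp p f) ^ 2 ≤ pexp p fun a => f a ^ 2 := by
  have h : 0 ≤ pexp p fun a => (f a - pexp p f) ^ 2 := pexp_nonneg fun a => sq_nonneg _
  have e : (fun a => (f a - pexp p f) ^ 2)
      = fun a => (f a ^ 2 - (2 * pexp p f) * f a) + (pexp p f) ^ 2 := by
    funext a; ring
  rw [e, pexp_add hp, pexp_sub hp, pexp_mul_left, pexp_const hp] at h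
  nlinarith

/-- Gibbs' inequality. -/
theorem ent_le_of_weight {p : PMF α} (hp : p.support.Finite) (Q : α → ℝ)
    (hQ : ∀ a ∈ p.support, 0 < Q a) (hsum : ∑ a ∈ hp.toFinset, Q a ≤ 1) :
    ent p ≤ pexp p fun a => -Real.log (Q a) := by
  rw [ent_eq_pexp, ← sub_nonneg, ← pexp_sub hp]
  have key : pexp p (fun a => 1 - Q a / (p a).toReal) ≤
      pexp p fun a => -Real.log (Q a) - -Real.log (p a).toReal := by
    refine pexp_mono hp fun a ha => ?_
    have h1 := toReal_pos_of_mem ha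
    have h2 := Real.log_le_sub_one_of_pos (div_pos (hQ a ha) h1)
    rw [Real.log_div (hQ a ha).ne' h1.ne'] at h2
    linarith
  refine le_trans ?_ key
  rw [pexp_sub hp, pexp_const hp, pexp_eq_sum hp.toFinset (by simp), sub_nonneg]
  refine le_trans (le_of_eq (sum_congr rfl fun a ha => ?_)) hsum
  have h1 := toReal_pos_of_mem (p := p) (a := a) (by simpa using ha)
  field_simp

theorem map_apply_ge (p : PMF α) (f : α → β) (a : α) :
    (p a).toReal ≤ (p.map f (f a)).toReal := by
  refine ENNReal.toReal_mono (PMF.apply_ne_top _ _) ?_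
  rw [PMF.map_apply]
  refine le_trans (le_of_eq ?_) (ENNReal.le_tsum a)
  simp

theorem ent_map_le {p : PMF α} (hp : p.support.Finite) (f : α → β) : ent (p.map f) ≤ ent p := by
  rw [ent_eq_pexp, ent_eq_pexp, pexp_map f hp]
  refine pexp_mono hp fun a ha => neg_le_neg (Real.log_le_log (toReal_pos_of_mem ha) ?_)
  exact map_apply_ge p f a

theorem ent_map_injective {p : PMF α} (hp : p.support.Finite) {f : α → β}
    (hf : Function.Injective f) : ent (p.map f) = ent p := by
  rw [ent_eq_pexp, ent_eq_pexp, pexp_map f hp]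
  refine pexp_congr fun a _ => ?_
  rw [PMF.map_apply, tsum_eq_single a]
  · simp
  · intro b hb
    rw [if_neg fun h => hb (hf h).symm]

/-- Conditioning lowers entropy: Gibbs' inequality for each `k a`, with the mixture itself as the
weight. -/
theorem ent_bind_ge {p : PMF α} {k : α → PMF β} (hp : p.support.Finite)
    (hk : ∀ a ∈ p.support, (k a).support.Finite) :
    pexp p (fun a => ent (k a)) ≤ ent (p.bind k) := by
  rw [ent_eq_pexp (p.bind k), pexp_bind hp hk]
  refine pexp_mono hp fun a ha => ?_
  refine ent_le_of_weight (hk a ha) _ (fun b hb => toReal_pos_of_mem ?_) ?_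
  · rw [PMF.mem_support_bind_iff]
    exact ⟨a, ha, hb⟩
  · refine le_trans (sum_le_sum_of_subset_of_nonneg (t := (finite_support_bind hp hk).toFinset)
      ?_ fun _ _ _ => ENNReal.toReal_nonneg) (sum_toReal_eq_one _ (by simp)).le
    intro b hb
    simp only [Set.Finite.mem_toFinset] at hb ⊢
    rw [PMF.mem_support_bind_iff]
    exact ⟨a, ha, hb⟩

theorem bind_apply_ge (p : PMF α) (k : α → PMF β) (a : α) (b : β) :
    (p a).toReal * (k a b).toReal ≤ (p.bind k b).toReal := by
  rw [← ENNReal.toReal_mul]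
  refine ENNReal.toReal_mono (PMF.apply_ne_top _ _) ?_
  rw [PMF.bind_apply]
  exact ENNReal.le_tsum a

/-- The mixture charges `b` with at least `p a * k a b`, so its information at `b` is at most that
of `a` plus that of `b` given `a`. -/
theorem ent_bind_le {p : PMF α} {k : α → PMF β} (hp : p.support.Finite)
    (hk : ∀ a ∈ p.support, (k a).support.Finite) :
    ent (p.bind k) ≤ ent p + pexp p fun a => ent (k a) := by
  rw [ent_eq_pexp (p.bind k), pexp_bind hp hk, ent_eq_pexp p, ← pexp_add hp]
  refine pexp_mono hp fun a ha => ?_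
  rw [ent_eq_pexp, ← pexp_const (hk a ha) (-Real.log (p a).toReal), ← pexp_add (hk a ha)]
  refine pexp_mono (hk a ha) fun b hb => ?_
  have h1 := toReal_pos_of_mem ha
  have h2 := toReal_pos_of_mem hb
  rw [← neg_add, ← Real.log_mul h1.ne' h2.ne']
  exact neg_le_neg (Real.log_le_log (mul_pos h1 h2) (bind_apply_ge p k a b))

theorem ent_nonneg (p : PMF α) : 0 ≤ ent p :=
  tsum_nonneg fun a => Real.negMulLog_nonneg ENNReal.toReal_nonneg (toReal_le_one p a)

theorem ent_pure (a : α) : ent (PMF.pure a) = 0 := by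
  rw [ent_eq_pexp, pexp_pure]
  simp

/-- The entropy of a pair, estimated by a weight for the first entry and a count for the second. -/
theorem ent_le_of_weight_of_card {p : PMF (α × δ)} (hp : p.support.Finite) (Q : α → ℝ)
    (F : α → Finset δ) (hQ : ∀ z ∈ p.support, 0 < Q z.1)
    (hF : ∀ z ∈ p.support, z.2 ∈ F z.1)
    (hsum : ∀ s : Finset α, (∀ a ∈ s, ∃ d, (a, d) ∈ p.support) → ∑ a ∈ s, Q a ≤ 1) :
    ent p ≤ pexp p fun z => -Real.log (Q z.1) + Real.log ((F z.1).card) := by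
  classical
  have hc : ∀ z ∈ p.support, (0 : ℝ) < (F z.1).card := fun z hz => by
    exact_mod_cast Finset.card_pos.2 ⟨_, hF z hz⟩
  refine le_trans (ent_le_of_weight hp (fun z => Q z.1 / (F z.1).card)
    (fun z hz => div_pos (hQ z hz) (hc z hz)) ?_) (le_of_eq (pexp_congr fun z hz => ?_))
  · set s := hp.toFinset.image Prod.fst
    have hs : ∀ a ∈ s, ∃ d, (a, d) ∈ p.support := by
      intro a ha
      obtain ⟨z, hz, rfl⟩ := Finset.mem_image.1 ha
      exact ⟨z.2, by simpa using hz⟩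
    refine le_trans ?_ (hsum s hs)
    rw [← sum_fiberwise_of_maps_to (t := s) (g := Prod.fst)
      fun z hz => Finset.mem_image_of_mem _ hz]
    refine sum_le_sum fun a ha => ?_
    obtain ⟨d, hd⟩ := hs a ha
    have h0 := hc _ hd
    have hcard : (hp.toFinset.filter fun z => z.1 = a).card ≤ (F a).card := by
      refine Finset.card_le_card_of_injOn Prod.snd ?_ ?_
      · intro z hz
        simp only [coe_filter, Set.Finite.mem_toFinset, Set.mem_ofPred_eq] at hz
        exact hz.2 ▸ hF z hz.1
      · intro z hz z' hz' h
        simp only [coe_filter, Set.Finite.mem_toFinset, Set.mem_ofPred_eq] at hz hz'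
        exact Prod.ext (hz.2.trans hz'.2.symm) h
    calc ∑ z ∈ hp.toFinset.filter (fun z => z.1 = a), Q z.1 / (F z.1).card
        = ∑ z ∈ hp.toFinset.filter (fun z => z.1 = a), Q a / (F a).card :=
          sum_congr rfl fun z hz => by rw [(mem_filter.1 hz).2]
      _ = (hp.toFinset.filter fun z => z.1 = a).card * (Q a / (F a).card) := by
          rw [sum_const, nsmul_eq_mul]
      _ ≤ (F a).card * (Q a / (F a).card) :=
          mul_le_mul_of_nonneg_right (by exact_mod_cast hcard) (div_nonneg (hQ _ hd).le h0.le)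
      _ = Q a := mul_div_cancel₀ _ h0.ne'
  · rw [Real.log_div (hQ z hz).ne' (hc z hz).ne']
    ring

end Expectation

end SwitchWalk
end

noncomputable section

namespace SwitchWalk

open Finset

/-! ### Independent samples and random walks -/

section Walk

variable {α : Type*} {G : Type*} [Group G]

theorem finite_support_iid {ν : PMF α} (hν : ν.support.Finite) (n : ℕ) :
    (iid ν n).support.Finite := by
  induction n with
  | zero => exact finite_support_pure _
  | succ n ih => exact finite_support_bind hν fun a _ => finite_support_map _ ih

theorem finite_support_walkLaw {ν : PMF G} (hν : ν.support.Finite) (n : ℕ) :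
    (walkLaw ν n).support.Finite :=
  finite_support_map _ (finite_support_iid hν n)

theorem pexp_iid_zero (ν : PMF α) (F : List α → ℝ) : pexp (iid ν 0) F = F [] :=
  pexp_pure _ _

theorem pexp_iid_succ {ν : PMF α} (hν : ν.support.Finite) (n : ℕ) (F : List α → ℝ) :
    pexp (iid ν (n + 1)) F = pexp ν fun a => pexp (iid ν n) fun w => F (a :: w) := by
  rw [iid, pexp_bind hν fun a _ => finite_support_map _ (finite_support_iid hν n)]
  simp only [pexp_map _ (finite_support_iid hν n)]

theorem mem_support_iid {ν : PMF α} {n : ℕ} {w : List α} (h : w ∈ (iid ν n).support) :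
    w.length = n ∧ ∀ a ∈ w, a ∈ ν.support := by
  induction n generalizing w with
  | zero =>
    simp only [iid, PMF.support_pure, Set.mem_singleton_iff] at h
    simp [h]
  | succ n ih =>
    rw [iid, PMF.mem_support_bind_iff] at h
    obtain ⟨a, ha, h⟩ := h
    rw [PMF.mem_support_map_iff] at h
    obtain ⟨l, hl, rfl⟩ := h
    have := ih hl
    simp only [List.length_cons, this.1, List.mem_cons, forall_eq_or_imp, ha, true_and]
    exact this.2

theorem walkLaw_zero (ν : PMF G) : walkLaw ν 0 = PMF.pure 1 := by
  simp [walkLaw, iid, PMF.pure_map]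

theorem walkLaw_succ (ν : PMF G) (n : ℕ) :
    walkLaw ν (n + 1) = ν.bind fun a => (walkLaw ν n).map fun g => a * g := by
  simp only [walkLaw, iid, PMF.map_bind, PMF.map_comp]
  congr 1

theorem walkLaw_add (ν : PMF G) (m n : ℕ) :
    walkLaw ν (m + n) = (walkLaw ν m).bind fun g => (walkLaw ν n).map fun h => g * h := by
  induction m with
  | zero =>
    rw [walkLaw_zero, PMF.pure_bind]
    simp only [zero_add, one_mul]
    exact (PMF.map_id _).symm
  | succ m ih =>
    rw [Nat.add_right_comm, walkLaw_succ, ih, walkLaw_succ, PMF.bind_bind]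
    congr 1
    funext a
    rw [PMF.map_bind, PMF.bind_map]
    congr 1
    funext g
    rw [PMF.map_comp]
    simp only [Function.comp_def, mul_assoc]

theorem walkLaw_one (ν : PMF G) : walkLaw ν 1 = ν := by
  rw [walkLaw_succ, walkLaw_zero]
  simp only [PMF.pure_map, mul_one]
  exact PMF.bind_pure ν

theorem walkLaw_succ' (ν : PMF G) (n : ℕ) :
    walkLaw ν (n + 1) = (walkLaw ν n).bind fun g => ν.map fun h => g * h := by
  rw [walkLaw_add, walkLaw_one]

theorem pexp_walkLaw_succ {ν : PMF G} (hν : ν.support.Finite) (n : ℕ) (F : G → ℝ) :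
    pexp (walkLaw ν (n + 1)) F = pexp ν fun a => pexp (walkLaw ν n) fun g => F (a * g) := by
  rw [walkLaw_succ, pexp_bind hν fun a _ => finite_support_map _ (finite_support_walkLaw hν n)]
  simp only [pexp_map _ (finite_support_walkLaw hν n)]

theorem pexp_walkLaw_succ' {ν : PMF G} (hν : ν.support.Finite) (n : ℕ) (F : G → ℝ) :
    pexp (walkLaw ν (n + 1)) F = pexp (walkLaw ν n) fun g => pexp ν fun a => F (g * a) := by
  rw [walkLaw_succ', pexp_bind (finite_support_walkLaw hν n) fun a _ => finite_support_map _ hν]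
  simp only [pexp_map _ hν]

theorem walkEntropy_eq (ν : PMF G) (n : ℕ) : walkEntropy ν n = ent (walkLaw ν n) := rfl

theorem meanNorm_eq (A : Set G) (ν : PMF G) (n : ℕ) :
    meanNorm A ν n = pexp (walkLaw ν n) fun g => (wordNorm A g : ℝ) := rfl

theorem ent_map_mul_left {p : PMF G} (hp : p.support.Finite) (a : G) :
    ent (p.map fun g => a * g) = ent p :=
  ent_map_injective hp (mul_right_injective a)

theorem walkEntropy_zero (ν : PMF G) : walkEntropy ν 0 = 0 := by
  rw [walkEntropy_eq, walkLaw_zero, ent_pure]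

theorem walkEntropy_nonneg (ν : PMF G) (n : ℕ) : 0 ≤ walkEntropy ν n := ent_nonneg _

/-- Given the first letter, the longer walk is a translate of the shorter one and has the same
entropy. -/
theorem walkEntropy_mono {ν : PMF G} (hν : ν.support.Finite) : Monotone (walkEntropy ν) := by
  refine monotone_nat_of_le_succ fun n => ?_
  have hn := finite_support_walkLaw hν n
  have := ent_bind_ge (p := ν) (k := fun a => (walkLaw ν n).map fun g => a * g) hν
    fun a _ => finite_support_map _ hn
  simp only [ent_map_mul_left hn, pexp_const hν, ← walkLaw_succ] at this
  exact this

theorem walkEntropy_add_le {ν : PMF G} (hν : ν.support.Finite) (m n : ℕ) :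
    walkEntropy ν (m + n) ≤ walkEntropy ν m + walkEntropy ν n := by
  have hm := finite_support_walkLaw hν m
  have hn := finite_support_walkLaw hν n
  have := ent_bind_le (p := walkLaw ν m) (k := fun a => (walkLaw ν n).map fun g => a * g) hm
    fun a _ => finite_support_map _ hn
  simp only [ent_map_mul_left hn, pexp_const hm, ← walkLaw_add] at this
  exact this

end Walk

/-! ### Inverted orbits and their local times -/

section InvertedOrbit

variable {Γ S : Type*} [Group Γ] [MulAction Γ S] (o : S)

open Classical in
/-- The inverted orbit `{o, g₁ • o, g₁ g₂ • o, …}` of the word `g₁ g₂ ⋯`. -/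
def visited : List Γ → Finset S
  | [] => {o}
  | g :: w => insert o ((visited w).image fun s => g • s)

open Classical in
/-- The number of visits of the inverted orbit to a site. -/
def visits : List Γ → S → ℕ
  | [], s => if s = o then 1 else 0
  | g :: w, s => (if s = o then 1 else 0) + visits w (g⁻¹ • s)

open Classical in
/-- The number of switches at a site, with one switch before and one after each step. -/
def switches : List Γ → S → ℕ
  | [], _ => 0
  | g :: w, s => (if s = o then 1 else 0) + ((if s = g • o then 1 else 0) + switches w (g⁻¹ • s))

variable {o}

theorem mem_visited_cons {g : Γ} {w : List Γ} {s : S} :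
    s ∈ visited o (g :: w) ↔ s = o ∨ g⁻¹ • s ∈ visited o w := by
  classical
  simp only [visited, mem_insert, mem_image]
  refine or_congr_right ⟨?_, fun h => ⟨_, h, by simp⟩⟩
  rintro ⟨t, ht, rfl⟩
  simpa using ht

theorem self_mem_visited (w : List Γ) : o ∈ visited o w := by
  cases w <;> simp [visited]

theorem visits_ne_zero_iff {w : List Γ} {s : S} : visits o w s ≠ 0 ↔ s ∈ visited o w := by
  induction w generalizing s with
  | nil => simp [visits, visited]
  | cons g w ih => rw [mem_visited_cons, ← ih, visits]; split_ifs with h <;> simp [h]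

theorem mem_visited_of_switches_ne_zero {w : List Γ} {s : S} (h : switches o w s ≠ 0) :
    s ∈ visited o w := by
  induction w generalizing s with
  | nil => simp [switches] at h
  | cons g w ih =>
    rw [mem_visited_cons]
    by_contra hc
    push Not at hc
    have h1 : s ≠ g • o := fun h1 => hc.2 (by rw [h1, inv_smul_smul]; exact self_mem_visited w)
    simp [switches, hc.1, h1, show switches o w (g⁻¹ • s) = 0 from by_contra fun h => hc.2 (ih h)]
      at h

theorem switches_ne_zero_iff {w : List Γ} (hw : w ≠ []) {s : S} :
    switches o w s ≠ 0 ↔ s ∈ visited o w := by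
  refine ⟨mem_visited_of_switches_ne_zero, fun h => ?_⟩
  induction w generalizing s with
  | nil => exact absurd rfl hw
  | cons g w ih =>
    rw [mem_visited_cons] at h
    rcases h with h | h
    · simp [switches, h]
    · cases w with
      | nil =>
        simp only [visited, mem_singleton] at h
        have : s = g • o := by rw [← h, smul_inv_smul]
        simp [switches, this]
      | cons g' w =>
        have := ih (by simp) h
        rw [switches]
        omega

/-- Every interior time of the inverted orbit carries two switches, the first and the last time only
one. The deficit at `o` is kept because the induction needs it: it pays for the switch at `g • o`
that ends the first step. -/
theorem switches_add_le (w : List Γ) (s : S) [Decidable (s = o)] :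
    switches o w s + (if s = o then 1 else 0) ≤ 2 * visits o w s := by
  classical
  have : ∀ t : S, switches o w t + (if t = o then 1 else 0) ≤ 2 * visits o w t := by
    induction w with
    | nil => intro t; simp only [switches, visits]; split_ifs <;> simp
    | cons g w ih =>
      intro t
      have h := ih (g⁻¹ • t)
      simp only [switches, visits, inv_smul_eq_iff] at h ⊢
      split_ifs at h ⊢ <;> omega
  convert this s

theorem switches_le (w : List Γ) (s : S) : switches o w s ≤ 2 * visits o w s := by
  classical
  exact le_trans (Nat.le_add_right _ _) (switches_add_le w s)

theorem switches_le_length (w : List Γ) (s : S) : switches o w s ≤ 2 * w.length := by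
  induction w generalizing s with
  | nil => simp [switches]
  | cons g w ih =>
    have := ih (g⁻¹ • s)
    simp only [switches, List.length_cons]
    split_ifs <;> omega

theorem sum_smul_inv {M : Type*} [AddCommMonoid M] [DecidableEq S] (g : Γ) (T : Finset S)
    (f : S → M) : ∑ s ∈ T, f (g⁻¹ • s) = ∑ s ∈ T.image (fun s => g⁻¹ • s), f s := by
  rw [sum_image (MulAction.injective g⁻¹).injOn]

theorem visited_subset_of_cons [DecidableEq S] {g : Γ} {w : List Γ} {T : Finset S}
    (hT : visited o (g :: w) ⊆ T) :
    o ∈ T ∧ g • o ∈ T ∧ visited o w ⊆ T.image fun s => g⁻¹ • s := by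
  refine ⟨hT (self_mem_visited _), hT ?_, fun s hs => mem_image.2 ⟨g • s, hT ?_, by simp⟩⟩
  · rw [mem_visited_cons, inv_smul_smul]
    exact Or.inr (self_mem_visited w)
  · rw [mem_visited_cons, inv_smul_smul]
    exact Or.inr hs

theorem sum_switches {w : List Γ} {T : Finset S} (hT : visited o w ⊆ T) :
    ∑ s ∈ T, switches o w s = 2 * w.length := by
  classical
  induction w generalizing T with
  | nil => simp [switches]
  | cons g w ih =>
    obtain ⟨h1, h2, h3⟩ := visited_subset_of_cons hT
    simp only [switches, sum_add_distrib, sum_ite_eq', h1, h2, if_true, List.length_cons]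
    rw [sum_smul_inv g T, ih h3]
    ring

/-- Prepending `g` translates the local times and adds one visit at `o`; there the square grows from
`k²` to `(k + 1)²`, where `k = visits o w (g⁻¹ • o)`. -/
theorem sum_sq_visits {g : Γ} {w : List Γ} {T : Finset S} (hT : visited o (g :: w) ⊆ T) :
    ∑ s ∈ T, (visits o (g :: w) s : ℝ) ^ 2
      = 1 + 2 * visits o w (g⁻¹ • o) + ∑ s ∈ visited o w, (visits o w s : ℝ) ^ 2 := by
  classical
  obtain ⟨h1, h2, h3⟩ := visited_subset_of_cons hT
  have e : ∀ s, (visits o (g :: w) s : ℝ) ^ 2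
      = (if s = o then 1 + 2 * (visits o w (g⁻¹ • o) : ℝ) else 0)
        + (visits o w (g⁻¹ • s) : ℝ) ^ 2 := by
    intro s
    simp only [visits, Nat.cast_add]
    split_ifs with h
    · subst h; push_cast; ring
    · push_cast; ring
  simp only [e, sum_add_distrib, sum_ite_eq', h1, if_true]
  congr 1
  rw [sum_smul_inv g T (fun s => (visits o w s : ℝ) ^ 2)]
  refine (sum_subset h3 fun s _ hs => ?_).symm
  rw [← visits_ne_zero_iff, not_not] at hs
  simp [hs]

theorem card_visited_cons (g : Γ) (w : List Γ) [Decidable (g⁻¹ • o ∈ visited o w)] :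
    ((visited o (g :: w)).card : ℝ)
      = (visited o w).card + if g⁻¹ • o ∈ visited o w then 0 else 1 := by
  classical
  have h : o ∈ (visited o w).image (fun s => g • s) ↔ g⁻¹ • o ∈ visited o w := by
    rw [mem_image]
    exact ⟨by rintro ⟨t, ht, h⟩; rwa [inv_smul_eq_iff.2 h.symm], fun h => ⟨_, h, smul_inv_smul _ _⟩⟩
  rw [visited]
  split_ifs with h'
  · rw [insert_eq_of_mem (h.2 h'), card_image_of_injective _ (MulAction.injective g), add_zero]
  · rw [card_insert_of_notMem (mt h.1 h'), card_image_of_injective _ (MulAction.injective g)]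
    push_cast; rfl

theorem mem_visited_iff {w : List Γ} {s : S} :
    s ∈ visited o w ↔ ∃ i ≤ w.length, (w.take i).prod • o = s := by
  induction w generalizing s with
  | nil => simp [visited, eq_comm]
  | cons g w ih =>
    rw [mem_visited_cons, ih]
    constructor
    · rintro (h | ⟨i, hi, h⟩)
      · exact ⟨0, by simp, by simp [h]⟩
      · exact ⟨i + 1, by simpa using hi, by simp [mul_smul, h]⟩
    · rintro ⟨i, hi, h⟩
      cases i with
      | zero => left; simpa using h.symm
      | succ i => right; exact ⟨i, by simpa using hi, by simp [← h, mul_smul]⟩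

theorem visited_append {v w : List Γ} {s : S} :
    s ∈ visited o (v ++ w) ↔ s ∈ visited o v ∨ v.prod⁻¹ • s ∈ visited o w := by
  induction v generalizing s with
  | nil =>
    simp only [List.nil_append, visited, mem_singleton, List.prod_nil, inv_one, one_smul]
    exact ⟨Or.inr, by rintro (rfl | h); exacts [self_mem_visited w, h]⟩
  | cons g v ih =>
    simp only [List.cons_append, mem_visited_cons, ih, List.prod_cons, mul_inv_rev, mul_smul,
      or_assoc]

/-! ### The return time -/

theorem toOuterMeasure_toReal {α : Type*} {p : PMF α} (hp : p.support.Finite) (A : Set α)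
    [DecidablePred (· ∈ A)] :
    (p.toOuterMeasure A).toReal = pexp p fun a => if a ∈ A then 1 else 0 := by
  rw [PMF.toOuterMeasure_apply, tsum_eq_sum (s := hp.toFinset), ENNReal.toReal_sum,
    pexp_eq_sum hp.toFinset (by simp)]
  · refine sum_congr rfl fun a _ => ?_
    by_cases h : a ∈ A <;> simp [h]
  · intro a _
    by_cases h : a ∈ A <;> simp [h, p.apply_ne_top]
  · intro a ha
    simp only [Set.Finite.mem_toFinset, PMF.mem_support_iff, not_not] at ha
    by_cases h : a ∈ A <;> simp [h, ha]

variable {γ : PMF Γ}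

theorem returnTail_zero : returnTail o γ 0 = 1 := by
  classical
  rw [returnTail, iid, toOuterMeasure_toReal (finite_support_pure _), pexp_pure, if_pos]
  intro i h1 h2
  omega

-- The equation `(g w₁⋯wᵢ)⁻¹ • o = o` says `w₁⋯wᵢ • o = g⁻¹ • o`. So there is no return by time `n +
-- 1` exactly when the inverted orbit of the remaining `n` letters misses `g⁻¹ • o`, which is also
-- when prepending `g` creates a new site.
open Classical in
theorem returnTail_succ (hγ : γ.support.Finite) (n : ℕ) :
    returnTail o γ (n + 1)
      = pexp γ fun g => pexp (iid γ n) fun w => if g⁻¹ • o ∈ visited o w then 0 else 1 := by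
  rw [returnTail, toOuterMeasure_toReal (finite_support_iid hγ _), pexp_iid_succ hγ]
  refine pexp_congr fun g _ => pexp_congr fun w hw => ?_
  have hl := (mem_support_iid hw).1
  have key : (∀ i : ℕ, 1 ≤ i → i ≤ n + 1 → ((g :: w).take i).prod⁻¹ • o ≠ o) ↔
      g⁻¹ • o ∉ visited o w := ?_
  · by_cases h : g⁻¹ • o ∈ visited o w
    · rw [if_pos h, if_neg]
      exact fun h' => key.1 h' h
    · rw [if_neg h, if_pos]
      exact key.2 h
  rw [mem_visited_iff]
  push Not
  simp only [hl]
  constructor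
  · intro h i hi he
    refine h (i + 1) (by omega) (by omega) ?_
    simp [mul_smul, ← he]
  · intro h i h1 h2 he
    obtain ⟨j, rfl⟩ : ∃ j, i = j + 1 := ⟨i - 1, by omega⟩
    refine h j (by omega) ?_
    rw [inv_smul_eq_iff] at he
    simp only [List.take_succ_cons, List.prod_cons, mul_smul] at he
    rw [eq_inv_smul_iff, ← he]

/-- Prepending a letter enlarges the inverted orbit exactly on the event described by
`returnTail_succ`, so the increment of the mean is a return tail. -/
theorem pexp_card_visited (hγ : γ.support.Finite) (n : ℕ) :
    pexp (iid γ n) (fun w => ((visited o w).card : ℝ))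
      = ∑ i ∈ range (n + 1), returnTail o γ i := by
  classical
  induction n with
  | zero => simp [pexp_iid_zero, visited, returnTail_zero]
  | succ n ih =>
    have h := finite_support_iid hγ n
    rw [pexp_iid_succ hγ, sum_range_succ, ← ih, returnTail_succ hγ]
    simp only [card_visited_cons, pexp_add h, pexp_add hγ, pexp_const hγ]

theorem returnTail_nonneg (n : ℕ) : 0 ≤ returnTail o γ n := ENNReal.toReal_nonneg

/-- The events for different `n` live on words of different lengths, so they are not literally
nested. Induction on the first letter shows instead that the probability of missing any given site
decreases in `n`. -/
theorem returnTail_anti (hγ : γ.support.Finite) : Antitone (returnTail o γ) := by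
  classical
  have hle : ∀ n (x : S), pexp (iid γ (n + 1)) (fun w => if x ∈ visited o w then (0 : ℝ) else 1)
      ≤ pexp (iid γ n) fun w => if x ∈ visited o w then 0 else 1 := by
    intro n
    induction n with
    | zero =>
      intro x
      rw [pexp_iid_succ hγ, pexp_iid_zero]
      simp only [pexp_iid_zero]
      rw [← pexp_const hγ (if x ∈ visited o ([] : List Γ) then (0 : ℝ) else 1)]
      refine pexp_mono hγ fun g _ => ?_
      by_cases hx : x = o
      · simp [hx, self_mem_visited]
      · rw [if_neg (c := x ∈ visited o []) (by simpa [visited] using hx)]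
        split_ifs <;> simp
    | succ n ih =>
      intro x
      rw [pexp_iid_succ hγ, pexp_iid_succ hγ n]
      refine pexp_mono hγ fun g _ => ?_
      simp only [mem_visited_cons]
      by_cases hx : x = o
      · simp only [hx, true_or, if_true]
        rw [pexp_const (finite_support_iid hγ _), pexp_const (finite_support_iid hγ _)]
      · simp only [hx, false_or]
        exact ih _
  refine antitone_nat_of_succ_le fun n => ?_
  cases n with
  | zero =>
    rw [returnTail_zero, returnTail_succ hγ]
    refine le_trans (pexp_mono hγ (g := fun _ => 1) fun g _ => ?_) (pexp_const hγ 1).le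
    rw [pexp_iid_zero]
    by_cases h : g⁻¹ • o ∈ visited o ([] : List Γ) <;> simp [h]
  | succ n =>
    rw [returnTail_succ hγ, returnTail_succ hγ]
    exact pexp_mono hγ fun g _ => hle n _

/-- The expected number of visits to a site until time `n`, times `P(T > N)` for some `N ≥ n`, is
at most the probability of hitting the site. -/
theorem pexp_visits_mul_tail_le (hγ : γ.support.Finite) {t : ℝ} {n : ℕ}
    (ht : t ≤ returnTail o γ n) (x : S) :
    pexp (iid γ n) (fun w => (visits o w x : ℝ)) * t ≤ 1 := by
  classical
  -- Bounding by the hitting probability instead of `1` makes the induction close. At `x = o` the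
  -- new visit costs `t ≤ P(T > n + 1)`, which is exactly the probability that the rest of the word
  -- misses `g⁻¹ • o`.
  have key : ∀ n, t ≤ returnTail o γ n → ∀ x, pexp (iid γ n) (fun w => (visits o w x : ℝ)) * t
      ≤ 1 - pexp (iid γ n) fun w => if x ∈ visited o w then 0 else 1 := by
    intro n
    induction n with
    | zero =>
      intro ht x
      rw [returnTail_zero] at ht
      simp only [pexp_iid_zero, visits, visited, mem_singleton]
      split_ifs <;> simp [ht]
    | succ n ih =>
      intro ht x
      have hf := finite_support_iid hγ n
      have ih := ih (ht.trans (returnTail_anti hγ (Nat.le_succ n)))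
      rw [returnTail_succ hγ] at ht
      have h1 : pexp γ (fun g => pexp (iid γ n) (fun w => (visits o w (g⁻¹ • x) : ℝ)) * t)
          ≤ pexp γ fun g => 1 - pexp (iid γ n) fun w =>
            if g⁻¹ • x ∈ visited o w then 0 else 1 := pexp_mono hγ fun g _ => ih _
      rw [pexp_sub hγ, pexp_const hγ, pexp_mul_right] at h1
      simp only [pexp_iid_succ hγ, mem_visited_cons, visits, Nat.cast_add]
      by_cases hx : x = o
      · subst hx
        simp only [if_true, Nat.cast_one, true_or, pexp_add hf, pexp_const hf, pexp_add hγ,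
          pexp_const hγ]
        linarith
      · simp only [hx, if_false, Nat.cast_zero, false_or, zero_add]
        exact h1
  refine (key n ht x).trans (sub_le_self _ (pexp_nonneg fun w => ?_))
  split_ifs <;> simp

/-- By `sum_sq_visits` each prepended letter adds `1 + 2k`; since `t ≤ 1` and `t` times the mean of
`k` is at most `1`, this contributes at most `3` after multiplication by `t`. -/
theorem pexp_sum_sq_visits_mul_le (hγ : γ.support.Finite) {t : ℝ} {n : ℕ}
    (ht : t ≤ returnTail o γ n) :
    pexp (iid γ n) (fun w => ∑ s ∈ visited o w, (visits o w s : ℝ) ^ 2) * t ≤ 3 * n + 1 := by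
  induction n with
  | zero =>
    rw [returnTail_zero] at ht
    rw [pexp_iid_zero, visited, sum_singleton]
    simpa [visits] using ht
  | succ n ih =>
    have hf := finite_support_iid hγ n
    have ht' := ht.trans (returnTail_anti hγ (Nat.le_succ n))
    have h2 : pexp γ (fun g => pexp (iid γ n) (fun w => (visits o w (g⁻¹ • o) : ℝ)) * t) ≤ 1 := by
      rw [← pexp_const hγ 1]
      exact pexp_mono hγ fun g _ => pexp_visits_mul_tail_le hγ ht' _
    have h1 : t ≤ 1 := ht.trans ((returnTail_anti hγ (Nat.zero_le _)).trans_eq returnTail_zero)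
    rw [pexp_mul_right] at h2
    have ih := ih ht'
    simp only [pexp_iid_succ hγ, sum_sq_visits (Subset.refl _), pexp_add hf, pexp_add hγ,
      pexp_const hf, pexp_const hγ, pexp_mul_left]
    push_cast
    nlinarith

end InvertedOrbit

end SwitchWalk
end

noncomputable section

namespace SwitchWalk

open Finset

/-! ### The lamps of the switch-walk-switch walk, given its steps -/

section LampLaw

variable {Λ Γ S : Type*} [Group Λ] [Group Γ] [MulAction Γ S] {o : S}

@[simp] theorem switch_right (a : Λ) : (switch Γ o a).right = 1 := rfl

open Classical in
@[simp] theorem switch_left (a : Λ) : (switch Γ o a).left.1 = Pi.mulSingle o a := rfl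

theorem mul_left_apply (x y : PermWreath Λ Γ S) (s : S) :
    (x * y).left.1 s = x.left.1 s * y.left.1 (x.right⁻¹ • s) := rfl

open Classical in
theorem switch_mul_left_apply (a : Λ) (x : PermWreath Λ Γ S) (s : S) :
    (switch Γ o a * x).left.1 s = (if s = o then a else 1) * x.left.1 s := by
  rw [mul_left_apply, switch_right, inv_one, one_smul, switch_left, Pi.mulSingle_apply]

theorem inr_mul_left_apply (g : Γ) (x : PermWreath Λ Γ S) (s : S) :
    (SemidirectProduct.inr g * x).left.1 s = x.left.1 (g⁻¹ • s) := by
  rw [mul_left_apply]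
  exact one_mul _

theorem switch_inv (a : Λ) : (switch Γ o a)⁻¹ = switch Γ o a⁻¹ := by
  classical
  refine SemidirectProduct.ext (Subtype.ext (funext fun s => ?_)) (by simp)
  rw [SemidirectProduct.inv_left]
  change ((switch Γ o a).left.1 _)⁻¹ = (switch Γ o a⁻¹).left.1 s
  simp only [switch_left, switch_right, Pi.mulSingle_apply, inv_one, one_smul]
  split_ifs <;> simp

/-- The sites where the lamp configuration of `x` is nontrivial. -/
def lampSupport (x : PermWreath Λ Γ S) : Finset S :=
  Set.Finite.toFinset (s := Function.mulSupport x.left.1) x.left.2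

theorem mem_lampSupport {x : PermWreath Λ Γ S} {s : S} :
    s ∈ lampSupport x ↔ x.left.1 s ≠ 1 := by
  exact (Set.Finite.mem_toFinset (s := Function.mulSupport x.left.1) _).trans Iff.rfl

/-- Multiply a random element from the left by an independent switch. -/
def addSwitch (o : S) (μ : PMF Λ) (P : PMF (PermWreath Λ Γ S)) : PMF (PermWreath Λ Γ S) :=
  μ.bind fun a => P.map fun x => switch Γ o a * x

/-- The law of the switch-walk-switch walk, given the steps in `Γ`. -/
def pathLaw (o : S) (μ : PMF Λ) : List Γ → PMF (PermWreath Λ Γ S)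
  | [] => PMF.pure 1
  | g :: w => addSwitch o μ ((addSwitch o μ (pathLaw o μ w)).map fun x =>
      SemidirectProduct.inr g * x)

theorem walkLaw_swsStep (μ : PMF Λ) (γ : PMF Γ) (n : ℕ) :
    walkLaw (swsStep o μ γ) n = (iid γ n).bind (pathLaw o μ) := by
  induction n with
  | zero => rw [walkLaw_zero, iid, PMF.pure_bind, pathLaw]
  | succ n ih =>
    rw [walkLaw_succ, ih, iid, swsStep]
    simp only [PMF.bind_bind, PMF.pure_bind, PMF.map_bind, PMF.bind_map, Function.comp_def,
      pathLaw, addSwitch, PMF.map_comp]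
    rw [PMF.bind_comm]
    refine congrArg _ (funext fun g => ?_)
    refine Eq.trans (congrArg _ (funext fun a => PMF.bind_comm μ (iid γ n) _)) ?_
    rw [PMF.bind_comm μ (iid γ n)]
    simp only [mul_assoc]

theorem finite_support_addSwitch {μ : PMF Λ} (hμ : μ.support.Finite)
    {P : PMF (PermWreath Λ Γ S)} (hP : P.support.Finite) : (addSwitch o μ P).support.Finite :=
  finite_support_bind hμ fun _ _ => finite_support_map _ hP

theorem finite_support_pathLaw {μ : PMF Λ} (hμ : μ.support.Finite) (w : List Γ) :
    (pathLaw o μ w).support.Finite := by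
  induction w with
  | nil => exact finite_support_pure _
  | cons g w ih =>
    exact finite_support_addSwitch hμ (finite_support_map _ (finite_support_addSwitch hμ ih))

theorem map_mul_left_apply {G : Type*} [Group G] (P : PMF G) (g x : G) :
    P.map (fun y => g * y) x = P (g⁻¹ * x) := by
  classical
  rw [PMF.map_apply, tsum_eq_single (g⁻¹ * x)]
  · simp
  · intro b hb
    rw [if_neg]
    rintro rfl
    simp at hb

theorem walkLaw_succ_apply {G : Type*} [Group G] (ν : PMF G) (n : ℕ) (y : G) :
    walkLaw ν (n + 1) y = ∑' a, ν a * walkLaw ν n (a⁻¹ * y) := by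
  rw [walkLaw_succ, PMF.bind_apply]
  simp only [map_mul_left_apply]

open Classical in
/-- `P` is the law of `(ℓ, y)`, where the values of `ℓ` are independent, and `ℓ s` is the position
at time `N s` of a random walk with step law `μ`. -/
def IsLampLaw (μ : PMF Λ) (N : S → ℕ) (y : Γ) (P : PMF (PermWreath Λ Γ S)) : Prop :=
  ∀ (x : PermWreath Λ Γ S) (T : Finset S), (∀ s ∉ T, N s = 0 ∧ x.left.1 s = 1) →
    P x = if x.right = y then ∏ s ∈ T, walkLaw μ (N s) (x.left.1 s) else 0

theorem isLampLaw_pure (μ : PMF Λ) :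
    IsLampLaw μ (fun _ : S => 0) (1 : Γ) (PMF.pure 1) := by
  classical
  intro x T hT
  rw [PMF.pure_apply]
  simp only [walkLaw_zero, PMF.pure_apply]
  by_cases h : x.right = 1
  · rw [if_pos h]
    by_cases h' : ∀ s, x.left.1 s = 1
    · rw [if_pos, prod_eq_one]
      · intro s _; rw [if_pos (h' s)]
      · exact SemidirectProduct.ext (Subtype.ext (funext h')) h
    · push Not at h'
      obtain ⟨s, hs⟩ := h'
      have hsT : s ∈ T := by_contra fun h => hs (hT s h).2
      rw [prod_eq_zero hsT (if_neg hs), if_neg]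
      rintro rfl
      exact hs rfl
  · rw [if_neg h, if_neg]
    rintro rfl
    exact h rfl

-- Only the lamp at `o` changes, and the sum over the value of the switch is the convolution that
-- makes one more step of the lamp walk there; the other factors come out of the sum.
open Classical in
theorem IsLampLaw.addSwitch {μ : PMF Λ} {N : S → ℕ} {y : Γ} {P : PMF (PermWreath Λ Γ S)}
    (h : IsLampLaw μ N y P) :
    IsLampLaw μ (fun s => (if s = o then 1 else 0) + N s) y (addSwitch o μ P) := by
  intro x T hT
  have hoT : o ∈ T := by
    by_contra ho
    have := (hT o ho).1
    simp at this
  have hx : ∀ a, P ((switch Γ o a)⁻¹ * x) = if x.right = y then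
      walkLaw μ (N o) (a⁻¹ * x.left.1 o) * ∏ s ∈ T.erase o, walkLaw μ (N s) (x.left.1 s)
      else 0 := by
    intro a
    rw [switch_inv, h _ T]
    · have hr : (switch Γ o a⁻¹ * x).right = x.right := one_mul _
      rw [hr, ← mul_prod_erase T _ hoT]
      refine if_congr Iff.rfl ?_ rfl
      rw [switch_mul_left_apply, if_pos rfl]
      congr 1
      refine prod_congr rfl fun s hs => ?_
      rw [switch_mul_left_apply, if_neg (ne_of_mem_erase hs), one_mul]
    · intro s hs
      have hso : s ≠ o := by rintro rfl; exact hs hoT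
      have := hT s hs
      rw [switch_mul_left_apply, if_neg hso, one_mul]
      exact ⟨by simpa [hso] using this.1, this.2⟩
  rw [SwitchWalk.addSwitch, PMF.bind_apply]
  simp only [map_mul_left_apply, hx]
  split_ifs with hr
  · rw [← mul_prod_erase T _ hoT, if_pos rfl, add_comm 1, walkLaw_succ_apply,
      ← ENNReal.tsum_mul_right]
    refine tsum_congr fun a => ?_
    rw [mul_assoc]
    congr 2
    refine prod_congr rfl fun s hs => ?_
    rw [if_neg (ne_of_mem_erase hs), zero_add]
  · simp

theorem IsLampLaw.map_inr {μ : PMF Λ} {N : S → ℕ} {y : Γ} {P : PMF (PermWreath Λ Γ S)}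
    (h : IsLampLaw μ N y P) (g : Γ) :
    IsLampLaw μ (fun s => N (g⁻¹ • s)) (g * y)
      (P.map fun x => SemidirectProduct.inr g * x) := by
  classical
  intro x T hT
  rw [map_mul_left_apply, ← map_inv, h _ (T.image fun s => g⁻¹ • s)]
  · have hr : (SemidirectProduct.inr g⁻¹ * x : PermWreath Λ Γ S).right = g⁻¹ * x.right := rfl
    rw [hr, inv_mul_eq_iff_eq_mul]
    refine if_congr Iff.rfl ?_ rfl
    rw [prod_image (MulAction.injective g⁻¹).injOn]
    refine prod_congr rfl fun s _ => ?_
    rw [inr_mul_left_apply, inv_inv, smul_inv_smul]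
  · intro s hs
    rw [inr_mul_left_apply, inv_inv]
    have := hT (g • s) fun h => hs (mem_image.2 ⟨_, h, inv_smul_smul _ _⟩)
    simpa only [inv_smul_smul] using this

theorem isLampLaw_pathLaw (μ : PMF Λ) (w : List Γ) :
    IsLampLaw μ (switches o w) w.prod (pathLaw o μ w) := by
  classical
  induction w with
  | nil => exact isLampLaw_pure μ
  | cons g w ih =>
    have := ((ih.addSwitch (o := o)).map_inr g).addSwitch (o := o)
    simp only [inv_smul_eq_iff] at this
    rw [List.prod_cons, pathLaw]
    have e : switches o (g :: w) = fun s => (if s = o then 1 else 0) +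
        ((if s = g • o then 1 else 0) + switches o w (g⁻¹ • s)) := by
      funext s
      rw [switches]
    rw [e]
    exact this

theorem map_addSwitch_left {μ : PMF Λ} {P : PMF (PermWreath Λ Γ S)} {N : S → ℕ}
    (h : ∀ s, P.map (fun x => x.left.1 s) = walkLaw μ (N s)) (s : S) [Decidable (s = o)] :
    (addSwitch o μ P).map (fun x => x.left.1 s)
      = walkLaw μ ((if s = o then 1 else 0) + N s) := by
  rw [addSwitch, PMF.map_bind]
  simp only [PMF.map_comp, Function.comp_def, switch_mul_left_apply]
  split_ifs with hs
  · rw [add_comm, walkLaw_succ, ← h]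
    simp only [PMF.map_comp, Function.comp_def]
  · simp only [one_mul, h, zero_add]
    exact PMF.bind_const _ _

/-- The lamps of the walk with given steps are positions of random walks. -/
theorem map_pathLaw_left (μ : PMF Λ) (w : List Γ) (s : S) :
    (pathLaw o μ w).map (fun x => x.left.1 s) = walkLaw μ (switches o w s) := by
  classical
  induction w generalizing s with
  | nil => rw [pathLaw, PMF.pure_map, switches, walkLaw_zero]; rfl
  | cons g w ih =>
    rw [pathLaw, map_addSwitch_left (N := fun s =>
      (if s = g • o then 1 else 0) + switches o w (g⁻¹ • s)), switches]
    · intro t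
      rw [PMF.map_comp]
      simp only [Function.comp_def, inr_mul_left_apply]
      rw [map_addSwitch_left ih]
      simp only [inv_smul_eq_iff]

theorem pathLaw_support {μ : PMF Λ} {w : List Γ} {x : PermWreath Λ Γ S}
    (hx : x ∈ (pathLaw o μ w).support) :
    x.right = w.prod ∧ ∀ s, switches o w s = 0 → x.left.1 s = 1 := by
  classical
  rw [PMF.mem_support_iff, isLampLaw_pathLaw μ w x (visited o w ∪ lampSupport x)] at hx
  · refine ⟨by_contra fun h => hx (if_neg h), fun s hs => by_contra fun h => hx ?_⟩
    have hm : s ∈ visited o w ∪ lampSupport x := by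
      rw [mem_union]
      exact Or.inr (mem_lampSupport.2 h)
    rw [prod_eq_zero hm, ite_self]
    rw [hs, walkLaw_zero, PMF.pure_apply, if_neg h]
  · intro s hs
    rw [mem_union, not_or] at hs
    exact ⟨by_contra fun h => hs.1 (mem_visited_of_switches_ne_zero h), by_contra fun h => hs.2 (mem_lampSupport.2 h)⟩

theorem pathLaw_apply {μ : PMF Λ} {w : List Γ} {x : PermWreath Λ Γ S} {T : Finset S}
    (hT : visited o w ⊆ T) (hx : x.right = w.prod) (hx' : ∀ s ∉ T, x.left.1 s = 1) :
    pathLaw o μ w x = ∏ s ∈ T, walkLaw μ (switches o w s) (x.left.1 s) := by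
  rw [isLampLaw_pathLaw μ w x T, if_pos hx]
  exact fun s hs => ⟨by_contra fun h => hs (hT (mem_visited_of_switches_ne_zero h)), hx' s hs⟩

theorem pathLaw_left_eq_one {μ : PMF Λ} {w : List Γ} {x : PermWreath Λ Γ S}
    (hx : x ∈ (pathLaw o μ w).support) {s : S} (hs : s ∉ visited o w) : x.left.1 s = 1 :=
  (pathLaw_support hx).2 s (by_contra fun h => hs (mem_visited_of_switches_ne_zero h))

theorem pexp_pathLaw_left {μ : PMF Λ} (hμ : μ.support.Finite) (w : List Γ) (s : S) (F : Λ → ℝ) :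
    pexp (pathLaw o μ w) (fun x => F (x.left.1 s)) = pexp (walkLaw μ (switches o w s)) F := by
  rw [← map_pathLaw_left, pexp_map _ (finite_support_pathLaw hμ w)]

/-- Given the steps, the entropy of the switch-walk-switch walk is the sum of the entropies of the
lamps. -/
theorem ent_pathLaw {μ : PMF Λ} (hμ : μ.support.Finite) (w : List Γ) :
    ent (pathLaw o μ w) = ∑ s ∈ visited o w, walkEntropy μ (switches o w s) := by
  have hf := finite_support_pathLaw (o := o) hμ w
  rw [ent_eq_pexp]
  have : ∀ x ∈ (pathLaw o μ w).support, -Real.log (pathLaw o μ w x).toReal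
      = ∑ s ∈ visited o w, -Real.log (walkLaw μ (switches o w s) (x.left.1 s)).toReal := by
    intro x hx
    have e := pathLaw_apply (μ := μ) (Subset.refl _) (pathLaw_support hx).1
      fun s hs => pathLaw_left_eq_one hx hs
    have hne := (toReal_ne_zero_iff _ _).2 hx
    rw [e, ENNReal.toReal_prod] at hne ⊢
    rw [Real.log_prod (fun s hs => prod_ne_zero_iff.1 hne s hs), sum_neg_distrib]
  rw [pexp_congr this, pexp_sum hf]
  refine sum_congr rfl fun s _ => ?_
  rw [pexp_pathLaw_left hμ w s fun a => -Real.log (walkLaw μ (switches o w s) a).toReal,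
    walkEntropy_eq, ent_eq_pexp]

/-- The law of the lamps depends on the steps only through their product and the numbers of
switches. -/
theorem pathLaw_congr {μ : PMF Λ} {w w' : List Γ} (hp : w.prod = w'.prod)
    (hs : ∀ s, walkLaw μ (switches o w s) = walkLaw μ (switches o w' s)) :
    pathLaw o μ w = pathLaw o μ w' := by
  classical
  ext x
  set T := visited o w ∪ visited o w' ∪ lampSupport x
  have hT : ∀ v : List Γ, visited o v ⊆ T → ∀ s ∉ T, switches o v s = 0 ∧ x.left.1 s = 1 := by
    intro v hv s hs
    refine ⟨by_contra fun h => hs (hv (mem_visited_of_switches_ne_zero h)), ?_⟩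
    exact by_contra fun h => hs (mem_union_right _ (mem_lampSupport.2 h))
  rw [isLampLaw_pathLaw μ w x T (hT w fun s h => by simp [T, h]),
    isLampLaw_pathLaw μ w' x T (hT w' fun s h => by simp [T, h]), hp]
  simp only [hs]

theorem pexp_walkLaw_swsStep {μ : PMF Λ} {γ : PMF Γ} (hμ : μ.support.Finite)
    (hγ : γ.support.Finite) (n : ℕ) (F : PermWreath Λ Γ S → ℝ) :
    pexp (walkLaw (swsStep o μ γ) n) F = pexp (iid γ n) fun w => pexp (pathLaw o μ w) F := by
  rw [walkLaw_swsStep, pexp_bind (finite_support_iid hγ n) fun w _ => finite_support_pathLaw hμ w]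

/-- The left side is the conditional entropy given the steps in `Γ`. -/
theorem pexp_ent_le_walkEntropy {μ : PMF Λ} {γ : PMF Γ} (hμ : μ.support.Finite)
    (hγ : γ.support.Finite) (n : ℕ) :
    pexp (iid γ n) (fun w => ∑ s ∈ visited o w, walkEntropy μ (switches o w s))
      ≤ walkEntropy (swsStep o μ γ) n := by
  rw [walkEntropy_eq, walkLaw_swsStep]
  simp only [← ent_pathLaw hμ]
  exact ent_bind_ge (finite_support_iid hγ n) fun w _ => finite_support_pathLaw hμ w

end LampLaw

end SwitchWalk
end

noncomputable section

namespace SwitchWalk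

open Finset

/-! ### Word norms -/

section WordNorm

variable {G : Type*} [Group G] {A : Set G}

theorem exists_word (hA : ∀ a ∈ A, a⁻¹ ∈ A) (hcl : Subgroup.closure A = ⊤) (g : G) :
    ∃ l : List G, (∀ x ∈ l, x ∈ A) ∧ l.prod = g := by
  have hg : g ∈ (Subgroup.closure A).toSubmonoid := by rw [hcl]; trivial
  rw [Subgroup.closure_toSubmonoid] at hg
  obtain ⟨l, hl, rfl⟩ := Submonoid.exists_list_of_mem_closure hg
  refine ⟨l, fun x hx => (hl x hx).elim id fun h => ?_, rfl⟩
  simpa using hA _ h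

theorem wordNorm_le {l : List G} (hl : ∀ x ∈ l, x ∈ A) : wordNorm A l.prod ≤ l.length :=
  Nat.sInf_le ⟨l, rfl, hl, rfl⟩

theorem exists_word_of_length {g : G} (h : ∃ l : List G, (∀ x ∈ l, x ∈ A) ∧ l.prod = g) :
    ∃ l : List G, l.length = wordNorm A g ∧ (∀ x ∈ l, x ∈ A) ∧ l.prod = g := by
  obtain ⟨l, hl, e⟩ := h
  exact Nat.sInf_mem (s := {n | ∃ l : List G, l.length = n ∧ (∀ x ∈ l, x ∈ A) ∧ l.prod = g})
    ⟨l.length, l, rfl, hl, e⟩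

theorem wordNorm_one : wordNorm A (1 : G) = 0 := by
  simpa using wordNorm_le (A := A) (l := []) (by simp)

theorem wordNorm_mul_le (hA : ∀ a ∈ A, a⁻¹ ∈ A) (hcl : Subgroup.closure A = ⊤) (g h : G) :
    wordNorm A (g * h) ≤ wordNorm A g + wordNorm A h := by
  obtain ⟨l, hl, hl', rfl⟩ := exists_word_of_length (exists_word hA hcl g)
  obtain ⟨k, hk, hk', rfl⟩ := exists_word_of_length (exists_word hA hcl h)
  rw [← hl, ← hk, ← List.prod_append, ← List.length_append]
  exact wordNorm_le (by simpa [or_imp, forall_and] using ⟨hl', hk'⟩)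

theorem wordNorm_mem_le {a : G} (ha : a ∈ A) : wordNorm A a ≤ 1 := by
  simpa using wordNorm_le (A := A) (l := [a]) (by simpa using ha)

theorem meanNorm_nonneg (A : Set G) (ν : PMF G) (n : ℕ) : 0 ≤ meanNorm A ν n :=
  pexp_nonneg fun _ => Nat.cast_nonneg _

theorem meanNorm_zero (A : Set G) (ν : PMF G) : meanNorm A ν 0 = 0 := by
  rw [meanNorm_eq, walkLaw_zero, pexp_pure, wordNorm_one, Nat.cast_zero]

theorem meanNorm_add_le (hA : ∀ a ∈ A, a⁻¹ ∈ A) (hcl : Subgroup.closure A = ⊤) {ν : PMF G}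
    (hν : ν.support.Finite) (m n : ℕ) :
    meanNorm A ν (m + n) ≤ meanNorm A ν m + meanNorm A ν n := by
  have hm := finite_support_walkLaw hν m
  have hn := finite_support_walkLaw hν n
  rw [meanNorm_eq, walkLaw_add, pexp_bind hm fun a _ => finite_support_map _ hn]
  simp only [pexp_map _ hn]
  have : meanNorm A ν m + meanNorm A ν n = pexp (walkLaw ν m) fun g => pexp (walkLaw ν n) fun h =>
      (wordNorm A g : ℝ) + wordNorm A h := by
    simp only [pexp_add hn, pexp_const hn, pexp_add hm, pexp_const hm]
    rfl
  rw [this]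
  refine pexp_mono hm fun g _ => pexp_mono hn fun h _ => ?_
  exact_mod_cast wordNorm_mul_le hA hcl g h

end WordNorm

/-! ### Word norms in the wreath product and words covering the inverted orbit -/

section WreathNorm

variable {Λ Γ S : Type*} [Group Λ] [Group Γ] [MulAction Γ S] {o : S} {A : Set Λ} {B : Set Γ}

theorem wreath_ext {x y : PermWreath Λ Γ S} (hr : x.right = y.right)
    (hl : ∀ s, x.left.1 s = y.left.1 s) : x = y :=
  SemidirectProduct.ext (Subtype.ext (funext hl)) hr

theorem switch_mul (a b : Λ) : switch Γ o a * switch Γ o b = switch Γ o (a * b) := by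
  classical
  refine wreath_ext (one_mul _) fun s => ?_
  rw [switch_mul_left_apply, switch_left, switch_left, Pi.mulSingle_apply, Pi.mulSingle_apply]
  split_ifs <;> simp

theorem switch_one : switch Γ o (1 : Λ) = 1 := by
  classical
  refine wreath_ext rfl fun s => ?_
  rw [switch_left, Pi.mulSingle_one]
  rfl

theorem prod_map_switch (l : List Λ) : (l.map (switch Γ o)).prod = switch Γ o l.prod := by
  induction l with
  | nil => exact switch_one.symm
  | cons a l ih => rw [List.map_cons, List.prod_cons, ih, switch_mul, List.prod_cons]

/-- The word norm dominates the sum of the norms of the lamps. -/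
theorem sum_wordNorm_left_le (hA : ∀ a ∈ A, a⁻¹ ∈ A) (hcl : Subgroup.closure A = ⊤)
    {l : List (PermWreath Λ Γ S)} (hl : ∀ x ∈ l, x ∈ wreathGens o A B) (T : Finset S) :
    ∑ s ∈ T, wordNorm A (l.prod.left.1 s) ≤ l.length := by
  classical
  induction l generalizing T with
  | nil =>
    refine (sum_eq_zero fun s _ => ?_).le
    exact wordNorm_one
  | cons x l ih =>
    have ih := ih fun y hy => hl y (List.mem_cons_of_mem _ hy)
    rcases hl x List.mem_cons_self with ⟨a, ha, rfl⟩ | ⟨g, hg, rfl⟩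
    · rw [List.prod_cons, List.length_cons, add_comm]
      calc ∑ s ∈ T, wordNorm A ((switch Γ o a * l.prod).left.1 s)
          ≤ ∑ s ∈ T, ((if s = o then 1 else 0) + wordNorm A (l.prod.left.1 s)) := by
            refine sum_le_sum fun s _ => ?_
            rw [switch_mul_left_apply]
            split_ifs
            · exact (wordNorm_mul_le hA hcl _ _).trans
                (Nat.add_le_add_right (wordNorm_mem_le ha) _)
            · simp
        _ ≤ 1 + l.length := by
            rw [sum_add_distrib]
            refine Nat.add_le_add ?_ (ih T)
            rw [sum_ite_eq']
            split_ifs <;> simp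
    · rw [List.prod_cons, List.length_cons]
      simp only [inr_mul_left_apply]
      rw [sum_smul_inv g T fun s => wordNorm A (l.prod.left.1 s)]
      exact (ih _).trans (Nat.le_succ _)

/-- Follow `v`, and put each lamp into its final state at the first visit of the inverted orbit to
its site. Later visits find nothing left to do, so every lamp is paid for once. -/
theorem exists_wreath_word (hA : ∀ a ∈ A, a⁻¹ ∈ A) (hcl : Subgroup.closure A = ⊤)
    {v : List Γ} (hv : ∀ g ∈ v, g ∈ B) {x : PermWreath Λ Γ S} (hx : x.right = v.prod)
    (hs : ∀ s ∉ visited o v, x.left.1 s = 1) :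
    ∃ l : List (PermWreath Λ Γ S), (∀ y ∈ l, y ∈ wreathGens o A B) ∧ l.prod = x ∧
      l.length ≤ v.length + ∑ s ∈ visited o v, wordNorm A (x.left.1 s) := by
  classical
  have hsw : ∀ a : Λ, ∃ l : List (PermWreath Λ Γ S), (∀ y ∈ l, y ∈ wreathGens o A B) ∧
      l.prod = switch Γ o a ∧ l.length = wordNorm A a := by
    intro a
    obtain ⟨l, hl, hl', rfl⟩ := exists_word_of_length (exists_word hA hcl a)
    refine ⟨l.map (switch Γ o), fun y hy => ?_, prod_map_switch l, by rw [List.length_map, hl]⟩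
    obtain ⟨b, hb, rfl⟩ := List.mem_map.1 hy
    exact Or.inl ⟨b, hl' b hb, rfl⟩
  induction v generalizing x with
  | nil =>
    obtain ⟨l, hl, hp, hn⟩ := hsw (x.left.1 o)
    refine ⟨l, hl, hp.trans (wreath_ext hx.symm fun s => ?_), by simp [hn, visited]⟩
    rw [switch_left, Pi.mulSingle_apply]
    split_ifs with h
    · rw [h]
    · rw [hs s (by simpa [visited] using h)]
  | cons g v ih =>
    obtain ⟨l, hl, hp, hn⟩ := hsw (x.left.1 o)
    set a := x.left.1 o with ha
    set y : PermWreath Λ Γ S := SemidirectProduct.inr g⁻¹ * (switch Γ o a⁻¹ * x) with hy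
    have hyl : ∀ s, y.left.1 s = if g • s = o then 1 else x.left.1 (g • s) := by
      intro s
      rw [hy, inr_mul_left_apply, inv_inv, switch_mul_left_apply]
      split_ifs with h
      · rw [h, ← ha, inv_mul_cancel]
      · rw [one_mul]
    obtain ⟨k, hk, hkp, hkn⟩ := ih (x := y) (fun h hh => hv h (List.mem_cons_of_mem _ hh))
      (by
        have : y.right = g⁻¹ * (1 * x.right) := rfl
        rw [this, hx, List.prod_cons, one_mul, inv_mul_cancel_left])
      (by
        intro s hs'
        rw [hyl]
        split_ifs with h
        · rfl
        · refine hs _ ?_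
          rw [mem_visited_cons, inv_smul_smul, not_or]
          exact ⟨h, hs'⟩)
    refine ⟨l ++ SemidirectProduct.inr g :: k, ?_, ?_, ?_⟩
    · intro z hz
      rcases List.mem_append.1 hz with hz | hz
      · exact hl z hz
      · rcases List.mem_cons.1 hz with rfl | hz
        · exact Or.inr ⟨g, hv g List.mem_cons_self, rfl⟩
        · exact hk z hz
    · rw [List.prod_append, List.prod_cons, hp, hkp, hy, ← mul_assoc (SemidirectProduct.inr g),
        ← map_mul, mul_inv_cancel, map_one, one_mul, ← mul_assoc, switch_mul, mul_inv_cancel,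
        switch_one, one_mul]
    -- In the remaining element `y` the lamp that belonged to `o` is already trivial, so its term
    -- drops out even if the orbit comes back to `o`.
    · have e : ∑ s ∈ visited o v, wordNorm A (y.left.1 s)
          = ∑ t ∈ ((visited o v).image fun s => g • s).erase o, wordNorm A (x.left.1 t) := by
        rw [← filter_ne', sum_filter, sum_image (MulAction.injective g).injOn]
        refine sum_congr rfl fun s _ => ?_
        rw [hyl]
        split_ifs with h1 h2
        · exact absurd h1 h2
        · exact wordNorm_one
        · rfl
      have e2 : ∑ s ∈ visited o (g :: v), wordNorm A (x.left.1 s) = wordNorm A a +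
          ∑ t ∈ ((visited o v).image fun s => g • s).erase o, wordNorm A (x.left.1 t) := by
        rw [visited, ← add_sum_erase _ _ (mem_insert_self _ _), erase_insert_eq_erase]
      rw [List.length_append, List.length_cons, hn, e2, List.length_cons, ← e]
      omega

/-- The length of the shortest word over `B` whose product is that of `w`, and whose inverted orbit
covers that of `w`. -/
def coverLength (o : S) (B : Set Γ) (w : List Γ) : ℕ :=
  sInf {n | ∃ v : List Γ, v.length = n ∧ (∀ g ∈ v, g ∈ B) ∧ v.prod = w.prod ∧
    visited o w ⊆ visited o v}

theorem exists_cover {w v₀ : List Γ} (hv : ∀ g ∈ v₀, g ∈ B) (hp : v₀.prod = w.prod)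
    (hs : visited o w ⊆ visited o v₀) :
    coverLength o B w ≤ v₀.length ∧ ∃ v : List Γ, v.length = coverLength o B w ∧
      (∀ g ∈ v, g ∈ B) ∧ v.prod = w.prod ∧ visited o w ⊆ visited o v :=
  ⟨Nat.sInf_le ⟨v₀, rfl, hv, hp, hs⟩,
    Nat.sInf_mem (s := {n | ∃ v : List Γ, v.length = n ∧ (∀ g ∈ v, g ∈ B) ∧ v.prod = w.prod ∧
      visited o w ⊆ visited o v}) ⟨v₀.length, v₀, rfl, hv, hp, hs⟩⟩

/-- The length of the shortest word over `B` with product `x.right`, whose inverted orbit covers the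
support of the lamps of `x`. -/
def coverNorm (o : S) (B : Set Γ) (x : PermWreath Λ Γ S) : ℕ :=
  sInf {n | ∃ v : List Γ, v.length = n ∧ (∀ g ∈ v, g ∈ B) ∧ v.prod = x.right ∧
    lampSupport x ⊆ visited o v}

/-- There is a word over `B` with product `x.right`, whose inverted orbit covers the support of the
lamps of `x`. -/
def Coverable (o : S) (B : Set Γ) (x : PermWreath Λ Γ S) : Prop :=
  ∃ v : List Γ, (∀ g ∈ v, g ∈ B) ∧ v.prod = x.right ∧ lampSupport x ⊆ visited o v

theorem Coverable.exists_length {x : PermWreath Λ Γ S} (h : Coverable o B x) :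
    ∃ v : List Γ, v.length = coverNorm o B x ∧ (∀ g ∈ v, g ∈ B) ∧ v.prod = x.right ∧
      lampSupport x ⊆ visited o v := by
  obtain ⟨v, hv⟩ := h
  exact Nat.sInf_mem (s := {n | ∃ v : List Γ, v.length = n ∧ (∀ g ∈ v, g ∈ B) ∧
    v.prod = x.right ∧ lampSupport x ⊆ visited o v}) ⟨v.length, v, rfl, hv⟩

theorem coverNorm_le {x : PermWreath Λ Γ S} {v : List Γ} (hv : ∀ g ∈ v, g ∈ B)
    (hp : v.prod = x.right) (hs : lampSupport x ⊆ visited o v) : coverNorm o B x ≤ v.length :=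
  Nat.sInf_le ⟨v, rfl, hv, hp, hs⟩

theorem coverNorm_one : coverNorm o B (1 : PermWreath Λ Γ S) = 0 :=
  Nat.le_zero.1 (coverNorm_le (v := []) (by simp) rfl fun s hs => absurd rfl (mem_lampSupport.1 hs))

/-- Prepend `g` to an optimal covering word: the two new switches act at `o` and at `g • o`, and the
inverted orbit of `g :: v` contains both. -/
theorem coverNorm_step_aux {x : PermWreath Λ Γ S} (hx : Coverable o B x) {g : Γ} (hg : g ∈ B)
    (a b : Λ) : Coverable o B (switch Γ o a * SemidirectProduct.inr g * switch Γ o b * x) ∧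
      coverNorm o B (switch Γ o a * SemidirectProduct.inr g * switch Γ o b * x)
        ≤ coverNorm o B x + 1 := by
  classical
  obtain ⟨v, hv, hvB, hp, hs⟩ := hx.exists_length
  set y := switch Γ o a * SemidirectProduct.inr g * switch Γ o b * x with hy
  have h1 : ∀ h ∈ g :: v, h ∈ B := by simpa using ⟨hg, hvB⟩
  have h2 : (g :: v).prod = y.right := by
    have : y.right = 1 * g * 1 * x.right := rfl
    rw [this, List.prod_cons, hp, one_mul, mul_one]
  have h3 : lampSupport y ⊆ visited o (g :: v) := by
    intro s hsy
    by_contra hc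
    rw [mem_visited_cons, not_or] at hc
    refine mem_lampSupport.1 hsy ?_
    have hb : g⁻¹ • s ≠ o := fun h => hc.2 (h ▸ self_mem_visited v)
    rw [hy, mul_assoc, mul_assoc, switch_mul_left_apply, if_neg hc.1, inr_mul_left_apply,
      switch_mul_left_apply, if_neg hb, one_mul, one_mul]
    exact by_contra fun h => hc.2 (hs (mem_lampSupport.2 h))
  refine ⟨⟨_, h1, h2, h3⟩, (coverNorm_le h1 h2 h3).trans_eq ?_⟩
  rw [List.length_cons, hv]

theorem step_inv (a b : Λ) (g : Γ) :
    (switch Γ o a * SemidirectProduct.inr g * switch Γ o b)⁻¹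
      = switch Γ o b⁻¹ * SemidirectProduct.inr g⁻¹ * switch Γ o a⁻¹ := by
  rw [mul_inv_rev, mul_inv_rev, switch_inv, switch_inv, ← map_inv, mul_assoc]

theorem abs_coverNorm_step_sub_le (hB : ∀ g ∈ B, g⁻¹ ∈ B) {g : Γ} (hg : g ∈ B) (a b : Λ)
    (x : PermWreath Λ Γ S) :
    |(coverNorm o B (switch Γ o a * SemidirectProduct.inr g * switch Γ o b * x) : ℝ)
      - coverNorm o B x| ≤ 1 := by
  set y := switch Γ o a * SemidirectProduct.inr g * switch Γ o b * x with hy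
  have hxy : x = switch Γ o b⁻¹ * SemidirectProduct.inr g⁻¹ * switch Γ o a⁻¹ * y := by
    rw [hy, ← step_inv, inv_mul_cancel_left]
  by_cases hx : Coverable o B x
  · have h1 := coverNorm_step_aux hx hg a b
    have h2 := (coverNorm_step_aux (x := y) h1.1 (hB g hg) b⁻¹ a⁻¹).2
    have h1 := h1.2
    rw [← hxy] at h2
    rw [← hy] at h1
    rw [abs_le]
    have h1' : (coverNorm o B y : ℝ) ≤ coverNorm o B x + 1 := by exact_mod_cast h1
    have h2' : (coverNorm o B x : ℝ) ≤ coverNorm o B y + 1 := by exact_mod_cast h2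
    constructor <;> linarith
  -- If no covering word exists for `x`, none exists for `y`, and both norms take the default value
  -- `sInf ∅ = 0`.
  · have hy' : ¬ Coverable o B y := fun h => hx (by
      rw [hxy]
      exact (coverNorm_step_aux h (hB g hg) b⁻¹ a⁻¹).1)
    have h0 : ∀ z : PermWreath Λ Γ S, ¬ Coverable o B z → coverNorm o B z = 0 := by
      intro z hz
      rw [coverNorm, Nat.sInf_eq_zero]
      right
      rw [Set.eq_empty_iff_forall_notMem]
      rintro n ⟨v, -, hv⟩
      exact hz ⟨v, hv⟩
    rw [h0 x hx, h0 y hy']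
    simp

/-- With covering words `v` for `x` and `u` for `y`, use `v v⁻¹ u`. Its product is that of `u`, and
as `v v⁻¹ = 1` its inverted orbit contains those of both `v` and `u`; going back along `v` causes
the factor `2`. -/
theorem coverLength_le {w : List Γ} (hB : ∀ g ∈ B, g⁻¹ ∈ B) {x y : PermWreath Λ Γ S}
    (hx : Coverable o B x) (hy : Coverable o B y) (hyw : y.right = w.prod) (hw : ∀ s ∈ visited o w, s ∈ lampSupport x ∨ s ∈ lampSupport y) :
    coverLength o B w ≤ 2 * coverNorm o B x + coverNorm o B y := by
  obtain ⟨v, hv, hvB, hvp, hvs⟩ := hx.exists_length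
  obtain ⟨u, hu, huB, hup, hus⟩ := hy.exists_length
  have hinv : ((v.map fun g => g⁻¹).reverse).prod = v.prod⁻¹ := (List.prod_inv_reverse v).symm
  have h1 : ∀ g ∈ v ++ ((v.map fun g => g⁻¹).reverse ++ u), g ∈ B := by
    intro g hg
    simp only [List.mem_append, List.mem_reverse, List.mem_map] at hg
    rcases hg with hg | ⟨h, hh, rfl⟩ | hg
    · exact hvB g hg
    · exact hB _ (hvB h hh)
    · exact huB g hg
  have h2 : (v ++ ((v.map fun g => g⁻¹).reverse ++ u)).prod = w.prod := by
    rw [List.prod_append, List.prod_append, hinv, mul_inv_cancel_left, hup, hyw]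
  have h3 : visited o w ⊆ visited o (v ++ ((v.map fun g => g⁻¹).reverse ++ u)) := by
    intro s hs
    rw [visited_append, visited_append]
    rcases hw s hs with h | h
    · exact Or.inl (hvs h)
    · refine Or.inr (Or.inr ?_)
      rw [hinv, inv_inv, smul_inv_smul]
      exact hus h
  refine (exists_cover h1 h2 h3).1.trans_eq ?_
  simp only [List.length_append, List.length_reverse, List.length_map, hv, hu]
  ring

theorem coverable_of_mem_support {μ : PMF Λ} {w : List Γ} (hw : ∀ g ∈ w, g ∈ B)
    {x : PermWreath Λ Γ S} (hx : x ∈ (pathLaw o μ w).support) : Coverable o B x :=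
  ⟨w, hw, (pathLaw_support hx).1.symm, fun _ hs => by_contra fun h =>
    mem_lampSupport.1 hs (pathLaw_left_eq_one hx h)⟩

variable {μ : PMF Λ} {γ : PMF Γ}

theorem sum_wordNorm_left_le_wordNorm (hA : ∀ a ∈ A, a⁻¹ ∈ A) (hcl : Subgroup.closure A = ⊤)
    {w : List Γ} (hw : ∀ g ∈ w, g ∈ B) {x : PermWreath Λ Γ S}
    (hx : x ∈ (pathLaw o μ w).support) (T : Finset S) :
    ∑ s ∈ T, wordNorm A (x.left.1 s) ≤ wordNorm (wreathGens o A B) x := by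
  -- Some representing word must be exhibited, since otherwise the word norm would be the default
  -- value `0`.
  obtain ⟨l, hl, hp, -⟩ := exists_wreath_word hA hcl hw (pathLaw_support hx).1
    fun s hs => pathLaw_left_eq_one hx hs
  obtain ⟨k, hk, hk', rfl⟩ := exists_word_of_length ⟨l, hl, hp⟩
  rw [← hk]
  exact sum_wordNorm_left_le hA hcl hk' T

theorem wordNorm_le_coverLength_add (hA : ∀ a ∈ A, a⁻¹ ∈ A) (hcl : Subgroup.closure A = ⊤)
    {w : List Γ} (hw : ∀ g ∈ w, g ∈ B) {x : PermWreath Λ Γ S}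
    (hx : x ∈ (pathLaw o μ w).support) :
    wordNorm (wreathGens o A B) x
      ≤ coverLength o B w + ∑ s ∈ visited o w, wordNorm A (x.left.1 s) := by
  obtain ⟨v, hv, hvB, hvp, hvs⟩ := (exists_cover (o := o) (w := w) hw rfl (Subset.refl _)).2
  obtain ⟨l, hl, hp, hn⟩ := exists_wreath_word hA hcl hvB
    ((pathLaw_support hx).1.trans hvp.symm)
    fun s hs => pathLaw_left_eq_one hx fun h => hs (hvs h)
  rw [← hp]
  refine (wordNorm_le hl).trans (hn.trans ?_)
  rw [hv, hp, sum_subset hvs]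
  intro s _ hs
  rw [pathLaw_left_eq_one hx hs, wordNorm_one]

theorem pexp_sum_wordNorm_left (hμ : μ.support.Finite) (w : List Γ) :
    pexp (pathLaw o μ w) (fun x => ∑ s ∈ visited o w, (wordNorm A (x.left.1 s) : ℝ))
      = ∑ s ∈ visited o w, meanNorm A μ (switches o w s) := by
  rw [pexp_sum (finite_support_pathLaw hμ w)]
  exact sum_congr rfl fun s _ => pexp_pathLaw_left hμ w s fun a => (wordNorm A a : ℝ)

theorem pexp_meanNorm_le_meanNorm (hA : ∀ a ∈ A, a⁻¹ ∈ A) (hcl : Subgroup.closure A = ⊤)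
    (hμ : μ.support.Finite) (hγ : γ.support.Finite) (hB : γ.support ⊆ B) (n : ℕ) :
    pexp (iid γ n) (fun w => ∑ s ∈ visited o w, meanNorm A μ (switches o w s))
      ≤ meanNorm (wreathGens o A B) (swsStep o μ γ) n := by
  rw [meanNorm_eq, pexp_walkLaw_swsStep hμ hγ]
  refine pexp_mono (finite_support_iid hγ n) fun w hw => ?_
  rw [← pexp_sum_wordNorm_left hμ]
  refine pexp_mono (finite_support_pathLaw hμ w) fun x hx => ?_
  exact_mod_cast sum_wordNorm_left_le_wordNorm hA hcl
    (fun g hg => hB ((mem_support_iid hw).2 g hg)) hx _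

theorem meanNorm_le_pexp (hA : ∀ a ∈ A, a⁻¹ ∈ A) (hcl : Subgroup.closure A = ⊤)
    (hμ : μ.support.Finite) (hγ : γ.support.Finite) (hB : γ.support ⊆ B) (n : ℕ) :
    meanNorm (wreathGens o A B) (swsStep o μ γ) n
      ≤ pexp (iid γ n) (fun w => (coverLength o B w : ℝ))
        + pexp (iid γ n) fun w => ∑ s ∈ visited o w, meanNorm A μ (switches o w s) := by
  rw [meanNorm_eq, pexp_walkLaw_swsStep hμ hγ, ← pexp_add (finite_support_iid hγ n)]
  refine pexp_mono (finite_support_iid hγ n) fun w hw => ?_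
  have hf := finite_support_pathLaw (o := o) hμ w
  rw [← pexp_sum_wordNorm_left hμ, ← pexp_const hf (coverLength o B w : ℝ), ← pexp_add hf]
  refine pexp_mono hf fun x hx => ?_
  exact_mod_cast wordNorm_le_coverLength_add hA hcl
    (fun g hg => hB ((mem_support_iid hw).2 g hg)) hx

theorem coverLength_le_length {w : List Γ} (hw : ∀ g ∈ w, g ∈ B) :
    coverLength o B w ≤ w.length :=
  (exists_cover hw rfl (Subset.refl _)).1

end WreathNorm

end SwitchWalk
end

noncomputable section

namespace SwitchWalk

open Finset

/-! ### Subadditive sequences -/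

section Subadditive

variable {u U : ℕ → ℝ}

theorem le_nat_mul_of_subadditive (h0 : u 0 = 0) (h : ∀ i j, u (i + j) ≤ u i + u j) (r k : ℕ) :
    u (r * k) ≤ r * u k := by
  induction r with
  | zero => simp [h0]
  | succ r ih =>
    rw [Nat.succ_mul]
    push_cast
    linarith [h (r * k) k]

theorem interp_le_of_monotone (hU : Monotone U) (x : ℝ) : interp U x ≤ U (⌊x⌋₊ + 1) := by
  rw [interp]
  have h := hU (Nat.le_succ ⌊x⌋₊)
  have h2 : x - ⌊x⌋₊ ≤ 1 := by linarith [Nat.lt_floor_add_one x]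
  nlinarith

theorem le_interp_of_monotone (hU : Monotone U) {x : ℝ} (hx : 0 ≤ x) : U ⌊x⌋₊ ≤ interp U x := by
  rw [interp]
  have h := hU (Nat.le_succ ⌊x⌋₊)
  nlinarith [mul_nonneg (sub_nonneg.2 (Nat.floor_le hx)) (sub_nonneg.2 h)]

theorem interp_of_lt_one (h0 : U 0 = 0) {x : ℝ} (hx1 : x < 1) : interp U x = x * U 1 := by
  have : ⌊x⌋₊ = 0 := Nat.floor_eq_zero.2 hx1
  rw [interp, this]
  simp [h0]

theorem half_le_floor {x : ℝ} (hx : 1 ≤ x) : x / 2 ≤ ⌊x⌋₊ := by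
  have h1 : (1 : ℝ) ≤ ⌊x⌋₊ := by exact_mod_cast Nat.one_le_floor_iff x |>.2 hx
  linarith [Nat.lt_floor_add_one x]

/-- The running maximum of a sequence. -/
def runMax (u : ℕ → ℝ) (n : ℕ) : ℝ := sSup (u '' Set.Iic n)

/-- The infimum of the tail of a sequence. -/
def tailInf (u : ℕ → ℝ) (n : ℕ) : ℝ := sInf (u '' Set.Ici n)

theorem le_runMax (u : ℕ → ℝ) {k n : ℕ} (h : k ≤ n) : u k ≤ runMax u n :=
  le_csSup ((Set.finite_Iic n).image u).bddAbove ⟨k, h, rfl⟩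

theorem runMax_le {n : ℕ} {c : ℝ} (h : ∀ k ≤ n, u k ≤ c) : runMax u n ≤ c :=
  csSup_le ⟨_, 0, Nat.zero_le n, rfl⟩ (by rintro _ ⟨k, hk, rfl⟩; exact h k hk)

theorem runMax_mono (u : ℕ → ℝ) : Monotone (runMax u) :=
  fun _ _ h => runMax_le fun _ hk => le_runMax u (hk.trans h)

theorem runMax_zero (u : ℕ → ℝ) : runMax u 0 = u 0 := by
  refine le_antisymm (runMax_le fun k hk => ?_) (le_runMax u le_rfl)
  rw [Nat.le_zero.1 hk]

theorem runMax_add_le (h : ∀ i j, u (i + j) ≤ u i + u j) (i j : ℕ) :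
    runMax u (i + j) ≤ runMax u i + runMax u j := by
  refine runMax_le fun k hk => ?_
  obtain ⟨a, b, ha, hb, rfl⟩ : ∃ a b, a ≤ i ∧ b ≤ j ∧ a + b = k :=
    ⟨min k i, k - min k i, by omega, by omega, by omega⟩
  exact (h a b).trans (add_le_add (le_runMax u ha) (le_runMax u hb))

theorem tailInf_le (hu : ∀ n, 0 ≤ u n) {k n : ℕ} (h : n ≤ k) : tailInf u n ≤ u k :=
  csInf_le ⟨0, by rintro _ ⟨k, -, rfl⟩; exact hu k⟩ ⟨k, h, rfl⟩

theorem le_tailInf {n : ℕ} {c : ℝ} (h : ∀ k, n ≤ k → c ≤ u k) : c ≤ tailInf u n :=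
  le_csInf ⟨_, n, le_refl n, rfl⟩ (by rintro _ ⟨k, hk, rfl⟩; exact h k hk)

theorem tailInf_mono (hu : ∀ n, 0 ≤ u n) : Monotone (tailInf u) :=
  fun _ _ h => le_tailInf fun _ hk => tailInf_le hu (h.trans hk)

theorem tailInf_nonneg (hu : ∀ n, 0 ≤ u n) (n : ℕ) : 0 ≤ tailInf u n :=
  le_tailInf fun k _ => hu k

theorem upperSpeed_eq {G : Type*} [Group G] (A : Set G) (ν : PMF G) (x : ℝ) :
    upperSpeed A ν x = interp (runMax (meanNorm A ν)) x := rfl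

theorem lowerSpeed_eq {G : Type*} [Group G] (A : Set G) (ν : PMF G) (x : ℝ) :
    lowerSpeed A ν x = interp (tailInf (meanNorm A ν)) x := rfl

/-- A subadditive sequence decays at most linearly below the scale `m`. -/
theorem le_of_subadditive (h0 : u 0 = 0) (h : ∀ i j, u (i + j) ≤ u i + u j) (hu : ∀ n, 0 ≤ u n)
    {m : ℕ} (hm : 0 < m) (hU : ∀ k, m ≤ k → U m ≤ u k) (hU0 : 0 ≤ U m) (k : ℕ) :
    U m / (17 * m) * (k - (k : ℝ) ^ 2 / (16 * m)) ≤ u k := by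
  have hm' : (0 : ℝ) < m := by exact_mod_cast hm
  have hc : 0 ≤ U m / (17 * m) := by positivity
  rcases Nat.eq_zero_or_pos k with rfl | hk
  · simpa using hu 0
  have hk' : (0 : ℝ) < k := by exact_mod_cast hk
  -- For `k ≤ 16m`, the multiple `rk` with `r = ⌊m/k⌋ + 1` exceeds `m` and satisfies `rk ≤ m + k ≤
  -- 17m`. Beyond `16m` the claimed lower bound is not positive.
  rcases le_or_gt (k : ℝ) (16 * m) with hkm | hkm
  · obtain ⟨r, hr⟩ : ∃ r : ℕ, r = m / k + 1 := ⟨_, rfl⟩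
    have h1 : m ≤ r * k := by
      rw [hr, Nat.succ_mul]
      have := Nat.div_add_mod m k
      have := Nat.mod_lt m hk
      nlinarith
    have h2 := (hU _ h1).trans (le_nat_mul_of_subadditive h0 h r k)
    have h3 : (r : ℝ) * k ≤ 17 * m := by
      have h4 : (m / k * k : ℕ) ≤ m := Nat.div_mul_le_self m k
      have h4' : ((m / k : ℕ) : ℝ) * k ≤ m := by exact_mod_cast h4
      rw [hr]
      push_cast
      nlinarith
    have h5 : U m * k ≤ 17 * m * u k := by
      nlinarith [mul_le_mul_of_nonneg_right h2 hk'.le, mul_le_mul_of_nonneg_right h3 (hu k)]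
    calc U m / (17 * m) * (k - (k : ℝ) ^ 2 / (16 * m)) ≤ U m / (17 * m) * k :=
          mul_le_mul_of_nonneg_left (sub_le_self _ (by positivity)) hc
      _ ≤ u k := by
          rw [div_mul_eq_mul_div, div_le_iff₀ (by positivity)]
          linarith
  · refine le_trans (mul_nonpos_of_nonneg_of_nonpos hc ?_) (hu k)
    rw [sub_nonpos, le_div_iff₀ (by positivity)]
    nlinarith

theorem le_div_add_one_mul (h0 : U 0 = 0) (h : ∀ i j, U (i + j) ≤ U i + U j) (hU : Monotone U)
    {k : ℕ} (hk : 0 < k) (N : ℕ) : U N ≤ (N / k + 1) * U k := by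
  have h1 : N ≤ (N / k + 1) * k := by
    rw [Nat.succ_mul]
    have := Nat.div_add_mod N k
    have := Nat.mod_lt N hk
    nlinarith
  refine (hU h1).trans ((le_nat_mul_of_subadditive h0 h _ k).trans ?_)
  have h2 : 0 ≤ U k := h0 ▸ hU (Nat.zero_le k)
  refine mul_le_mul_of_nonneg_right ?_ h2
  push_cast
  exact add_le_add_left Nat.cast_div_le _

end Subadditive

/-! ### Sums over the inverted orbit -/

section OrbitSums

variable {Γ S : Type*} [Group Γ] [MulAction Γ S] {o : S} {γ : PMF Γ} {u U : ℕ → ℝ}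

/-- Sum the bound of `le_of_subadditive` over the sites at a scale `m` close to `1/p`. The linear
terms add up to `2n`, and the second moment of the local times limits the quadratic loss to `n`. -/
theorem mul_interp_le_pexp_sum (hγ : γ.support.Finite) (h0 : u 0 = 0)
    (h : ∀ i j, u (i + j) ≤ u i + u j) (hu : ∀ n, 0 ≤ u n) (hU : Monotone U)
    (hUu : ∀ m k, m ≤ k → U m ≤ u k) (hU0 : ∀ m, 0 ≤ U m) (n : ℕ) {p : ℝ} (hp0 : 0 < p)
    (hp : p ≤ returnTail o γ n) :
    n * p * interp U (1 / p)
      ≤ 34 * pexp (iid γ n) fun w => ∑ s ∈ visited o w, u (switches o w s) := by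
  rcases Nat.eq_zero_or_pos n with rfl | hn
  · rw [Nat.cast_zero, zero_mul, zero_mul]
    exact mul_nonneg (by norm_num) (pexp_nonneg fun w => sum_nonneg fun s _ => hu _)
  have hn' : (1 : ℝ) ≤ n := by exact_mod_cast hn
  have hp1 : p ≤ 1 :=
    hp.trans ((returnTail_anti hγ (Nat.zero_le n)).trans_eq returnTail_zero)
  -- Just above `1/p`: this gives `1/m ≤ p ≤ P(T > n)`, lets `U m` dominate the interpolated value,
  -- and still keeps `mp ≤ 2`.
  obtain ⟨m, hm⟩ : ∃ m, m = ⌊1 / p⌋₊ + 1 := ⟨_, rfl⟩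
  have hm0 : 0 < m := by omega
  have hm' : (0 : ℝ) < m := by exact_mod_cast hm0
  have hpm : 1 / p < m := by rw [hm]; push_cast; exact Nat.lt_floor_add_one _
  have hmp : (m : ℝ) * p ≤ 2 := by
    have h1 : (⌊1 / p⌋₊ : ℝ) ≤ 1 / p := Nat.floor_le (by positivity)
    have h2 : (m : ℝ) ≤ 1 / p + 1 := by rw [hm]; push_cast; linarith
    have := mul_le_mul_of_nonneg_right h2 hp0.le
    have e : (1 / p + 1) * p = 1 + p := by field_simp
    linarith
  have ht : (1 : ℝ) / m ≤ returnTail o γ n := by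
    refine le_trans ?_ hp
    rw [div_le_iff₀ hm']
    rw [div_lt_iff₀ hp0] at hpm
    linarith
  have hf := finite_support_iid hγ n
  have hsq := pexp_sum_sq_visits_mul_le hγ ht
  set V := pexp (iid γ n) fun w => ∑ s ∈ visited o w, (visits o w s : ℝ) ^ 2 with hV
  have hlow : U m / (17 * m) * (2 * n - 4 / (16 * m) * V)
      ≤ pexp (iid γ n) fun w => ∑ s ∈ visited o w, u (switches o w s) := by
    rw [hV, ← pexp_mul_left, ← pexp_const hf (2 * n : ℝ), ← pexp_sub hf, ← pexp_mul_left]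
    refine pexp_mono hf fun w hw => ?_
    have hs : ∑ s ∈ visited o w, (switches o w s : ℝ) = 2 * n := by
      rw [← (mem_support_iid hw).1]
      exact_mod_cast sum_switches (Subset.refl (visited o w))
    calc U m / (17 * m) * (2 * n - 4 / (16 * m) * ∑ s ∈ visited o w, (visits o w s : ℝ) ^ 2)
        ≤ U m / (17 * m) * ∑ s ∈ visited o w,
            ((switches o w s : ℝ) - (switches o w s : ℝ) ^ 2 / (16 * m)) := by
          refine mul_le_mul_of_nonneg_left ?_ (div_nonneg (hU0 m) (by positivity))
          rw [sum_sub_distrib, hs, mul_sum]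
          refine sub_le_sub_left (sum_le_sum fun s _ => ?_) _
          have h1 : (switches o w s : ℝ) ≤ 2 * visits o w s := by
            exact_mod_cast switches_le w s
          rw [div_mul_eq_mul_div]
          refine div_le_div_of_nonneg_right ?_ (by positivity)
          nlinarith [Nat.cast_nonneg (α := ℝ) (switches o w s)]
      _ ≤ ∑ s ∈ visited o w, u (switches o w s) := by
          rw [mul_sum]
          exact sum_le_sum fun s _ =>
            le_of_subadditive h0 h hu hm0 (hUu m) (hU0 m) (switches o w s)
  -- The second moment bound is `V/m ≤ 3n + 1 ≤ 4n`. The `4` in the numerator comes from `switches ≤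
  -- 2 * visits`, and `16` is large enough for the loss to take at most half of `2n`.
  have hV2 : 4 / (16 * m) * V ≤ n := by
    have : 4 / (16 * m) * V = (V * (1 / m)) / 4 := by field_simp; norm_num
    rw [this]
    linarith
  have h2 : U m / (17 * m) * n ≤ U m / (17 * m) * (2 * n - 4 / (16 * m) * V) :=
    mul_le_mul_of_nonneg_left (by linarith) (div_nonneg (hU0 m) (by positivity))
  have h3 : n * p * interp U (1 / p) ≤ n * p * U m := by
    rw [hm]
    exact mul_le_mul_of_nonneg_left (interp_le_of_monotone hU _) (by positivity)
  -- The constant `34` is `17 · 2`, from `le_of_subadditive` and `p ≤ 2/m`.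
  have h4 : n * p * U m ≤ 34 * (U m / (17 * m) * n) := by
    have e : 34 * (U m / (17 * m) * n) = 2 / m * (n * U m) := by field_simp; ring
    have h5 : p ≤ 2 / m := by rw [le_div_iff₀ hm']; linarith
    rw [e]
    have := mul_le_mul_of_nonneg_right h5 (mul_nonneg (Nat.cast_nonneg (α := ℝ) n) (hU0 m))
    linarith
  linarith

/-- With `k = ⌊n/q⌋`, a site with `N` switches costs at most `(N/k + 1) U k`. Summed over the orbit
this is `(2n/k + |orbit|) U k`; here `n/k ≤ 2q` and the orbit has mean size at most `q`, whence the
`5`. -/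
theorem pexp_sum_le_mul_interp (hγ : γ.support.Finite) (h0 : U 0 = 0)
    (h : ∀ i j, U (i + j) ≤ U i + U j) (hU : Monotone U) (n : ℕ) {q : ℝ}
    (hq : ∑ i ∈ range (n + 1), returnTail o γ i ≤ q) :
    pexp (iid γ n) (fun w => ∑ s ∈ visited o w, U (switches o w s))
      ≤ 5 * (q * interp U (n / q)) := by
  have hf := finite_support_iid hγ n
  have hU0 : ∀ k, 0 ≤ U k := fun k => h0 ▸ hU (Nat.zero_le k)
  have hq1 : 1 ≤ q := by
    refine le_trans ?_ hq
    rw [sum_range_succ', returnTail_zero]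
    have := sum_nonneg fun i (_ : i ∈ range n) => returnTail_nonneg (o := o) (γ := γ) (i + 1)
    linarith
  have hq0 : 0 < q := by linarith
  have hsum : ∀ w ∈ (iid γ n).support, ∑ s ∈ visited o w, (switches o w s : ℝ) = 2 * n := by
    intro w hw
    rw [← (mem_support_iid hw).1]
    exact_mod_cast sum_switches (Subset.refl (visited o w))
  -- Below `q` the scale `⌊n/q⌋` is zero. There the interpolation is the line from `U 0 = 0` to `U
  -- 1`, and `U N ≤ N * U 1` suffices.
  rcases lt_or_ge (n : ℝ) q with hnq | hnq
  · have hx : (n : ℝ) / q < 1 := by rwa [div_lt_one hq0]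
    rw [interp_of_lt_one h0 hx]
    have e : 5 * (q * (n / q * U 1)) = 5 * n * U 1 := by field_simp
    rw [e]
    calc pexp (iid γ n) (fun w => ∑ s ∈ visited o w, U (switches o w s))
        ≤ pexp (iid γ n) fun _ => 2 * n * U 1 := by
          refine pexp_mono hf fun w hw => ?_
          rw [← hsum w hw, sum_mul]
          refine sum_le_sum fun s _ => ?_
          simpa using le_nat_mul_of_subadditive h0 h (switches o w s) 1
      _ = 2 * n * U 1 := pexp_const hf _
      _ ≤ 5 * n * U 1 := by
          have := mul_nonneg (Nat.cast_nonneg (α := ℝ) n) (hU0 1)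
          nlinarith
  · have hx : 1 ≤ (n : ℝ) / q := by rwa [one_le_div hq0]
    obtain ⟨k, hk⟩ : ∃ k, k = ⌊(n : ℝ) / q⌋₊ := ⟨_, rfl⟩
    have hk2 : (n : ℝ) / q / 2 ≤ k := hk ▸ half_le_floor hx
    have hk0 : (0 : ℝ) < k := by linarith
    have hk0' : 0 < k := by exact_mod_cast hk0
    have hint : U k ≤ interp U (n / q) := hk ▸ le_interp_of_monotone hU (by linarith)
    have hnk : (n : ℝ) / k ≤ 2 * q := by
      rw [div_le_iff₀ hk0]
      rw [div_div, div_le_iff₀ (by positivity)] at hk2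
      linarith
    calc pexp (iid γ n) (fun w => ∑ s ∈ visited o w, U (switches o w s))
        ≤ pexp (iid γ n) fun w => (2 * n / k + (visited o w).card) * U k := by
          refine pexp_mono hf fun w hw => ?_
          have e : (2 * n / k + (visited o w).card) * U k
              = ∑ s ∈ visited o w, ((switches o w s : ℝ) / k + 1) * U k := by
            rw [← sum_mul, sum_add_distrib, ← sum_div, hsum w hw]
            simp
          rw [e]
          exact sum_le_sum fun s _ => le_div_add_one_mul h0 h hU hk0' _
      _ = (2 * n / k + ∑ i ∈ range (n + 1), returnTail o γ i) * U k := by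
          rw [pexp_mul_right, pexp_add hf, pexp_const hf, pexp_card_visited hγ]
      _ ≤ (5 * q) * U k := by
          refine mul_le_mul_of_nonneg_right ?_ (hU0 k)
          have : 2 * (n : ℝ) / k = 2 * (n / k) := by ring
          rw [this]
          linarith
      _ ≤ 5 * (q * interp U (n / q)) := by
          have := mul_le_mul_of_nonneg_left hint hq0.le
          linarith

variable {Λ : Type*} [Group Λ] {A : Set Λ} {B : Set Γ} {μ : PMF Λ}

theorem lowerSpeed_le_meanNorm (hA : ∀ a ∈ A, a⁻¹ ∈ A) (hcl : Subgroup.closure A = ⊤)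
    (hμ : μ.support.Finite) (hγ : γ.support.Finite) (hB : γ.support ⊆ B) (n : ℕ) {p : ℝ}
    (hp0 : 0 < p) (hp : p ≤ returnTail o γ n) :
    n * p * lowerSpeed A μ (1 / p)
      ≤ 34 * meanNorm (wreathGens o A B) (swsStep o μ γ) n := by
  refine le_trans ?_ (mul_le_mul_of_nonneg_left
    (pexp_meanNorm_le_meanNorm (o := o) hA hcl hμ hγ hB n) (by norm_num))
  rw [lowerSpeed_eq]
  exact mul_interp_le_pexp_sum hγ (meanNorm_zero A μ) (meanNorm_add_le hA hcl hμ)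
    (meanNorm_nonneg A μ) (tailInf_mono (meanNorm_nonneg A μ))
    (fun m k h => tailInf_le (meanNorm_nonneg A μ) h) (tailInf_nonneg (meanNorm_nonneg A μ)) n
    hp0 hp

theorem entropyFun_le_walkEntropy (hμ : μ.support.Finite) (hγ : γ.support.Finite) (n : ℕ) {p : ℝ}
    (hp0 : 0 < p) (hp : p ≤ returnTail o γ n) :
    n * p * entropyFun μ (1 / p) ≤ 34 * walkEntropy (swsStep o μ γ) n := by
  refine le_trans ?_ (mul_le_mul_of_nonneg_left
    (pexp_ent_le_walkEntropy (o := o) hμ hγ n) (by norm_num))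
  exact mul_interp_le_pexp_sum hγ (walkEntropy_zero μ) (walkEntropy_add_le hμ)
    (walkEntropy_nonneg μ) (walkEntropy_mono hμ) (fun m k h => walkEntropy_mono hμ h)
    (walkEntropy_nonneg μ) n hp0 hp

end OrbitSums

end SwitchWalk
end

noncomputable section

namespace SwitchWalk

open Finset

namespace DegreeSeq

/-! ### Portraits of words in the mother group -/

theorem perm_inv_apply_self {α : Type*} (σ : Equiv.Perm α) (x : α) : σ⁻¹ (σ x) = x :=
  σ.symm_apply_apply x

theorem perm_apply_inv_self {α : Type*} (σ : Equiv.Perm α) (x : α) : σ (σ⁻¹ x) = x :=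
  σ.apply_symm_apply x

variable (m : DegreeSeq)

/-- The degree sequence of the subtrees of the root. -/
def shift : DegreeSeq where
  deg i := m.deg (i + 1)
  two_le i := m.two_le (i + 1)
  bounded := m.bounded.mono (by rintro _ ⟨i, rfl⟩; exact ⟨i + 1, rfl⟩)

variable {m}

/-- The ray in the subtree at `a` that corresponds to the ray `x`. -/
def cons (a : Fin (m.deg 0)) (x : m.shift.Ray) : m.Ray
  | 0 => a
  | i + 1 => x i

/-- All digits but the first. -/
def tailRay (x : m.Ray) : m.shift.Ray := fun i => x (i + 1)

theorem cons_tailRay (x : m.Ray) : cons (x 0) (tailRay x) = x := by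
  funext i; cases i <;> rfl

theorem cons_inj {a b : Fin (m.deg 0)} {x y : m.shift.Ray} :
    cons a x = cons b y ↔ a = b ∧ x = y :=
  ⟨fun h => ⟨congrFun h 0, congrArg tailRay h⟩, by rintro ⟨rfl, rfl⟩; rfl⟩

variable (m) in
/-- The first digit of the zero ray. -/
def zeroDigit : Fin (m.deg 0) := m.zeroRay 0

theorem cons_zeroRay : cons m.zeroDigit m.shift.zeroRay = m.zeroRay := by
  funext i; cases i <;> rfl

theorem rootPerm_cons (σ : Equiv.Perm (Fin (m.deg 0))) (a : Fin (m.deg 0)) (x : m.shift.Ray) :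
    m.rootPerm σ (cons a x) = cons (σ a) x := by
  funext i
  cases i with
  | zero => exact Function.update_self (0 : ℕ) (σ a) (cons a x)
  | succ i => exact Function.update_of_ne (Nat.succ_ne_zero i) (σ a) (cons a x)

/-- A generator: a permutation of the subtrees of the root, or a power of `ρ`. -/
abbrev Letter (m : DegreeSeq) : Type := Equiv.Perm (Fin (m.deg 0)) ⊕ ℕ

/-- The automorphism given by a letter. -/
def letterPerm : m.Letter → Equiv.Perm m.Ray
  | Sum.inl σ => m.rootPerm σ
  | Sum.inr a => m.rho ^ a

open Classical in
/-- The letter by which `ρ ^ a` acts on the subtree at `j`. -/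
def section_ (j : Fin (m.deg 0)) (a : ℕ) : m.shift.Letter :=
  if j = m.zeroDigit then Sum.inr a else Sum.inl (finRotate (m.shift.deg 0) ^ a)

theorem rho_apply (x : m.Ray) : m.rho x = m.twist (fun i => finRotate (m.deg i)) x := rfl

theorem firstNonzero_cons_succ {x : m.shift.Ray} {i : ℕ} :
    FirstNonzero (cons m.zeroDigit x) (i + 1) ↔ FirstNonzero x i := by
  constructor
  · rintro ⟨h1, h2⟩
    exact ⟨fun j hj => h1 (j + 1) (by omega), h2⟩
  · rintro ⟨h1, h2⟩
    refine ⟨fun j hj => ?_, h2⟩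
    cases j with
    | zero => rfl
    | succ j => exact h1 j (by omega)

theorem rho_cons_zeroDigit (x : m.shift.Ray) :
    m.rho (cons m.zeroDigit x) = cons m.zeroDigit (m.shift.rho x) := by
  rw [rho_apply]
  funext i
  rcases i with - | - | i
  · rfl
  · have : ¬ FirstNonzero (cons m.zeroDigit x) 0 := fun h => h.2 rfl
    simp only [twist, this, if_false]
    rfl
  · change m.twist _ _ (i + 1 + 1) =
      m.shift.twist (fun i => finRotate (m.shift.deg i)) x (i + 1)
    by_cases h : FirstNonzero x i
    · exact (if_pos (firstNonzero_cons_succ.2 h)).trans (if_pos h).symm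
    · exact (if_neg (mt firstNonzero_cons_succ.1 h)).trans (if_neg h).symm

theorem rho_cons {j : Fin (m.deg 0)} (hj : j ≠ m.zeroDigit) (x : m.shift.Ray) :
    m.rho (cons j x) = cons j (m.shift.rootPerm (finRotate (m.shift.deg 0)) x) := by
  have hj' : (j : ℕ) ≠ 0 := fun h => hj (Fin.ext h)
  rw [rho_apply]
  funext i
  rcases i with - | - | i
  · rfl
  · have : FirstNonzero (cons j x) 0 := ⟨by simp, hj'⟩
    simp only [twist, this, if_true]
    exact (Function.update_self (0 : ℕ) _ x).symm
  · have : ¬ FirstNonzero (cons j x) (i + 1) := fun h => hj' (h.1 0 (by omega))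
    simp only [twist, this, if_false]
    exact (Function.update_of_ne (Nat.succ_ne_zero i)
      (finRotate (m.shift.deg 0) (x 0)) x).symm

theorem rootPerm_mul (σ τ : Equiv.Perm (Fin (m.deg 0))) :
    m.rootPerm (σ * τ) = m.rootPerm σ * m.rootPerm τ := by
  ext x : 1
  rw [← cons_tailRay x, Equiv.Perm.mul_apply, rootPerm_cons, rootPerm_cons, rootPerm_cons,
    Equiv.Perm.mul_apply]

theorem rootPerm_one : m.rootPerm 1 = 1 := by
  ext x : 1
  rw [← cons_tailRay x, rootPerm_cons]
  rfl

theorem rho_pow_cons (j : Fin (m.deg 0)) (a : ℕ) (x : m.shift.Ray) :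
    (m.rho ^ a) (cons j x) = cons j (letterPerm (section_ j a) x) := by
  by_cases hj : j = m.zeroDigit
  · rw [section_, if_pos hj, letterPerm]
    subst hj
    induction a with
    | zero => rfl
    | succ a ih =>
      rw [pow_succ', pow_succ', Equiv.Perm.mul_apply, ih, rho_cons_zeroDigit, Equiv.Perm.mul_apply]
  · rw [section_, if_neg hj, letterPerm]
    induction a with
    | zero => rw [pow_zero, pow_zero, rootPerm_one]; rfl
    | succ a ih =>
      rw [pow_succ', pow_succ', Equiv.Perm.mul_apply, ih, rho_cons hj, rootPerm_mul,
        Equiv.Perm.mul_apply]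

theorem rho_zeroRay : m.rho m.zeroRay = m.zeroRay := by
  have h : ∀ i, ¬ FirstNonzero m.zeroRay i := fun i h => h.2 rfl
  rw [rho_apply]
  funext i
  cases i with
  | zero => rfl
  | succ i => simp only [twist, h, if_false]

theorem rho_pow_zeroRay (a : ℕ) : (m.rho ^ a) m.zeroRay = m.zeroRay := by
  induction a with
  | zero => rfl
  | succ a ih => rw [pow_succ', Equiv.Perm.mul_apply, ih, rho_zeroRay]

theorem finRotate_pow_eq_one {d k : ℕ} (h : d ∣ k) : finRotate d ^ k = 1 := by
  cases d with
  | zero => exact Subsingleton.elim _ _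
  | succ d =>
    cases d with
    | zero => exact Equiv.ext fun i => Subsingleton.elim (α := Fin 1) _ _
    | succ d =>
      rw [← orderOf_dvd_iff_pow_eq_one, isCycle_finRotate.orderOf, support_finRotate, card_univ,
        Fintype.card_fin]
      exact h

theorem rho_pow_apply_succ (a : ℕ) (x : m.Ray) (i : ℕ) [Decidable (FirstNonzero x i)] :
    (m.rho ^ a) x (i + 1) =
      if FirstNonzero x i then (finRotate (m.deg (i + 1)) ^ a) (x (i + 1)) else x (i + 1) := by
  induction a generalizing x with
  | zero => simp
  | succ a ih =>
    classical
    rw [pow_succ, Equiv.Perm.mul_apply, ih]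
    have h : FirstNonzero (m.rho x) i ↔ FirstNonzero x i := m.firstNonzero_twist _ x i
    have h2 : m.rho x (i + 1)
        = if FirstNonzero x i then finRotate (m.deg (i + 1)) (x (i + 1)) else x (i + 1) := by
      rw [rho_apply, twist]
      congr!
    rw [h2]
    by_cases hx : FirstNonzero x i
    · simp only [h, hx, if_true, pow_succ, Equiv.Perm.mul_apply]
    · simp only [h, hx, if_false]

theorem rho_pow_eq_one {k : ℕ} (hk : ∀ i, m.deg (i + 1) ∣ k) : m.rho ^ k = 1 := by
  classical
  have h0 : ∀ (a : ℕ) (x : m.Ray), (m.rho ^ a) x 0 = x 0 := by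
    intro a
    induction a with
    | zero => intro x; rfl
    | succ a ih => intro x; rw [pow_succ', Equiv.Perm.mul_apply]; exact ih x
  refine Equiv.ext fun x => funext fun i => ?_
  cases i with
  | zero => exact h0 k x
  | succ i =>
    rw [rho_pow_apply_succ, finRotate_pow_eq_one (hk i)]
    simp

/-- The automorphism given by a word. -/
def wordPerm : List m.Letter → Equiv.Perm m.Ray
  | [] => 1
  | l :: w => letterPerm l * wordPerm w

open Classical in
/-- The part of the inverted orbit of the zero ray at the times of the powers of `ρ`. -/
def hits : List m.Letter → Finset m.Ray
  | [] => ∅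
  | Sum.inl σ :: w => (hits w).image (m.rootPerm σ)
  | Sum.inr a :: w => insert m.zeroRay ((hits w).image ⇑(m.rho ^ a))

/-- The action of a word on the subtrees of the root. -/
def topPerm : List m.Letter → Equiv.Perm (Fin (m.deg 0))
  | [] => 1
  | Sum.inl σ :: w => σ * topPerm w
  | Sum.inr _ :: w => topPerm w

/-- The word that describes the action of a word on the subtree that it moves to `j`. -/
def subword : List m.Letter → Fin (m.deg 0) → List m.shift.Letter
  | [], _ => []
  | Sum.inl σ :: w, j => subword w (σ⁻¹ j)
  | Sum.inr a :: w, j => section_ j a :: subword w j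

theorem wordPerm_cons (w : List m.Letter) (i : Fin (m.deg 0)) (x : m.shift.Ray) :
    wordPerm w (cons i x) = cons (topPerm w i) (wordPerm (subword w (topPerm w i)) x) := by
  induction w with
  | nil => rfl
  | cons l w ih =>
    rw [wordPerm, Equiv.Perm.mul_apply, ih]
    cases l with
    | inl σ => simp [letterPerm, rootPerm_cons, topPerm, subword]
    | inr a => rw [letterPerm, rho_pow_cons, topPerm, subword, wordPerm, Equiv.Perm.mul_apply]

/-- Counting only the times of powers of `ρ` makes the orbit self-similar. Such a letter acts on the
subtree at `0` as a power of `ρ` again and marks its zero ray; on every other subtree it acts as a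
root permutation and marks nothing. -/
theorem cons_mem_hits {w : List m.Letter} {j : Fin (m.deg 0)} {x : m.shift.Ray} :
    cons j x ∈ hits w ↔ x ∈ hits (subword w j) := by
  classical
  induction w generalizing j x with
  | nil => simp [hits, subword]
  | cons l w ih =>
    cases l with
    | inl σ =>
      rw [hits, subword, ← ih, mem_image]
      constructor
      · rintro ⟨y, hy, h⟩
        rw [← cons_tailRay y, rootPerm_cons, cons_inj] at h
        rw [← h.1, ← h.2, perm_inv_apply_self, cons_tailRay]
        exact hy
      · exact fun h => ⟨_, h, by rw [rootPerm_cons, perm_apply_inv_self]⟩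
    | inr a =>
      have h1 : cons j x ∈ (hits w).image ⇑(m.rho ^ a) ↔
          x ∈ (hits (subword w j)).image (letterPerm (section_ j a)) := by
        rw [mem_image, mem_image]
        constructor
        · rintro ⟨y, hy, h⟩
          rw [← cons_tailRay y, rho_pow_cons, cons_inj] at h
          obtain ⟨rfl, h⟩ := h
          exact ⟨_, ih.1 (by rwa [cons_tailRay]), h⟩
        · rintro ⟨y, hy, h⟩
          exact ⟨_, ih.2 hy, by rw [rho_pow_cons, h]⟩
      rw [hits, subword, mem_insert, h1, ← cons_zeroRay, cons_inj]
      by_cases hj : j = m.zeroDigit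
      · simp [section_, hj, hits, letterPerm]
      · simp [section_, hj, hits, letterPerm]

theorem hits_eq_biUnion [DecidableEq m.Ray] (w : List m.Letter) :
    hits w = univ.biUnion fun j => (hits (subword w j)).image (cons j) := by
  ext x
  rw [← cons_tailRay x, cons_mem_hits]
  simp only [mem_biUnion, mem_univ, true_and, mem_image, cons_inj]
  constructor
  · exact fun h => ⟨_, _, h, rfl, rfl⟩
  · rintro ⟨j, y, h, rfl, rfl⟩
    exact h

theorem card_hits (w : List m.Letter) :
    (hits w).card = ∑ j, (hits (subword w j)).card := by
  classical
  rw [hits_eq_biUnion, card_biUnion]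
  · refine sum_congr rfl fun j _ => card_image_of_injective _ fun x y h => (cons_inj.1 h).2
  · intro i _ j _ hij
    rw [Function.onFun, disjoint_left]
    intro x hx hx'
    obtain ⟨y, -, rfl⟩ := mem_image.1 hx
    obtain ⟨z, -, h⟩ := mem_image.1 hx'
    exact hij (cons_inj.1 h).1.symm

/-- If a word applies powers of `ρ` only while the same subtree is at the vertex `0`, then it is
determined by its action on the first digit, by this subtree, and by the total exponent. -/
theorem exists_exponent {w : List m.Letter} {j₀ : Fin (m.deg 0)}
    (h : ∀ j ≠ j₀, hits (subword w j) = ∅) :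
    ∃ a : ℕ, hits w ⊆ {cons j₀ m.shift.zeroRay} ∧ ∀ j, wordPerm (subword w j) =
      (open Classical in if j = j₀ then m.shift.rho ^ a
        else m.shift.rootPerm (finRotate (m.shift.deg 0) ^ a)) := by
  classical
  induction w generalizing j₀ with
  | nil =>
    refine ⟨0, by simp [hits], fun j => ?_⟩
    rw [pow_zero, pow_zero, rootPerm_one, ite_self]
    rfl
  | cons l w ih =>
    cases l with
    | inl σ =>
      obtain ⟨a, h1, h2⟩ := ih (j₀ := σ⁻¹ j₀) fun j hj => by
        have := h (σ j) fun h' => hj (by rw [← h', perm_inv_apply_self])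
        rwa [subword, perm_inv_apply_self] at this
      refine ⟨a, ?_, fun j => ?_⟩
      · rw [hits]
        refine (image_subset_image h1).trans ?_
        rw [image_singleton, rootPerm_cons, perm_apply_inv_self]
      · rw [subword, h2]
        simp only [EmbeddingLike.apply_eq_iff_eq]
    | inr a =>
      -- A power of `ρ` always marks the subtree at `0`, so this must be the exceptional one.
      have hj₀ : j₀ = m.zeroDigit := by
        by_contra hc
        have := h _ (Ne.symm hc)
        rw [subword, section_, if_pos rfl, hits] at this
        exact insert_ne_empty _ _ this
      subst hj₀
      obtain ⟨b, h1, h2⟩ := ih (j₀ := m.zeroDigit) fun j hj => by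
        have := h j hj
        rw [subword, section_, if_neg hj, hits, image_eq_empty] at this
        exact this
      rw [cons_zeroRay] at h1 ⊢
      refine ⟨a + b, ?_, fun j => ?_⟩
      · rw [hits, insert_subset_iff]
        refine ⟨mem_singleton_self _, (image_subset_image h1).trans ?_⟩
        rw [image_singleton, rho_pow_zeroRay]
      · rw [subword, wordPerm, h2, section_]
        split_ifs with hj
        · rw [letterPerm, pow_add]
        · rw [letterPerm, pow_add, rootPerm_mul]

open Classical in
/-- A transformation of the rays that is trivial below the first level but for a power of `ρ` in
the subtree at `j₀`, together with a finite set of rays. -/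
def leafPortrait (π : Equiv.Perm (Fin (m.deg 0))) (j₀ : Fin (m.deg 0)) (a : ℕ) (b : Bool) :
    (m.Ray → m.Ray) × Finset m.Ray :=
  (fun x => cons (π (x 0)) ((if π (x 0) = j₀ then m.shift.rho ^ a
        else m.shift.rootPerm (finRotate (m.shift.deg 0) ^ a)) (tailRay x)),
    if b then {cons j₀ m.shift.zeroRay} else ∅)

open Classical in
/-- A transformation of the rays and a finite set of rays, assembled from the subtrees. -/
def nodePortrait (π : Equiv.Perm (Fin (m.deg 0)))
    (z : Fin (m.deg 0) → (m.shift.Ray → m.shift.Ray) × Finset m.shift.Ray) :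
    (m.Ray → m.Ray) × Finset m.Ray :=
  (fun x => cons (π (x 0)) ((z (π (x 0))).1 (tailRay x)),
    univ.biUnion fun j => (z j).2.image (cons j))

/-- The transformation of the rays and the part of the inverted orbit given by a word. -/
def portrait (w : List m.Letter) : (m.Ray → m.Ray) × Finset m.Ray := (⇑(wordPerm w), hits w)

theorem portrait_eq_node (w : List m.Letter) :
    portrait w = nodePortrait (topPerm w) fun j => portrait (subword w j) := by
  classical
  refine Prod.ext (funext fun x => ?_) ?_
  · conv_lhs => rw [← cons_tailRay x]
    exact wordPerm_cons w _ _
  · exact hits_eq_biUnion w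

/-- With at most one site, at most one subtree is marked, and `exists_exponent` leaves only four
data: the root permutation, the marked subtree, the total exponent, and whether there is a site at
all. All degrees divide `M!`, so the exponent matters only modulo `M!`. -/
theorem portrait_eq_leaf {M : ℕ} (hM : ∀ i, m.deg i ≤ M) {w : List m.Letter}
    (hw : (hits w).card ≤ 1) :
    ∃ j₀, ∃ a < M.factorial, ∃ b, portrait w = leafPortrait (topPerm w) j₀ a b := by
  classical
  have hdvd : ∀ i, m.deg i ∣ M.factorial := fun i =>
    Nat.dvd_factorial (lt_of_lt_of_le Nat.zero_lt_two (m.two_le _)) (hM i)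
  obtain ⟨j₀, hj₀⟩ : ∃ j₀, ∀ j ≠ j₀, hits (subword w j) = ∅ := by
    by_cases h : ∃ j₀, hits (subword w j₀) ≠ ∅
    · obtain ⟨j₀, h⟩ := h
      refine ⟨j₀, fun j hj => ?_⟩
      by_contra hc
      have h1 := card_pos.2 (nonempty_iff_ne_empty.2 h)
      have h2 := card_pos.2 (nonempty_iff_ne_empty.2 hc)
      have h3 : ∑ i ∈ {j₀, j}, (hits (subword w i)).card ≤ (hits w).card := by
        rw [card_hits]
        exact sum_le_sum_of_subset (subset_univ _)
      rw [sum_pair hj.symm] at h3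
      omega
    · push Not at h
      exact ⟨m.zeroDigit, fun j _ => h j⟩
  obtain ⟨a, h1, h2⟩ := exists_exponent hj₀
  refine ⟨j₀, a % M.factorial, Nat.mod_lt _ (Nat.factorial_pos M), !decide (hits w = ∅),
    Prod.ext (funext fun x => ?_) ?_⟩
  · change wordPerm w x = cons _ _
    conv_lhs => rw [← cons_tailRay x, wordPerm_cons, h2]
    have f1 : m.shift.rho ^ M.factorial = 1 := rho_pow_eq_one fun i => hdvd (i + 1 + 1)
    have f2 : finRotate (m.shift.deg 0) ^ M.factorial = 1 := finRotate_pow_eq_one (hdvd 1)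
    have e1 : m.shift.rho ^ (a % M.factorial) = m.shift.rho ^ a := by
      conv_rhs => rw [← Nat.mod_add_div a M.factorial, pow_add, pow_mul, f1, one_pow, mul_one]
    have e2 : finRotate (m.shift.deg 0) ^ (a % M.factorial) = finRotate (m.shift.deg 0) ^ a := by
      conv_rhs => rw [← Nat.mod_add_div a M.factorial, pow_add, pow_mul, f2, one_pow, mul_one]
    rw [e1, e2]
  · change hits w = if _ then _ else _
    rcases subset_singleton_iff.1 h1 with h | h <;> simp [h]

/-- The length of the code of a portrait with `k` sites. -/
def codeLength (M k : ℕ) : ℕ := if k = 0 then 1 else (M + 2) * k - (M + 1)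

theorem codeLength_le {M k : ℕ} (hk : k ≠ 0) : codeLength M k ≤ (M + 2) * k := by
  rw [codeLength, if_neg hk]
  exact Nat.sub_le _ _

theorem one_le_codeLength (M k : ℕ) : 1 ≤ codeLength M k := by
  rw [codeLength]
  split_ifs with h
  · rfl
  · have : M + 2 ≤ (M + 2) * k := Nat.le_mul_of_pos_right _ (Nat.pos_of_ne_zero h)
    omega

/-- Empty subtrees cost `1` and the others `(M + 2) k - (M + 1)`. With at least two nonempty
subtrees among `d ≤ M`, the saving of `2 (M + 2)` pays for the `d` units, for the symbol of the node
itself, and for the `-(M + 1)` on the right. -/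
theorem sum_codeLength_lt {M d : ℕ} (hd : d ≤ M) {k : Fin d → ℕ} {i j : Fin d} (hij : i ≠ j)
    (hi : k i ≠ 0) (hj : k j ≠ 0) : 1 + ∑ l, codeLength M (k l) ≤ codeLength M (∑ l, k l) := by
  have h1 : ∀ l, codeLength M (k l) + (if k l ≠ 0 then M + 2 else 0) = (M + 2) * k l + 1 := by
    intro l
    rw [codeLength]
    by_cases h : k l = 0
    · simp [h]
    · have : M + 2 ≤ (M + 2) * k l := Nat.le_mul_of_pos_right _ (Nat.pos_of_ne_zero h)
      rw [if_neg h, if_pos h]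
      omega
  have h2 : ∑ l, codeLength M (k l) + ∑ l, (if k l ≠ 0 then M + 2 else 0)
      = (M + 2) * ∑ l, k l + d := by
    rw [← sum_add_distrib, sum_congr rfl fun l _ => h1 l, sum_add_distrib, mul_sum]
    simp
  have h3 : 2 * (M + 2) ≤ ∑ l, (if k l ≠ 0 then M + 2 else 0) := by
    calc 2 * (M + 2) = ∑ l ∈ {i, j}, (if k l ≠ 0 then M + 2 else 0) := by
          rw [sum_pair hij, if_pos hi, if_pos hj]; ring
      _ ≤ _ := sum_le_sum_of_subset (subset_univ _)
  have h4 : ∑ l, k l ≠ 0 := by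
    have := single_le_sum (f := k) (fun _ _ => Nat.zero_le _) (mem_univ i)
    omega
  have h5 : codeLength M (∑ l, k l) = (M + 2) * ∑ l, k l - (M + 1) := by
    rw [codeLength, if_neg h4]
  omega

/-- The number of leaf portraits is at most this. -/
def leafCount (M : ℕ) : ℕ := M.factorial * (M * (M.factorial * 2))

/-- The weight of a single node of a portrait. -/
def nodeWeight (M : ℕ) : ℝ := 1 / (leafCount M + M.factorial)

theorem nodeWeight_pos (M : ℕ) : 0 < nodeWeight M := by
  have := Nat.factorial_pos M
  rw [nodeWeight]
  positivity

theorem nodeWeight_le_one (M : ℕ) : nodeWeight M ≤ 1 := by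
  have h : (1 : ℝ) ≤ M.factorial := by exact_mod_cast Nat.factorial_pos M
  have h' : (0 : ℝ) ≤ leafCount M := Nat.cast_nonneg _
  rw [nodeWeight, div_le_one (by linarith)]
  linarith

theorem sum_leaf_le {M : ℕ} (hM : ∀ i, m.deg i ≤ M)
    (s : Finset ((m.Ray → m.Ray) × Finset m.Ray))
    (hs : ∀ z ∈ s, ∃ w : List m.Letter, portrait w = z ∧ (hits w).card ≤ 1) :
    ∑ z ∈ s, nodeWeight M ^ codeLength M z.2.card ≤ leafCount M * nodeWeight M := by
  classical
  have hsub : s ⊆ ((univ : Finset (Equiv.Perm (Fin (m.deg 0)))) ×ˢ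
      ((univ : Finset (Fin (m.deg 0))) ×ˢ (range M.factorial ×ˢ (univ : Finset Bool)))).image
        fun t => leafPortrait t.1 t.2.1 t.2.2.1 t.2.2.2 := by
    intro z hz
    obtain ⟨w, rfl, hw⟩ := hs z hz
    obtain ⟨j, a, ha, b, h⟩ := portrait_eq_leaf hM hw
    exact mem_image.2 ⟨(topPerm w, j, a, b), by simpa using ha, h.symm⟩
  have hcard : s.card ≤ leafCount M := by
    refine (card_le_card hsub).trans (card_image_le.trans ?_)
    rw [card_product, card_product, card_product, card_univ, card_univ, card_univ, card_range,
      Fintype.card_perm, Fintype.card_fin, Fintype.card_bool, leafCount]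
    exact Nat.mul_le_mul (Nat.factorial_le (hM 0)) (Nat.mul_le_mul_right _ (hM 0))
  calc ∑ z ∈ s, nodeWeight M ^ codeLength M z.2.card ≤ ∑ z ∈ s, nodeWeight M :=
        sum_le_sum fun z _ => pow_le_of_le_one (nodeWeight_pos M).le (nodeWeight_le_one M)
          (Nat.one_le_iff_ne_zero.1 (one_le_codeLength _ _))
    _ = s.card * nodeWeight M := by rw [sum_const, nsmul_eq_mul]
    _ ≤ leafCount M * nodeWeight M :=
        mul_le_mul_of_nonneg_right (by exact_mod_cast hcard) (nodeWeight_pos M).le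

/-- If a portrait has at least two sites, then at least two subtrees contain some. -/
theorem exists_ne_hits {w : List m.Letter}
    (hw : 2 ≤ (hits w).card) :
    ∃ i j, i ≠ j ∧ (hits (subword w i)).card ≠ 0 ∧ (hits (subword w j)).card ≠ 0 := by
  by_contra hc
  push Not at hc
  obtain ⟨j₀, hj₀⟩ : ∃ j₀, ∀ j ≠ j₀, hits (subword w j) = ∅ := by
    by_cases h : ∃ j₀, (hits (subword w j₀)).card ≠ 0
    · obtain ⟨j₀, h⟩ := h
      exact ⟨j₀, fun j hj => card_eq_zero.1 (hc j₀ j hj.symm h)⟩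
    · push Not at h
      exact ⟨m.zeroDigit, fun j _ => card_eq_zero.1 (h j)⟩
  obtain ⟨a, h1, -⟩ := exists_exponent hj₀
  have := card_le_card h1
  rw [card_singleton] at this
  omega

theorem sum_le_sum_of_injOn_mapsTo {ι κ : Type*} {s : Finset ι} {t : Finset κ} {f : ι → ℝ}
    {g : κ → ℝ} {F : ι → κ} (hF : Set.InjOn F s) (hst : ∀ z ∈ s, F z ∈ t)
    (hle : ∀ z ∈ s, f z ≤ g (F z)) (hg : ∀ y, 0 ≤ g y) : ∑ z ∈ s, f z ≤ ∑ y ∈ t, g y := by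
  classical
  refine (sum_le_sum hle).trans ?_
  rw [← sum_image (f := g) hF]
  exact sum_le_sum_of_subset_of_nonneg
    (fun y hy => by obtain ⟨z, hz, rfl⟩ := mem_image.1 hy; exact hst z hz) fun y _ _ => hg y

/-- A portrait with several sites is determined by its root permutation and the portraits of the
subtrees. Each subtree has fewer sites, because another one is nonempty. The weight is at most that
of one node times a product over the subtrees, so the sum factors, and each factor is at most `1` by
`ih`. -/
theorem sum_node_le {M r : ℕ} (hM : ∀ i, m.deg i ≤ M)
    (ih : ∀ s : Finset ((m.shift.Ray → m.shift.Ray) × Finset m.shift.Ray),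
      (∀ z ∈ s, ∃ w : List m.shift.Letter, portrait w = z ∧ (hits w).card ≤ r) →
      ∑ z ∈ s, nodeWeight M ^ codeLength M z.2.card ≤ 1)
    (s : Finset ((m.Ray → m.Ray) × Finset m.Ray))
    (hs : ∀ z ∈ s, ∃ w : List m.Letter, portrait w = z ∧ (hits w).card ≤ r + 1 ∧
      2 ≤ (hits w).card) :
    ∑ z ∈ s, nodeWeight M ^ codeLength M z.2.card ≤ M.factorial * nodeWeight M := by
  classical
  have hx := nodeWeight_pos M
  choose! W hW hWr hW2 using hs
  set F : (m.Ray → m.Ray) × Finset m.Ray → Equiv.Perm (Fin (m.deg 0)) ×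
      (Fin (m.deg 0) → (m.shift.Ray → m.shift.Ray) × Finset m.shift.Ray) :=
    fun z => (topPerm (W z), fun j => portrait (subword (W z) j)) with hF
  set t : Fin (m.deg 0) → Finset ((m.shift.Ray → m.shift.Ray) × Finset m.shift.Ray) :=
    fun j => s.image fun z => portrait (subword (W z) j) with ht
  have hinj : Set.InjOn F s := by
    intro z hz z' hz' h
    rw [← hW z hz, ← hW z' hz', portrait_eq_node, portrait_eq_node]
    have h1 := congrArg Prod.fst h
    have h2 := congrArg Prod.snd h
    simp only [hF] at h1 h2
    rw [h1, h2]
  have hsub : ∀ z ∈ s, F z ∈ univ ×ˢ Fintype.piFinset t := by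
    intro z hz
    rw [mem_product, Fintype.mem_piFinset]
    exact ⟨mem_univ _, fun j => mem_image_of_mem _ hz⟩
  have hle : ∀ z ∈ s, nodeWeight M ^ codeLength M z.2.card ≤
      nodeWeight M * ∏ j, nodeWeight M ^ codeLength M ((F z).2 j).2.card := by
    intro z hz
    obtain ⟨i, j, hij, hi, hj⟩ := exists_ne_hits (hW2 z hz)
    rw [prod_pow_eq_pow_sum, ← pow_succ']
    refine pow_le_pow_of_le_one hx.le (nodeWeight_le_one M) ?_
    have hcard : z.2.card = ∑ l, (hits (subword (W z) l)).card := by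
      rw [← card_hits]
      exact congrArg (fun y => y.2.card) (hW z hz).symm
    have := sum_codeLength_lt (hM 0) (k := fun l => (hits (subword (W z) l)).card) hij hi hj
    rw [hcard]
    rw [add_comm] at this
    exact this
  have ht1 : ∀ j, ∑ y ∈ t j, nodeWeight M ^ codeLength M y.2.card ≤ 1 := by
    intro j
    refine ih _ fun y hy => ?_
    obtain ⟨z, hz, rfl⟩ := mem_image.1 hy
    refine ⟨_, rfl, ?_⟩
    obtain ⟨i, i', hii, hi, hi'⟩ := exists_ne_hits (hW2 z hz)
    obtain ⟨l, hlj, hl⟩ : ∃ l, l ≠ j ∧ (hits (subword (W z) l)).card ≠ 0 := by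
      by_cases h : i = j
      · exact ⟨i', fun h' => hii (h.trans h'.symm), hi'⟩
      · exact ⟨i, h, hi⟩
    have h3 : ∑ i ∈ {j, l}, (hits (subword (W z) i)).card ≤ (hits (W z)).card := by
      rw [card_hits]
      exact sum_le_sum_of_subset (subset_univ _)
    rw [sum_pair hlj.symm] at h3
    have := hWr z hz
    omega
  calc ∑ z ∈ s, nodeWeight M ^ codeLength M z.2.card
      ≤ ∑ y ∈ univ ×ˢ Fintype.piFinset t,
          nodeWeight M * ∏ j, nodeWeight M ^ codeLength M (y.2 j).2.card :=
        sum_le_sum_of_injOn_mapsTo hinj hsub hle fun _ =>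
          mul_nonneg hx.le (prod_nonneg fun _ _ => pow_nonneg hx.le _)
    _ = (m.deg 0).factorial * (nodeWeight M *
          ∏ j, ∑ y ∈ t j, nodeWeight M ^ codeLength M y.2.card) := by
        rw [sum_product, prod_univ_sum]
        simp only [← mul_sum]
        rw [sum_const, nsmul_eq_mul, card_univ, Fintype.card_perm, Fintype.card_fin,
          mul_left_comm]
    _ ≤ M.factorial * (nodeWeight M * 1) := by
        refine mul_le_mul (by exact_mod_cast Nat.factorial_le (hM 0))
          (mul_le_mul_of_nonneg_left (prod_le_one (fun j _ => sum_nonneg fun _ _ =>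
            pow_nonneg hx.le _) fun j _ => ht1 j) hx.le)
          (mul_nonneg hx.le (prod_nonneg fun j _ => sum_nonneg fun _ _ => pow_nonneg hx.le _))
          (Nat.cast_nonneg _)
    _ = M.factorial * nodeWeight M := by rw [mul_one]

/-- Kraft's inequality for portraits. -/
theorem sum_nodeWeight_pow_le_one (M r : ℕ) (m : DegreeSeq) (hM : ∀ i, m.deg i ≤ M)
    (s : Finset ((m.Ray → m.Ray) × Finset m.Ray))
    (hs : ∀ z ∈ s, ∃ w : List m.Letter, portrait w = z ∧ (hits w).card ≤ r) :
    ∑ z ∈ s, nodeWeight M ^ codeLength M z.2.card ≤ 1 := by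
  classical
  have hx := nodeWeight_pos M
  -- The weight of a node is chosen for this identity: leaves and root permutations of branching
  -- nodes share the total weight one. It depends on `M` only, hence serves all shifted degree
  -- sequences in the induction.
  have h1 : (leafCount M : ℝ) * nodeWeight M + M.factorial * nodeWeight M = 1 := by
    have : (0 : ℝ) < M.factorial := by exact_mod_cast Nat.factorial_pos M
    rw [← add_mul, nodeWeight]
    exact mul_one_div_cancel (by positivity)
  have h2 : (0 : ℝ) ≤ M.factorial * nodeWeight M := by positivity
  induction r generalizing m with
  | zero =>
    have := sum_leaf_le hM s fun z hz => by
      obtain ⟨w, h, hw⟩ := hs z hz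
      exact ⟨w, h, by omega⟩
    linarith
  | succ r ih =>
    rw [← sum_filter_add_sum_filter_not s fun z => z.2.card ≤ 1]
    have h3 := sum_leaf_le hM (s.filter fun z => z.2.card ≤ 1) fun z hz => by
      rw [mem_filter] at hz
      obtain ⟨w, rfl, hw⟩ := hs z hz.1
      exact ⟨w, rfl, hz.2⟩
    have h4 := sum_node_le hM (ih m.shift fun i => hM (i + 1))
      (s.filter fun z => ¬ z.2.card ≤ 1) fun z hz => by
        rw [mem_filter] at hz
        obtain ⟨w, rfl, hw⟩ := hs z hz.1
        exact ⟨w, rfl, hw, not_le.1 hz.2⟩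
    linarith

/-! ### Portraits of elements of the mother group -/

/-- Insert the trivial letter `ρ ^ 0` before each generator and at the end. Every time is then a
time of a power of `ρ`, so that `hits` sees the whole inverted orbit. -/
theorem exists_letters {w : List m.motherGroup} (hw : ∀ g ∈ w, g ∈ m.motherGens) :
    ∃ v : List m.Letter, wordPerm v = (w.prod : Equiv.Perm m.Ray) ∧
      ∀ x, x ∈ hits v ↔ ∃ s ∈ visited m.rootSite w, s.1 = x := by
  classical
  induction w with
  | nil =>
    refine ⟨[Sum.inr 0], rfl, fun x => ?_⟩
    rw [hits, hits, image_empty, visited]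
    simp only [insert_empty_eq, mem_singleton, exists_eq_left]
    exact eq_comm
  | cons g w ih =>
    obtain ⟨v, hv, hv'⟩ := ih fun h hh => hw h (List.mem_cons_of_mem _ hh)
    obtain ⟨l, hl⟩ : ∃ l : m.Letter, letterPerm l = (g : Equiv.Perm m.Ray) := by
      rcases hw g List.mem_cons_self with ⟨σ, rfl⟩ | ⟨a, rfl⟩
      · exact ⟨Sum.inl σ, rfl⟩
      · exact ⟨Sum.inr a, rfl⟩
    have hins : insert m.zeroRay (hits (l :: v))
        = insert m.zeroRay ((hits v).image (letterPerm l)) := by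
      cases l with
      | inl σ => rfl
      | inr a =>
        rw [hits, insert_idem]
        rfl
    refine ⟨Sum.inr 0 :: l :: v, ?_, fun x => ?_⟩
    · rw [wordPerm, wordPerm, hv, hl, letterPerm, pow_zero, one_mul]
      rfl
    · rw [hits, pow_zero, Equiv.Perm.coe_one, image_id, hins, mem_insert, mem_image, hl]
      simp only [hv', mem_visited_cons]
      constructor
      · rintro (rfl | ⟨_, ⟨s, hs, rfl⟩, rfl⟩)
        · exact ⟨m.rootSite, Or.inl rfl, rfl⟩
        · exact ⟨g • s, Or.inr (by rwa [inv_smul_smul]), rfl⟩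
      · rintro ⟨s, rfl | hs, rfl⟩
        · exact Or.inl rfl
        · refine Or.inr ⟨_, ⟨_, hs, rfl⟩, ?_⟩
          exact congrArg Subtype.val (smul_inv_smul g s)

theorem deg_le_maxDeg (i : ℕ) : m.deg i ≤ m.maxDeg := le_csSup m.bounded ⟨i, rfl⟩

/-- The weight of a site in the portrait of an element of the mother group. -/
def siteWeight (M : ℕ) : ℝ := nodeWeight M ^ (M + 2)

theorem siteWeight_pos (M : ℕ) : 0 < siteWeight M := pow_pos (nodeWeight_pos M) _

theorem siteWeight_le_one (M : ℕ) : siteWeight M ≤ 1 :=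
  pow_le_one₀ (nodeWeight_pos M).le (nodeWeight_le_one M)

/-- Kraft's inequality for pairs of a product and an inverted orbit in the mother group. -/
theorem sum_siteWeight_pow_le_one (s : Finset (m.motherGroup × Finset m.Site))
    (hs : ∀ z ∈ s, ∃ w : List m.motherGroup, (∀ g ∈ w, g ∈ m.motherGens) ∧
      z = (w.prod, visited m.rootSite w)) :
    ∑ z ∈ s, siteWeight m.maxDeg ^ z.2.card ≤ 1 := by
  classical
  set F : m.motherGroup × Finset m.Site → (m.Ray → m.Ray) × Finset m.Ray :=
    fun z => (⇑(z.1 : Equiv.Perm m.Ray), z.2.image Subtype.val) with hF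
  have hinj : Function.Injective F := by
    rintro ⟨g, O⟩ ⟨g', O'⟩ h
    simp only [hF, Prod.mk.injEq] at h
    obtain ⟨h1, h2⟩ := h
    rw [Subtype.ext (DFunLike.coe_injective h1), image_injective Subtype.val_injective h2]
  have hcard : ∀ z, (F z).2.card = z.2.card := fun z =>
    card_image_of_injective _ Subtype.val_injective
  -- The supremum merely supplies some bound on the number of sites, to start the induction there.
  -- The weight per site comes from `codeLength ≤ (M + 2) k`, valid because an inverted orbit is
  -- never empty.
  refine le_trans ?_ (sum_nodeWeight_pow_le_one m.maxDeg
    ((s.image F).sup fun z => z.2.card) m deg_le_maxDeg (s.image F) ?_)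
  · rw [sum_image hinj.injOn]
    refine sum_le_sum fun z hz => ?_
    rw [hcard, siteWeight, ← pow_mul]
    obtain ⟨w, -, rfl⟩ := hs z hz
    exact pow_le_pow_of_le_one (nodeWeight_pos _).le (nodeWeight_le_one _)
      (codeLength_le (card_pos.2 ⟨_, self_mem_visited w⟩).ne')
  · intro y hy
    obtain ⟨z, hz, rfl⟩ := mem_image.1 hy
    obtain ⟨w, hw, rfl⟩ := hs z hz
    obtain ⟨v, hv, hv'⟩ := exists_letters hw
    have hv' : hits v = (visited m.rootSite w).image Subtype.val := by
      ext x
      rw [hv', mem_image]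
    refine ⟨v, by rw [portrait, hv, hv'], ?_⟩
    rw [hv']
    exact le_sup (f := fun z : (m.Ray → m.Ray) × Finset m.Ray => z.2.card) hy

end DegreeSeq

end SwitchWalk
end

noncomputable section

namespace SwitchWalk

open Finset

/-! ### Speed and entropy -/

section Pinsker

variable {α : Type*}

/-- Pinsker's inequality, with a constant that is not optimal. -/
theorem pexp_sub_pexp_le {p q : PMF α} (hq : q.support.Finite) (hpq : p.support ⊆ q.support)
    {f : α → ℝ} (hf : ∀ a, |f a| ≤ 1) :
    pexp p f - pexp q f
      ≤ 2 * √(pexp p fun a => Real.log (p a).toReal - Real.log (q a).toReal) := by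
  set s := hq.toFinset
  have hs : q.support ⊆ s := by simp [s]
  set x : α → ℝ := fun a => √(p a).toReal with hx
  set y : α → ℝ := fun a => √(q a).toReal with hy
  have hxp : ∀ a, x a ^ 2 = (p a).toReal := fun a => Real.sq_sqrt ENNReal.toReal_nonneg
  have hyq : ∀ a, y a ^ 2 = (q a).toReal := fun a => Real.sq_sqrt ENNReal.toReal_nonneg
  have hx0 : ∀ a, 0 ≤ x a := fun a => Real.sqrt_nonneg _
  have hy0 : ∀ a, 0 ≤ y a := fun a => Real.sqrt_nonneg _
  have hp1 : ∑ a ∈ s, x a ^ 2 = 1 := by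
    simp only [hxp]; exact sum_toReal_eq_one s (hpq.trans hs)
  have hq1 : ∑ a ∈ s, y a ^ 2 = 1 := by
    simp only [hyq]; exact sum_toReal_eq_one s hs
  -- Factor `p - q = (√p - √q)(√p + √q)`; by Cauchy–Schwarz it then suffices to bound the squared
  -- Hellinger distance.
  have h1 : pexp p f - pexp q f ≤ ∑ a ∈ s, |x a - y a| * (x a + y a) := by
    rw [pexp_eq_sum s (hpq.trans hs), pexp_eq_sum s hs, ← sum_sub_distrib]
    refine sum_le_sum fun a _ => ?_
    calc (p a).toReal * f a - (q a).toReal * f a = ((x a - y a) * (x a + y a)) * f a := by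
          rw [← hxp, ← hyq]; ring
      _ ≤ |((x a - y a) * (x a + y a)) * f a| := le_abs_self _
      _ = |x a - y a| * (x a + y a) * |f a| := by
          rw [abs_mul, abs_mul, abs_of_nonneg (add_nonneg (hx0 a) (hy0 a))]
      _ ≤ |x a - y a| * (x a + y a) :=
          mul_le_of_le_one_right (mul_nonneg (abs_nonneg _) (add_nonneg (hx0 a) (hy0 a))) (hf a)
  have h2 : (∑ a ∈ s, |x a - y a| * (x a + y a)) ^ 2
      ≤ (∑ a ∈ s, (x a - y a) ^ 2) * 4 := by
    refine (sum_mul_sq_le_sq_mul_sq s _ _).trans ?_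
    simp only [sq_abs]
    refine mul_le_mul_of_nonneg_left ?_ (sum_nonneg fun a _ => sq_nonneg _)
    calc ∑ a ∈ s, (x a + y a) ^ 2 ≤ ∑ a ∈ s, (2 * x a ^ 2 + 2 * y a ^ 2) :=
          sum_le_sum fun a _ => by nlinarith [sq_nonneg (x a - y a)]
      _ = 4 := by rw [sum_add_distrib, ← mul_sum, ← mul_sum, hp1, hq1]; norm_num
  -- The squared Hellinger distance is at most the relative entropy, by `log t ≤ t - 1` at `t =
  -- √(q/p)`.
  have h3 : ∑ a ∈ s, (x a - y a) ^ 2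
      ≤ pexp p fun a => Real.log (p a).toReal - Real.log (q a).toReal := by
    have e : ∑ a ∈ s, (x a - y a) ^ 2 = ∑ a ∈ s, (2 * x a ^ 2 - 2 * (x a * y a)) := by
      rw [sum_sub_distrib, ← mul_sum, hp1]
      have : ∑ a ∈ s, (x a - y a) ^ 2
          = ∑ a ∈ s, x a ^ 2 - ∑ a ∈ s, 2 * (x a * y a) + ∑ a ∈ s, y a ^ 2 := by
        rw [← sum_sub_distrib, ← sum_add_distrib]
        exact sum_congr rfl fun a _ => by ring
      rw [this, hp1, hq1]
      ring
    rw [e, pexp_eq_sum s (hpq.trans hs)]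
    refine sum_le_sum fun a _ => ?_
    by_cases ha : a ∈ p.support
    · have hpa := toReal_pos_of_mem ha
      have hqa := toReal_pos_of_mem (hpq ha)
      have hxa : 0 < x a := Real.sqrt_pos.2 hpa
      have hya : 0 < y a := Real.sqrt_pos.2 hqa
      have hl := Real.log_le_sub_one_of_pos (div_pos hya hxa)
      rw [Real.log_div hya.ne' hxa.ne'] at hl
      rw [← hxp, ← hyq, Real.log_pow, Real.log_pow]
      have : x a ^ 2 * (y a / x a - 1) = x a * y a - x a ^ 2 := by field_simp
      have h4 := mul_le_mul_of_nonneg_left hl (sq_nonneg (x a))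
      push_cast
      nlinarith
    · have hp0 : (p a).toReal = 0 := by
        by_contra h
        exact ha ((toReal_ne_zero_iff p a).1 h)
      have : x a = 0 := by rw [hx]; simp [hp0]
      simp [this, hp0]
  have h4 : ∑ a ∈ s, |x a - y a| * (x a + y a)
      ≤ √((pexp p fun a => Real.log (p a).toReal - Real.log (q a).toReal) * 4) :=
    Real.le_sqrt_of_sq_le (h2.trans (mul_le_mul_of_nonneg_right h3 (by norm_num)))
  refine (h1.trans h4).trans_eq ?_
  rw [mul_comm, Real.sqrt_mul (by norm_num), show (4 : ℝ) = 2 ^ 2 by norm_num,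
    Real.sqrt_sq (by norm_num)]

theorem pexp_sqrt_le {p : PMF α} (hp : p.support.Finite) {f : α → ℝ} (hf : ∀ a, 0 ≤ f a) :
    pexp p (fun a => √(f a)) ≤ √(pexp p f) := by
  refine Real.le_sqrt_of_sq_le ((sq_pexp_le hp _).trans (le_of_eq ?_))
  simp only [Real.sq_sqrt (hf _)]

variable {G : Type*} [Group G] {ν : PMF G}

/-- Let `K s` be the law at time `n + 1` given the first letter `s`, and `P` the unconditional law;
their relative entropies average to the entropy increment. The test function `φ x - φ (s⁻¹ x)`,
bounded by `1`, averages to the preceding increment of the mean of `φ` under `K s`, and by symmetry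
to minus the following one under `P`. Pinsker's inequality compares the two. -/
theorem pexp_add_two_sub_le (hν : ν.support.Finite)
    (hsymm : ∀ F : G → ℝ, pexp ν (fun s => F s⁻¹) = pexp ν F) {φ : G → ℝ}
    (hφ : ∀ s ∈ ν.support, ∀ x, |φ (s * x) - φ x| ≤ 1) (n : ℕ) :
    pexp (walkLaw ν (n + 2)) φ - pexp (walkLaw ν n) φ
      ≤ 2 * √(walkEntropy ν (n + 1) - walkEntropy ν n) := by
  have hn := finite_support_walkLaw hν n
  have hn1 := finite_support_walkLaw hν (n + 1)
  set K : G → PMF G := fun s => (walkLaw ν n).map fun g => s * g with hK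
  have hKf : ∀ s, (K s).support.Finite := fun s => finite_support_map _ hn
  set P := walkLaw ν (n + 1) with hP
  have hPK : P = ν.bind K := walkLaw_succ ν n
  have hsub : ∀ s ∈ ν.support, (K s).support ⊆ P.support := by
    intro s hs x hx
    rw [hPK, PMF.mem_support_bind_iff]
    exact ⟨s, hs, hx⟩
  set D : G → ℝ := fun s => pexp (K s) fun a =>
    Real.log (K s a).toReal - Real.log (P a).toReal with hD
  have hDsum : pexp ν D = walkEntropy ν (n + 1) - walkEntropy ν n := by
    simp only [hD, pexp_sub (hKf _)]
    rw [pexp_sub hν, ← pexp_bind hν fun s _ => hKf s, ← hPK]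
    have h1 : ∀ s, pexp (K s) (fun a => Real.log (K s a).toReal) = -walkEntropy ν n := by
      intro s
      rw [walkEntropy_eq, ← ent_map_mul_left hn s, ent_eq_pexp]
      have := pexp_mul_left (K s) (-1) fun a => Real.log (K s a).toReal
      simp only [neg_one_mul] at this
      rw [this, neg_neg]
    have h2 : pexp P (fun a => Real.log (P a).toReal) = -walkEntropy ν (n + 1) := by
      rw [walkEntropy_eq, ← hP, ent_eq_pexp]
      have := pexp_mul_left P (-1) fun a => Real.log (P a).toReal
      simp only [neg_one_mul] at this
      rw [this, neg_neg]
    simp only [h1, h2, pexp_const hν]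
    ring
  set f : G → G → ℝ := fun s x => φ x - φ (s⁻¹ * x) with hf
  have h1 : pexp ν (fun s => pexp (K s) (f s)) = pexp P φ - pexp (walkLaw ν n) φ := by
    simp only [hf, pexp_sub (hKf _)]
    rw [pexp_sub hν, ← pexp_bind hν fun s _ => hKf s, ← hPK]
    congr 1
    simp only [hK, pexp_map _ hn, inv_mul_cancel_left, pexp_const hν]
  have h2 : pexp ν (fun s => pexp P (f s)) = pexp P φ - pexp (walkLaw ν (n + 2)) φ := by
    simp only [hf, pexp_sub hn1]
    rw [pexp_sub hν, pexp_const hν]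
    congr 1
    rw [hsymm fun s => pexp P fun x => φ (s * x)]
    exact (pexp_walkLaw_succ hν (n + 1) φ).symm
  have h3 : pexp ν (fun s => pexp (K s) (f s) - pexp P (f s)) ≤ pexp ν fun s => 2 * √(D s) := by
    refine pexp_mono hν fun s hs => ?_
    refine pexp_sub_pexp_le hn1 (hsub s hs) fun x => ?_
    have := hφ s hs (s⁻¹ * x)
    rwa [mul_inv_cancel_left] at this
  rw [pexp_sub hν, h1, h2, pexp_mul_left] at h3
  -- The divergence is known to be nonnegative only for `s` in the support of `ν`; the truncation
  -- takes care of the other `s`.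
  have h4 : pexp ν (fun s => √(D s)) ≤ √(pexp ν fun s => max (D s) 0) := by
    refine le_trans (pexp_mono hν fun s _ => ?_) (pexp_sqrt_le hν fun s => le_max_right _ _)
    exact Real.sqrt_le_sqrt (le_max_left _ _)
  have h5 : pexp ν (fun s => max (D s) 0) = pexp ν D := by
    refine pexp_congr fun s hs => max_eq_left ?_
    have : pexp (K s) (fun a => -Real.log (K s a).toReal)
        ≤ pexp (K s) fun a => -Real.log (P a).toReal := by
      rw [← ent_eq_pexp]
      refine ent_le_of_weight (hKf s) _ (fun a ha => toReal_pos_of_mem (hsub s hs ha)) ?_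
      refine (sum_le_sum_of_subset_of_nonneg (t := hn1.toFinset) ?_ fun _ _ _ =>
        ENNReal.toReal_nonneg).trans (sum_toReal_eq_one _ (by simp [hP])).le
      intro a ha
      simp only [Set.Finite.mem_toFinset] at ha ⊢
      exact hsub s hs ha
    rw [← sub_nonneg, ← pexp_sub (hKf s)] at this
    refine this.trans_eq ?_
    simp only [hD]
    congr 1
    funext a
    ring
  rw [h5, hDsum] at h4
  linarith

/-- The speed of a symmetric random walk is bounded by the square root of its entropy. -/
theorem pexp_walkLaw_le_sqrt (hν : ν.support.Finite)
    (hsymm : ∀ F : G → ℝ, pexp ν (fun s => F s⁻¹) = pexp ν F) {φ : G → ℝ}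
    (hφ : ∀ s ∈ ν.support, ∀ x, |φ (s * x) - φ x| ≤ 1) (hφ1 : φ 1 = 0) (hφ0 : ∀ x, 0 ≤ φ x)
    (n : ℕ) : pexp (walkLaw ν n) φ ≤ 1 + 2 * √(n * walkEntropy ν n) := by
  have h0 : pexp (walkLaw ν 0) φ = 0 := by rw [walkLaw_zero, pexp_pure, hφ1]
  have h1 : pexp (walkLaw ν 1) φ ≤ 1 := by
    rw [walkLaw_one]
    refine (pexp_mono hν (g := fun _ => 1) fun s hs => ?_).trans_eq (pexp_const hν 1)
    have := (le_abs_self _).trans (hφ s hs 1)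
    rwa [mul_one, hφ1, sub_zero] at this
  have h2 : ∀ n, pexp (walkLaw ν (n + 1)) φ + pexp (walkLaw ν n) φ
      ≤ 1 + 2 * ∑ i ∈ range n, √(walkEntropy ν (i + 1) - walkEntropy ν i) := by
    intro n
    induction n with
    | zero => simp only [range_zero, sum_empty, zero_add]; linarith
    | succ n ih =>
      rw [sum_range_succ]
      have := pexp_add_two_sub_le hν hsymm hφ n
      have e : n + 1 + 1 = n + 2 := rfl
      rw [e]
      linarith
  -- Cauchy–Schwarz, after which the entropy increments telescope.
  have h3 : (∑ i ∈ range n, √(walkEntropy ν (i + 1) - walkEntropy ν i)) ^ 2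
      ≤ n * walkEntropy ν n := by
    refine (sq_sum_le_card_mul_sum_sq).trans_eq ?_
    rw [card_range]
    congr 1
    rw [sum_congr rfl fun i _ =>
      Real.sq_sqrt (sub_nonneg.2 (walkEntropy_mono hν (Nat.le_succ i))), sum_range_sub,
      walkEntropy_zero, sub_zero]
  have h4 := Real.le_sqrt_of_sq_le h3
  have h5 := h2 n
  have h6 : 0 ≤ pexp (walkLaw ν (n + 1)) φ := pexp_nonneg hφ0
  linarith

end Pinsker

/-! ### Entropy of the path data, and symmetry of the step law -/

section UpperBounds

variable {Λ Γ S : Type*} [Group Λ] [Group Γ] [MulAction Γ S] {o : S} {μ : PMF Λ} {γ : PMF Γ}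
  {B : Set Γ} {θ : ℝ}

/-- Kraft's inequality for the products and inverted orbits of the words over `B`, with weight `θ`
for each site. -/
def KraftBound (o : S) (B : Set Γ) (θ : ℝ) : Prop :=
  ∀ s : Finset (Γ × Finset S), (∀ z ∈ s, ∃ w : List Γ, (∀ g ∈ w, g ∈ B) ∧
    z = (w.prod, visited o w)) → ∑ z ∈ s, θ ^ z.2.card ≤ 1

/-- The numbers of switches, as a finitely supported function. -/
def switchCount (o : S) (w : List Γ) : S →₀ ℕ :=
  Finsupp.onFinset (visited o w) (switches o w) fun _ h => mem_visited_of_switches_ne_zero h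

/-- The product and the orbit are weighted by Kraft's inequality. Given the orbit, the numbers of
switches form one of at most `(2n + 1) ^ |orbit|` functions; this is the source of the logarithm. -/
theorem ent_pathData_le (hγ : γ.support.Finite) (hB : γ.support ⊆ B) (hθ : 0 < θ)
    (hK : KraftBound o B θ) (n : ℕ) :
    ent ((iid γ n).map fun w => ((w.prod, visited o w), switchCount o w))
      ≤ (-Real.log θ + Real.log (2 * n + 1)) * ∑ i ∈ range (n + 1), returnTail o γ i := by
  classical
  have hf := finite_support_iid hγ n
  have hf' := finite_support_map (fun w => ((w.prod, visited o w), switchCount o w)) hf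
  refine (ent_le_of_weight_of_card hf' (fun c => θ ^ c.2.card)
    (fun c => c.2.finsupp fun _ => range (2 * n + 1)) (fun z _ => pow_pos hθ _) ?_ ?_).trans_eq ?_
  · intro z hz
    rw [PMF.mem_support_map_iff] at hz
    obtain ⟨w, hw, rfl⟩ := hz
    rw [mem_finsupp_iff]
    refine ⟨Finsupp.support_onFinset_subset
      (hf := fun _ h => mem_visited_of_switches_ne_zero h), fun s _ => ?_⟩
    rw [mem_range, switchCount, Finsupp.onFinset_apply]
    have := switches_le_length (o := o) w s
    rw [(mem_support_iid hw).1] at this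
    omega
  · intro s hs
    refine hK s fun z hz => ?_
    obtain ⟨d, hd⟩ := hs z hz
    rw [PMF.mem_support_map_iff] at hd
    obtain ⟨w, hw, h⟩ := hd
    exact ⟨w, fun g hg => hB ((mem_support_iid hw).2 g hg), (congrArg Prod.fst h).symm⟩
  · rw [pexp_map _ hf, ← pexp_card_visited hγ, ← pexp_mul_left]
    refine pexp_congr fun w _ => ?_
    rw [card_finsupp, prod_const, card_range, Real.log_pow]
    push_cast
    rw [Real.log_pow]
    ring

/-- The entropy of the switch-walk-switch walk is at most that of its path plus that of its
lamps. -/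
theorem walkEntropy_swsStep_le (hμ : μ.support.Finite) (hγ : γ.support.Finite)
    (hB : γ.support ⊆ B) (hθ : 0 < θ) (hK : KraftBound o B θ) (n : ℕ) :
    walkEntropy (swsStep o μ γ) n
      ≤ (-Real.log θ + Real.log (2 * n + 1)) * ∑ i ∈ range (n + 1), returnTail o γ i
        + pexp (iid γ n) fun w => ∑ s ∈ visited o w, walkEntropy μ (switches o w s) := by
  have hf := finite_support_iid hγ n
  set Z : List Γ → (Γ × Finset S) × (S →₀ ℕ) :=
    fun w => ((w.prod, visited o w), switchCount o w) with hZ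
  -- The law of the lamps depends on the word only through `Z w`, so it is enough to pay for the
  -- entropy of `Z w` rather than of the whole word.
  obtain ⟨k, hk⟩ : ∃ k, pathLaw o μ = k ∘ Z := by
    refine (Function.factorsThrough_iff _).1 fun w w' h => ?_
    simp only [hZ, Prod.mk.injEq] at h
    refine pathLaw_congr h.1.1 fun s => ?_
    have := DFunLike.congr_fun h.2 s
    simp only [switchCount, Finsupp.onFinset_apply] at this
    rw [this]
  have hbind : walkLaw (swsStep o μ γ) n = ((iid γ n).map Z).bind k := by
    rw [walkLaw_swsStep, hk, PMF.bind_map]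
  have hkf : ∀ z ∈ ((iid γ n).map Z).support, (k z).support.Finite := by
    intro z hz
    rw [PMF.mem_support_map_iff] at hz
    obtain ⟨w, -, rfl⟩ := hz
    have := congrFun hk w
    rw [Function.comp_apply] at this
    rw [← this]
    exact finite_support_pathLaw hμ w
  rw [walkEntropy_eq, hbind]
  refine (ent_bind_le (finite_support_map _ hf) hkf).trans
    (add_le_add (ent_pathData_le hγ hB hθ hK n) (le_of_eq ?_))
  rw [pexp_map _ hf]
  refine pexp_congr fun w _ => ?_
  have := congrFun hk w
  rw [Function.comp_apply] at this
  rw [← this, ent_pathLaw hμ]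

theorem pexp_inv_of_symm {G : Type*} [Group G] {ν : PMF G} (h : ∀ a, ν a⁻¹ = ν a) (F : G → ℝ) :
    pexp ν (fun s => F s⁻¹) = pexp ν F := by
  unfold pexp
  rw [← (Equiv.inv G).tsum_eq]
  simp [h]

theorem finite_support_swsStep (hμ : μ.support.Finite) (hγ : γ.support.Finite) :
    (swsStep o μ γ).support.Finite :=
  finite_support_bind hμ fun _ _ => finite_support_bind hγ fun _ _ =>
    finite_support_bind hμ fun _ _ => finite_support_pure _

theorem pexp_swsStep (hμ : μ.support.Finite) (hγ : γ.support.Finite)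
    (F : PermWreath Λ Γ S → ℝ) :
    pexp (swsStep o μ γ) F = pexp μ fun a => pexp γ fun g => pexp μ fun b =>
      F (switch Γ o a * SemidirectProduct.inr g * switch Γ o b) := by
  have h1 : ∀ a g, (μ.bind fun b => PMF.pure
      (switch Γ o a * SemidirectProduct.inr g * switch Γ o b)).support.Finite := fun a g =>
    finite_support_bind hμ fun _ _ => finite_support_pure _
  rw [swsStep, pexp_bind hμ fun a _ => finite_support_bind hγ fun g _ => h1 a g]
  refine pexp_congr fun a _ => ?_
  rw [pexp_bind hγ fun g _ => h1 a g]
  refine pexp_congr fun g _ => ?_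
  rw [pexp_bind hμ fun _ _ => finite_support_pure _]
  simp only [pexp_pure]

/-- Inversion exchanges the two independent, identically distributed symmetric switches and inverts
the symmetric step between them. -/
theorem pexp_swsStep_inv (hμ : μ.support.Finite) (hγ : γ.support.Finite)
    (hμs : ∀ a, μ a⁻¹ = μ a) (hγs : ∀ g, γ g⁻¹ = γ g) (F : PermWreath Λ Γ S → ℝ) :
    pexp (swsStep o μ γ) (fun x => F x⁻¹) = pexp (swsStep o μ γ) F := by
  rw [pexp_swsStep hμ hγ, pexp_swsStep hμ hγ]
  simp only [step_inv]
  have h1 : ∀ a : Λ, pexp γ (fun g => pexp μ fun b =>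
      F (switch Γ o b⁻¹ * SemidirectProduct.inr g⁻¹ * switch Γ o a⁻¹))
      = pexp γ fun g => pexp μ fun b =>
      F (switch Γ o b * SemidirectProduct.inr g * switch Γ o a⁻¹) := by
    intro a
    rw [pexp_inv_of_symm hγs fun g => pexp μ fun b =>
      F (switch Γ o b⁻¹ * SemidirectProduct.inr g * switch Γ o a⁻¹)]
    refine pexp_congr fun g _ => ?_
    exact pexp_inv_of_symm hμs fun b =>
      F (switch Γ o b * SemidirectProduct.inr g * switch Γ o a⁻¹)
  simp only [h1]
  rw [pexp_inv_of_symm hμs fun a => pexp γ fun g => pexp μ fun b =>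
      F (switch Γ o b * SemidirectProduct.inr g * switch Γ o a), pexp_comm hμ hγ]
  simp only [pexp_comm hμ hμ (fun a b => F (switch Γ o b * SemidirectProduct.inr _ * switch Γ o a))]
  exact pexp_comm hγ hμ _

theorem mem_support_swsStep {x : PermWreath Λ Γ S} (hx : x ∈ (swsStep o μ γ).support) :
    ∃ a b, ∃ g ∈ γ.support, x = switch Γ o a * SemidirectProduct.inr g * switch Γ o b := by
  simp only [swsStep, PMF.mem_support_bind_iff, PMF.mem_support_pure_iff] at hx
  obtain ⟨a, -, g, hg, b, -, h⟩ := hx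
  exact ⟨a, b, g, hg, h⟩

end UpperBounds

/-! ### Covering the inverted orbit -/

section Cover

variable {Γ S : Type*} [Group Γ] [MulAction Γ S] {o : S} {γ : PMF Γ} {B : Set Γ} {θ : ℝ}

open Classical in
/-- The lamp configuration with value `-1` on a finite set. -/
def signs (t : Finset S) : Lamps ℤˣ S :=
  ⟨fun s => if s ∈ t then -1 else 1, t.finite_toSet.subset fun s hs => by
    by_contra h
    exact hs (if_neg h)⟩

/-- The fair coin. -/
def coin : PMF ℤˣ := PMF.uniformOfFintype ℤˣ

theorem finite_support_coin : coin.support.Finite := Set.toFinite _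

theorem coin_apply (a b : ℤˣ) : coin a = coin b := by simp [coin]

/-- With two-valued lamps the configuration is a subset of the orbit, one of `2 ^ |orbit|`. The
numbers of switches need not be recorded, so no `log n` arises. -/
theorem ent_coinWalk_le (hγ : γ.support.Finite) (hB : γ.support ⊆ B) (hθ : 0 < θ)
    (hK : KraftBound o B θ) (n : ℕ) :
    walkEntropy (swsStep o coin γ) n
      ≤ (-Real.log θ + Real.log 2) * ∑ i ∈ range (n + 1), returnTail o γ i := by
  classical
  have hf := finite_support_iid hγ n
  have hpf := fun w : List Γ => finite_support_pathLaw (o := o) finite_support_coin w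
  set p : PMF ((Γ × Finset S) × PermWreath ℤˣ Γ S) :=
    (iid γ n).bind fun w => (pathLaw o coin w).map fun x => ((w.prod, visited o w), x) with hp
  have hpfin : p.support.Finite := finite_support_bind hf fun w _ => finite_support_map _ (hpf w)
  have hmap : walkLaw (swsStep o coin γ) n = p.map Prod.snd := by
    rw [walkLaw_swsStep, hp, PMF.map_bind]
    congr 1
    funext w
    rw [PMF.map_comp]
    exact (PMF.map_id _).symm
  have hmem : ∀ z ∈ p.support, ∃ w ∈ (iid γ n).support, z.1 = (w.prod, visited o w) ∧
      z.2 ∈ (pathLaw o coin w).support := by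
    intro z hz
    rw [hp, PMF.mem_support_bind_iff] at hz
    obtain ⟨w, hw, hz⟩ := hz
    rw [PMF.mem_support_map_iff] at hz
    obtain ⟨x, hx, rfl⟩ := hz
    exact ⟨w, hw, rfl, hx⟩
  set F : Γ × Finset S → Finset (PermWreath ℤˣ Γ S) := fun c =>
    c.2.powerset.image fun t => ⟨signs t, c.1⟩ with hF
  rw [walkEntropy_eq, hmap]
  refine (ent_map_le hpfin _).trans ((ent_le_of_weight_of_card hpfin (fun c => θ ^ c.2.card)
    F (fun z _ => pow_pos hθ _) ?_ ?_).trans ?_)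
  · intro z hz
    obtain ⟨w, hw, h1, h2⟩ := hmem z hz
    refine mem_image.2 ⟨lampSupport z.2, ?_, wreath_ext ?_ fun s => ?_⟩
    · rw [mem_powerset, h1]
      exact fun s hs => by_contra fun h => mem_lampSupport.1 hs (pathLaw_left_eq_one h2 h)
    · rw [h1]
      exact (pathLaw_support h2).1.symm
    · change (if s ∈ lampSupport z.2 then (-1 : ℤˣ) else 1) = z.2.left.1 s
      split_ifs with h
      · exact ((Int.units_eq_one_or _).resolve_left (mem_lampSupport.1 h)).symm
      · exact (by_contra fun h' => h (mem_lampSupport.2 (Ne.symm h')))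
  · intro s hs
    refine hK s fun z hz => ?_
    obtain ⟨d, hd⟩ := hs z hz
    obtain ⟨w, hw, h, -⟩ := hmem _ hd
    exact ⟨w, fun g hg => hB ((mem_support_iid hw).2 g hg), h⟩
  · rw [hp, pexp_bind hf fun w _ => finite_support_map _ (hpf w), ← pexp_card_visited hγ,
      ← pexp_mul_left]
    refine pexp_mono hf fun w _ => ?_
    rw [pexp_map _ (hpf w)]
    dsimp only
    rw [pexp_const (hpf w), Real.log_pow]
    have hcard : ((F (w.prod, visited o w)).card : ℝ) ≤ 2 ^ (visited o w).card := by
      have : (F (w.prod, visited o w)).card ≤ 2 ^ (visited o w).card :=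
        card_image_le.trans (card_powerset _).le
      exact_mod_cast this
    have hpos : (0 : ℝ) < (F (w.prod, visited o w)).card := by
      exact_mod_cast card_pos.2 ⟨_, mem_image_of_mem _ (empty_mem_powerset _)⟩
    have := Real.log_le_log hpos hcard
    rw [Real.log_pow] at this
    linarith

theorem walkLaw_coin_neg (n : ℕ) (y : ℤˣ) : walkLaw coin (n + 1) (-y) = walkLaw coin (n + 1) y := by
  rw [walkLaw_succ_apply, walkLaw_succ_apply, ← (Equiv.neg ℤˣ).tsum_eq]
  refine tsum_congr fun a => ?_
  rw [Equiv.neg_apply, coin_apply (-a) a]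
  congr 2
  rw [inv_neg, neg_mul_neg]

/-- Flipping all lamps of the inverted orbit preserves the law of the walk with coin lamps. -/
theorem pathLaw_coin_flip {w : List Γ} (hw : w ≠ []) (x : PermWreath ℤˣ Γ S) :
    pathLaw o coin w (SemidirectProduct.inl (signs (visited o w)) * x) = pathLaw o coin w x := by
  classical
  have hl : ∀ s, (SemidirectProduct.inl (signs (visited o w)) * x : PermWreath ℤˣ Γ S).left.1 s
      = if s ∈ visited o w then -x.left.1 s else x.left.1 s := by
    intro s
    rw [mul_left_apply, SemidirectProduct.right_inl, inv_one, one_smul]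
    change (if s ∈ visited o w then (-1 : ℤˣ) else 1) * _ = _
    split_ifs <;> simp
  have hr : (SemidirectProduct.inl (signs (visited o w)) * x : PermWreath ℤˣ Γ S).right
      = x.right := one_mul _
  have hT : ∀ s ∉ visited o w ∪ lampSupport x, switches o w s = 0 ∧ x.left.1 s = 1 ∧
      s ∉ visited o w := by
    intro s hs
    rw [mem_union, not_or] at hs
    exact ⟨by_contra fun h => hs.1 (mem_visited_of_switches_ne_zero h),
      by_contra fun h => hs.2 (mem_lampSupport.2 h), hs.1⟩
  rw [isLampLaw_pathLaw coin w _ (visited o w ∪ lampSupport x) fun s hs => by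
      rw [hl, if_neg (hT s hs).2.2]; exact ⟨(hT s hs).1, (hT s hs).2.1⟩,
    isLampLaw_pathLaw coin w x (visited o w ∪ lampSupport x) fun s hs =>
      ⟨(hT s hs).1, (hT s hs).2.1⟩, hr]
  refine if_congr Iff.rfl (prod_congr rfl fun s _ => ?_) rfl
  rw [hl]
  split_ifs with h
  -- As the word is nonempty, each visited site has been switched at least once, and a single toss
  -- makes its lamp symmetric.
  · obtain ⟨k, hk⟩ := Nat.exists_eq_succ_of_ne_zero ((switches_ne_zero_iff hw).2 h)
    rw [hk]
    exact walkLaw_coin_neg k _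
  · rfl

/-- At every visited site either the configuration or its flip is nontrivial, so their supports
together cover the orbit. Both have the same law, and `coverLength_le` gives the factor `2 + 1`. -/
theorem coverLength_le_pexp (hB : ∀ g ∈ B, g⁻¹ ∈ B) {w : List Γ} (hw : w ≠ [])
    (hwB : ∀ g ∈ w, g ∈ B) :
    (coverLength o B w : ℝ) ≤ 3 * pexp (pathLaw o coin w) fun x => (coverNorm o B x : ℝ) := by
  classical
  have hf := finite_support_pathLaw (o := o) finite_support_coin w
  set c : PermWreath ℤˣ Γ S := SemidirectProduct.inl (signs (visited o w)) with hc
  have hmap : (pathLaw o coin w).map (fun x => c * x) = pathLaw o coin w := by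
    ext x
    rw [map_mul_left_apply, ← pathLaw_coin_flip hw (c⁻¹ * x), ← hc, mul_inv_cancel_left]
  have h1 : pexp (pathLaw o coin w) (fun x => (coverNorm o B (c * x) : ℝ))
      = pexp (pathLaw o coin w) fun x => (coverNorm o B x : ℝ) := by
    conv_rhs => rw [← hmap, pexp_map _ hf]
  have h2 : pexp (pathLaw o coin w) (fun _ => (coverLength o B w : ℝ))
      ≤ pexp (pathLaw o coin w) fun x => 2 * (coverNorm o B x : ℝ) + coverNorm o B (c * x) := by
    refine pexp_mono hf fun x hx => ?_
    have hx' : c * x ∈ (pathLaw o coin w).support := by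
      rw [PMF.mem_support_iff, hc, pathLaw_coin_flip hw]
      exact hx
    have := coverLength_le hB (coverable_of_mem_support hwB hx)
      (coverable_of_mem_support hwB hx') (pathLaw_support hx').1 fun s hs => by
        rw [mem_lampSupport, mem_lampSupport]
        by_contra h
        push Not at h
        have hcs : (c * x).left.1 s = -1 * x.left.1 s := by
          rw [hc, mul_left_apply, SemidirectProduct.right_inl, inv_one, one_smul]
          change (if s ∈ visited o w then (-1 : ℤˣ) else 1) * _ = _
          rw [if_pos hs]
        rw [h.1, h.2, mul_one] at hcs
        exact absurd hcs (by decide)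
    exact_mod_cast this
  rw [pexp_const hf, pexp_add hf, pexp_mul_left, h1] at h2
  linarith

/-- The expected length of a word that covers the inverted orbit. -/
theorem pexp_coverLength_le (hγ : γ.support.Finite) (hγs : ∀ g, γ g⁻¹ = γ g)
    (hB : ∀ g ∈ B, g⁻¹ ∈ B) (hγB : γ.support ⊆ B) (hθ : 0 < θ) (hK : KraftBound o B θ)
    {n : ℕ} (hn : n ≠ 0) :
    pexp (iid γ n) (fun w => (coverLength o B w : ℝ)) ≤ 3 * (1 + 2 * √(n *
      ((-Real.log θ + Real.log 2) * ∑ i ∈ range (n + 1), returnTail o γ i))) := by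
  have hf := finite_support_iid hγ n
  calc pexp (iid γ n) (fun w => (coverLength o B w : ℝ))
      ≤ pexp (iid γ n) fun w => 3 * pexp (pathLaw o coin w) fun x => (coverNorm o B x : ℝ) := by
        refine pexp_mono hf fun w hw => coverLength_le_pexp hB ?_ fun g hg =>
          hγB ((mem_support_iid hw).2 g hg)
        rintro rfl
        exact hn (mem_support_iid hw).1.symm
    _ = 3 * pexp (walkLaw (swsStep o coin γ) n) fun x => (coverNorm o B x : ℝ) := by
        rw [pexp_mul_left, pexp_walkLaw_swsStep finite_support_coin hγ]
    _ ≤ 3 * (1 + 2 * √(n * walkEntropy (swsStep o coin γ) n)) := by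
        refine mul_le_mul_of_nonneg_left (pexp_walkLaw_le_sqrt
          (finite_support_swsStep finite_support_coin hγ)
          (pexp_swsStep_inv finite_support_coin hγ (fun a => coin_apply _ _) hγs) ?_ ?_
          (fun x => Nat.cast_nonneg _) n) (by norm_num)
        · intro s hs x
          obtain ⟨a, b, g, hg, rfl⟩ := mem_support_swsStep hs
          exact abs_coverNorm_step_sub_le hB (hγB hg) a b x
        · rw [coverNorm_one, Nat.cast_zero]
    _ ≤ _ := by
        gcongr
        exact ent_coinWalk_le hγ hγB hθ hK n

end Cover

end SwitchWalk
end

noncomputable section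

namespace SwitchWalk

open Finset
open scoped InnerProductSpace

/-! ### From a spectral gap to a contraction -/

section Contraction

variable {E : Type*} [NormedAddCommGroup E] [InnerProductSpace ℝ E] {P : E →L[ℝ] E} {δ : ℝ}

/-- A spectral gap of `1 - P` above `0`, in the form of an inequality on the range. -/
theorem gap_on_range (hP : ∀ x y, ⟪P x, y⟫_ℝ = ⟪x, P y⟫_ℝ) (hc : ∀ x, ‖P x‖ ≤ ‖x‖) (hδ : 0 < δ)
    (h : ∀ f, δ * ⟪f - P f, f⟫_ℝ ≤ ‖f - P f‖ ^ 2) (g : E) :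
    δ * ‖g - P g‖ ^ 2 ≤ ⟪(g - P g) - P (g - P g), g - P g⟫_ℝ := by
  have hpos : ∀ x, 0 ≤ ⟪x - P x, x⟫_ℝ := fun x => by
    rw [inner_sub_left, real_inner_self_eq_norm_sq]
    nlinarith [real_inner_le_norm (P x) x, hc x, norm_nonneg x]
  obtain ⟨b, hb⟩ : ∃ b, b = g - P g := ⟨_, rfl⟩
  rw [← hb]
  -- Expanding positivity of `1 - P` at `δ g - b`, with `b = g - P g`, gives `2δ‖b‖² ≤ δ²⟪b, g⟫ + ⟪b
  -- - P b, b⟫`; the hypothesis bounds `δ⟪b, g⟫` by `‖b‖²`.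
  have h1 := hpos (δ • g - b)
  have h2 : ⟪b - P b, g⟫_ℝ = ‖b‖ ^ 2 := by
    rw [← real_inner_self_eq_norm_sq]
    nth_rw 4 [hb]
    rw [inner_sub_left, inner_sub_right, hP]
  have h3 : δ • g - b - P (δ • g - b) = δ • b - (b - P b) := by
    rw [map_sub, map_smul, hb, smul_sub]
    abel
  rw [h3, inner_sub_left, inner_sub_right, inner_sub_right, real_inner_smul_left,
    real_inner_smul_left, real_inner_smul_right, real_inner_smul_right, h2,
    real_inner_self_eq_norm_sq] at h1
  have h4 := mul_le_mul_of_nonneg_left (h g) hδ.le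
  rw [← hb] at h4
  nlinarith

/-- A spectral gap gives a strict contraction of the lazy operator. -/
theorem exists_norm_add_le [CompleteSpace E] (hP : ∀ x y, ⟪P x, y⟫_ℝ = ⟪x, P y⟫_ℝ)
    (hc : ∀ x, ‖P x‖ ≤ ‖x‖) (hinj : ∀ x, P x = x → x = 0) (hδ : 0 < δ)
    (h : ∀ f, δ * ⟪f - P f, f⟫_ℝ ≤ ‖f - P f‖ ^ 2) :
    ∃ l : ℝ, 0 ≤ l ∧ l < 1 ∧ ∀ f, ‖(2⁻¹ : ℝ) • (f + P f)‖ ≤ l * ‖f‖ := by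
  have hgap : ∀ f, δ * ‖f‖ ^ 2 ≤ ⟪f - P f, f⟫_ℝ := by
    set B : E →L[ℝ] E := ContinuousLinearMap.id ℝ E - P with hB
    have hBs : LinearMap.IsSymmetric (B : E →ₗ[ℝ] E) := fun x y => by
      simp only [hB, ContinuousLinearMap.coe_coe, sub_apply,
        ContinuousLinearMap.id_apply, inner_sub_left, inner_sub_right, hP]
    -- The orthogonal complement of the range of the symmetric operator `1 - P` is its kernel, which
    -- is trivial. The gap therefore extends from the range to the whole space by continuity.
    have hd : Dense (Set.range B) := by
      have h1 : (LinearMap.range (B : E →ₗ[ℝ] E))ᗮ = ⊥ := by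
        rw [hBs.orthogonal_range, LinearMap.ker_eq_bot']
        intro x hx
        exact hinj x (sub_eq_zero.1 hx).symm
      have := (Submodule.topologicalClosure_eq_top_iff).2 h1
      rw [← Submodule.dense_iff_topologicalClosure_eq_top] at this
      exact this
    have hclosed : IsClosed {f : E | δ * ‖f‖ ^ 2 ≤ ⟪f - P f, f⟫_ℝ} :=
      isClosed_le (by fun_prop) (by fun_prop)
    intro f
    have : closure (Set.range B) ⊆ {f : E | δ * ‖f‖ ^ 2 ≤ ⟪f - P f, f⟫_ℝ} := by
      refine hclosed.closure_subset_iff.2 ?_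
      rintro _ ⟨g, rfl⟩
      exact gap_on_range hP hc hδ h g
    exact this (hd f)
  refine ⟨√(max (1 - δ / 2) 0), Real.sqrt_nonneg _, ?_, fun f => ?_⟩
  · rw [Real.sqrt_lt' one_pos, one_pow]
    exact max_lt (by linarith) one_pos
  -- The gap only keeps the spectrum of `P` away from `1`; averaging with the identity also takes
  -- care of `-1`.
  · have h1 : ‖(2⁻¹ : ℝ) • (f + P f)‖ ^ 2 ≤ (1 - δ / 2) * ‖f‖ ^ 2 := by
      rw [norm_smul, mul_pow, norm_add_sq_real]
      have h2 := hgap f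
      rw [inner_sub_left, real_inner_self_eq_norm_sq, real_inner_comm] at h2
      have h3 : ‖P f‖ ^ 2 ≤ ‖f‖ ^ 2 := pow_le_pow_left₀ (norm_nonneg _) (hc f) 2
      norm_num
      linarith
    rw [← Real.sqrt_sq (norm_nonneg f), ← Real.sqrt_mul (le_max_right _ _)]
    refine Real.le_sqrt_of_sq_le (h1.trans ?_)
    exact mul_le_mul_of_nonneg_right (le_max_left _ _) (sq_nonneg _)

end Contraction

/-! ### Growth of almost harmonic cocycles -/

section Cocycle

variable {Λ : Type*} [Group Λ] {E : Type*} [NormedAddCommGroup E] [InnerProductSpace ℝ E]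
  {μ : PMF Λ} {π : Λ →* (E ≃ₗᵢ[ℝ] E)} {v : E}

theorem norm_sq_cocycle_mul (g a : Λ) :
    ‖π (g * a) v - v‖ ^ 2 = ‖π g v - v‖ ^ 2 + 2 * ⟪π g v - v, π g (π a v - v)⟫_ℝ
      + ‖π a v - v‖ ^ 2 := by
  have : π (g * a) v - v = (π g v - v) + π g (π a v - v) := by
    rw [map_mul, LinearIsometryEquiv.coe_mul, Function.comp_apply, map_sub]
    abel
  rw [this, norm_add_sq_real, LinearIsometryEquiv.norm_map]

/-- The first two moments of the squared displacement of a vector that is almost harmonic. -/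
theorem moments_cocycle (hμ : μ.support.Finite) {b ε : ℝ} (hb : 0 ≤ b) (hε : 0 ≤ ε)
    (h1 : pexp μ (fun s => ‖π s v - v‖ ^ 2) = 1)
    (hw : ∀ u : E, |pexp μ fun s => ⟪u, π s v - v⟫_ℝ| ≤ ε * ‖u‖)
    (hvb : ∀ s ∈ μ.support, ‖π s v - v‖ ≤ b) {t : ℕ} (ht : ε * (t * b) ≤ 1 / 4) :
    t / 2 ≤ pexp (walkLaw μ t) (fun g => ‖π g v - v‖ ^ 2) ∧
    pexp (walkLaw μ t) (fun g => ‖π g v - v‖ ^ 2) ≤ 3 / 2 * t ∧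
    pexp (walkLaw μ t) (fun g => ‖π g v - v‖ ^ 4) ≤ (9 + 2 * b ^ 2) * t ^ 2 := by
  have hle : ∀ t : ℕ, ∀ g ∈ (walkLaw μ t).support, ‖π g v - v‖ ≤ t * b := by
    intro t
    induction t with
    | zero =>
      intro g hg
      rw [walkLaw_zero, PMF.support_pure, Set.mem_singleton_iff] at hg
      simp [hg]
    | succ t ih =>
      intro g hg
      rw [walkLaw_succ', PMF.mem_support_bind_iff] at hg
      obtain ⟨x, hx, hg⟩ := hg
      obtain ⟨a, ha, rfl⟩ := (PMF.mem_support_map_iff _ _ _).1 hg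
      have : π (x * a) v - v = (π x v - v) + π x (π a v - v) := by
        rw [map_mul, LinearIsometryEquiv.coe_mul, Function.comp_apply, map_sub]
        abel
      rw [this]
      refine (norm_add_le _ _).trans ?_
      rw [LinearIsometryEquiv.norm_map]
      push_cast
      linarith [ih x hx, hvb a ha]
  have hdrift : ∀ g, |pexp μ fun s => ⟪π g v - v, π g (π s v - v)⟫_ℝ| ≤ ε * ‖π g v - v‖ := by
    intro g
    have h := hw ((π g).symm (π g v - v))
    rw [LinearIsometryEquiv.norm_map] at h
    refine le_trans (le_of_eq ?_) h
    congr 1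
    refine pexp_congr fun s _ => ?_
    rw [← LinearIsometryEquiv.inner_map_map (π g) ((π g).symm _),
      LinearIsometryEquiv.apply_symm_apply]
  induction t with
  | zero => simp [walkLaw_zero, pexp_pure]
  | succ t ih =>
    push_cast at ht
    have ht' : ε * (t * b) ≤ 1 / 4 := by nlinarith [mul_nonneg hε hb]
    obtain ⟨i1, i2, i3⟩ := ih ht'
    have hf := finite_support_walkLaw hμ t
    set D : Λ → ℝ := fun g => pexp μ fun s => ⟪π g v - v, π g (π s v - v)⟫_ℝ
    -- Up to time `t` the drift is at most `1/4`, so each step adds between `1/2` and `3/2` to the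
    -- mean squared displacement, as for a perturbed martingale.
    have hD : ∀ g ∈ (walkLaw μ t).support, |D g| ≤ 1 / 4 := fun g hg =>
      (hdrift g).trans ((mul_le_mul_of_nonneg_left (hle t g hg) hε).trans ht')
    have e1 : pexp (walkLaw μ (t + 1)) (fun g => ‖π g v - v‖ ^ 2)
        = pexp (walkLaw μ t) fun g => ‖π g v - v‖ ^ 2 + (2 * D g + 1) := by
      rw [pexp_walkLaw_succ' hμ]
      refine pexp_congr fun g _ => ?_
      simp only [norm_sq_cocycle_mul]
      rw [pexp_add hμ, pexp_add hμ, pexp_const hμ, pexp_mul_left, h1]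
      ring
    have e2 : pexp (walkLaw μ (t + 1)) (fun g => ‖π g v - v‖ ^ 4)
        ≤ pexp (walkLaw μ t) fun g => ‖π g v - v‖ ^ 4 + (11 * ‖π g v - v‖ ^ 2 + 2 * b ^ 2) := by
      rw [pexp_walkLaw_succ' hμ]
      refine pexp_mono hf fun g hg => ?_
      set a := ‖π g v - v‖ ^ 2 with ha
      have ha0 : 0 ≤ a := sq_nonneg _
      -- Write `a`, `x`, `d` for the old squared displacement, the inner product and the squared
      -- increment. In `(a + 2x + d)²` use `4xd ≤ 4x² + d²`, then `x² ≤ ad` and `d ≤ b²`; the term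
      -- linear in `x` is kept, because its mean is small.
      have key : ∀ s ∈ μ.support, ‖π (g * s) v - v‖ ^ 4
          ≤ a ^ 2 + (4 * a * ⟪π g v - v, π g (π s v - v)⟫_ℝ
            + (10 * a + 2 * b ^ 2) * ‖π s v - v‖ ^ 2) := by
        intro s hs
        have hx := abs_le.1 (abs_real_inner_le_norm (π g v - v) (π g (π s v - v)))
        rw [LinearIsometryEquiv.norm_map] at hx
        have hx2 : ⟪π g v - v, π g (π s v - v)⟫_ℝ ^ 2 ≤ a * ‖π s v - v‖ ^ 2 := by
          rw [ha, ← mul_pow]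
          exact sq_le_sq' hx.1 hx.2
        have hd : ‖π s v - v‖ ^ 2 ≤ b ^ 2 := pow_le_pow_left₀ (norm_nonneg _) (hvb s hs) 2
        have hd0 : 0 ≤ ‖π s v - v‖ ^ 2 := sq_nonneg _
        rw [show ‖π (g * s) v - v‖ ^ 4 = (‖π (g * s) v - v‖ ^ 2) ^ 2 by ring,
          norm_sq_cocycle_mul]
        set x := ⟪π g v - v, π g (π s v - v)⟫_ℝ
        set d := ‖π s v - v‖ ^ 2
        nlinarith [sq_nonneg (2 * x - d), mul_nonneg hd0 (sub_nonneg.2 hd)]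
      refine (pexp_mono hμ key).trans ?_
      rw [pexp_add hμ, pexp_add hμ, pexp_const hμ, pexp_mul_left, pexp_mul_left, h1]
      have h2 := (abs_le.1 (hD g hg)).2
      have h3 := mul_le_mul_of_nonneg_left h2 ha0
      rw [show ‖π g v - v‖ ^ 4 = a ^ 2 by rw [ha]; ring]
      linarith
    refine ⟨?_, ?_, ?_⟩
    · rw [e1, pexp_add hf]
      have : pexp (walkLaw μ t) (fun _ => (1 / 2 : ℝ))
          ≤ pexp (walkLaw μ t) fun g => 2 * D g + 1 :=
        pexp_mono hf fun g hg => by linarith [(abs_le.1 (hD g hg)).1]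
      rw [pexp_const hf] at this
      push_cast
      linarith
    · rw [e1, pexp_add hf]
      have : pexp (walkLaw μ t) (fun g => 2 * D g + 1)
          ≤ pexp (walkLaw μ t) (fun _ => (3 / 2 : ℝ)) :=
        pexp_mono hf fun g hg => by linarith [(abs_le.1 (hD g hg)).2]
      rw [pexp_const hf] at this
      push_cast
      linarith
    · refine e2.trans ?_
      rw [pexp_add hf, pexp_add hf, pexp_const hf, pexp_mul_left]
      push_cast
      have : (0 : ℝ) ≤ t := Nat.cast_nonneg t
      nlinarith [sq_nonneg b, mul_nonneg this (sq_nonneg b)]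

/-- A second moment of order `t` and a fourth moment of order `t²` force a first moment of order
`√t`: integrate `L² y² - y⁴ ≤ L³ y` with `L` a suitable multiple of `√t`. -/
theorem sqrt_le_pexp_norm_cocycle (hμ : μ.support.Finite) {b ε : ℝ} (hb : 0 ≤ b) (hε : 0 ≤ ε)
    (h1 : pexp μ (fun s => ‖π s v - v‖ ^ 2) = 1)
    (hw : ∀ u : E, |pexp μ fun s => ⟪u, π s v - v⟫_ℝ| ≤ ε * ‖u‖)
    (hvb : ∀ s ∈ μ.support, ‖π s v - v‖ ≤ b) {t : ℕ} (ht : ε * (t * b) ≤ 1 / 4) :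
    √t / (8 * √(9 + 2 * b ^ 2)) ≤ pexp (walkLaw μ t) (fun g => ‖π g v - v‖) := by
  obtain ⟨i1, -, i3⟩ := moments_cocycle hμ hb hε h1 hw hvb ht
  have hf := finite_support_walkLaw hμ t
  rcases Nat.eq_zero_or_pos t with rfl | htpos
  · simpa using pexp_nonneg fun g => norm_nonneg (π g v - v)
  set k := √(9 + 2 * b ^ 2) with hk
  have hk0 : 0 < k := Real.sqrt_pos.2 (by positivity)
  have hk2 : k ^ 2 = 9 + 2 * b ^ 2 := Real.sq_sqrt (by positivity)
  set r := √(t : ℝ) with hr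
  have hr0 : 0 < r := Real.sqrt_pos.2 (by exact_mod_cast htpos)
  have hr2 : r ^ 2 = t := Real.sq_sqrt (Nat.cast_nonneg _)
  set L := 2 * k * r with hL
  have hL0 : 0 < L := by positivity
  have key : ∀ y : ℝ, 0 ≤ y → L ^ 2 * y ^ 2 - y ^ 4 ≤ L ^ 3 * y := by
    intro y hy
    rcases le_total y L with h | h
    · have : L ^ 2 * y ^ 2 ≤ L ^ 2 * (y * L) := by
        rw [sq y]
        gcongr
      nlinarith [pow_nonneg hy 4]
    · have : L ^ 2 * y ^ 2 ≤ y ^ 2 * y ^ 2 := by gcongr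
      nlinarith [mul_nonneg (pow_nonneg hL0.le 3) hy]
  have h2 := pexp_mono hf fun g _ => key ‖π g v - v‖ (norm_nonneg _)
  rw [pexp_sub hf, pexp_mul_left, pexp_mul_left] at h2
  rw [div_le_iff₀ (by positivity)]
  have h3 : L ^ 2 * (r ^ 2 / 2) - k ^ 2 * r ^ 4
      ≤ L ^ 3 * pexp (walkLaw μ t) (fun g => ‖π g v - v‖) := by
    rw [hr2, hk2, show r ^ 4 = (r ^ 2) ^ 2 by ring, hr2]
    have := mul_le_mul_of_nonneg_left i1 (sq_nonneg L)
    linarith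
  set y := pexp (walkLaw μ t) (fun g => ‖π g v - v‖)
  have h4 : (k ^ 2 * r ^ 3) * r ≤ (k ^ 2 * r ^ 3) * (y * (8 * k)) := by
    rw [hL] at h3
    linarith
  exact le_of_mul_le_mul_left h4 (by positivity)

/-- A cocycle grows at most linearly in the word norm. -/
theorem norm_cocycle_le {A : Set Λ} (hA : ∀ a ∈ A, a⁻¹ ∈ A) (hcl : Subgroup.closure A = ⊤) {C : ℝ}
    (hC : ∀ a ∈ A, ‖π a v - v‖ ≤ C) (g : Λ) : ‖π g v - v‖ ≤ wordNorm A g * C := by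
  obtain ⟨l, hn, hl, hg⟩ := exists_word_of_length (exists_word hA hcl g)
  rw [← hn, ← hg]
  clear hn hg
  induction l with
  | nil => simp
  | cons a l ih =>
    have : π (a * l.prod) v - v = (π a v - v) + π a (π l.prod v - v) := by
      rw [map_mul, LinearIsometryEquiv.coe_mul, Function.comp_apply, map_sub]
      abel
    rw [List.prod_cons, this, List.length_cons]
    refine (norm_add_le _ _).trans ?_
    rw [LinearIsometryEquiv.norm_map]
    push_cast
    linarith [hC a (hl a List.mem_cons_self), ih fun x hx => hl x (List.mem_cons_of_mem _ hx)]

end Cocycle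

end SwitchWalk
end

noncomputable section

namespace SwitchWalk

open Finset
open scoped InnerProductSpace

/-! ### The averaging operator, and diffusive growth without a spectral gap -/

section Averaging

variable {Λ : Type*} [Group Λ] {E : Type*} [NormedAddCommGroup E] [InnerProductSpace ℝ E]
  {μ : PMF Λ}

/-- The averaging operator `∑ μ(s) π(s)` of a finitely supported law. -/
def avgOp (hμ : μ.support.Finite) (π : Λ →* (E ≃ₗᵢ[ℝ] E)) : E →L[ℝ] E :=
  ∑ s ∈ hμ.toFinset, (μ s).toReal • ((π s).toContinuousLinearEquiv : E →L[ℝ] E)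

variable (hμ : μ.support.Finite) (π : Λ →* (E ≃ₗᵢ[ℝ] E))

theorem avgOp_apply (x : E) : avgOp hμ π x = ∑ s ∈ hμ.toFinset, (μ s).toReal • π s x := by
  rw [avgOp, _root_.sum_apply]
  rfl

theorem map_avgOp (φ : E →ₗ[ℝ] ℝ) (x : E) : φ (avgOp hμ π x) = pexp μ fun s => φ (π s x) := by
  rw [avgOp_apply, map_sum, pexp_eq_sum hμ.toFinset (by simp)]
  simp only [map_smul, smul_eq_mul]

theorem inner_avgOp (x y : E) : ⟪y, avgOp hμ π x⟫_ℝ = pexp μ fun s => ⟪y, π s x⟫_ℝ :=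
  map_avgOp hμ π (innerₛₗ ℝ y) x

theorem map_avgOp_pow (φ : E →ₗ[ℝ] ℝ) (x : E) (n : ℕ) :
    φ ((avgOp hμ π ^ n) x) = pexp (walkLaw μ n) fun g => φ (π g x) := by
  induction n generalizing φ with
  | zero => simp [walkLaw_zero, pexp_pure]
  | succ n ih =>
    rw [pow_succ', mul_apply_eq_comp, map_avgOp, pexp_walkLaw_succ hμ]
    refine pexp_congr fun s _ => ?_
    have := ih (φ.comp ((π s).toLinearEquiv : E →ₗ[ℝ] E))
    simp only [LinearMap.comp_apply, LinearEquiv.coe_coe, LinearIsometryEquiv.coe_toLinearEquiv]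
      at this
    rw [this]
    simp only [map_mul, LinearIsometryEquiv.coe_mul, Function.comp_apply]

theorem inner_avgOp_left (hμs : ∀ a, μ a⁻¹ = μ a) (x y : E) :
    ⟪avgOp hμ π x, y⟫_ℝ = ⟪x, avgOp hμ π y⟫_ℝ := by
  rw [real_inner_comm, inner_avgOp, inner_avgOp, ← pexp_inv_of_symm hμs]
  refine pexp_congr fun s _ => ?_
  have : π s (π s⁻¹ x) = x := by
    rw [← Function.comp_apply (f := π s), ← LinearIsometryEquiv.coe_mul, ← map_mul, mul_inv_cancel,
      map_one, LinearIsometryEquiv.coe_one, id]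
  rw [← LinearIsometryEquiv.inner_map_map (π s), this, real_inner_comm]

theorem norm_avgOp_le (x : E) : ‖avgOp hμ π x‖ ≤ ‖x‖ := by
  rw [avgOp_apply]
  refine (norm_sum_le _ _).trans_eq ?_
  simp only [norm_smul, LinearIsometryEquiv.norm_map, Real.norm_eq_abs,
    abs_of_nonneg ENNReal.toReal_nonneg]
  rw [← sum_mul, sum_toReal_eq_one _ (by simp), one_mul]

theorem pexp_norm_sub_sq (x : E) :
    pexp μ (fun s => ‖π s x - x‖ ^ 2) = 2 * ⟪x - avgOp hμ π x, x⟫_ℝ := by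
  simp only [norm_sub_sq_real, LinearIsometryEquiv.norm_map]
  rw [pexp_add hμ, pexp_sub hμ, pexp_const hμ, pexp_mul_left, inner_sub_left,
    real_inner_self_eq_norm_sq, real_inner_comm, inner_avgOp]
  simp only [real_inner_comm x]
  ring

/-- A fixed vector of the average has zero energy by `pexp_norm_sub_sq`. So every element of the
support fixes it, hence so does the group they generate. -/
theorem avgOp_fixed (hμs : ∀ a, μ a⁻¹ = μ a) (hμcl : Subgroup.closure μ.support = ⊤) {x : E}
    (hx : avgOp hμ π x = x) (g : Λ) : π g x = x := by
  have h0 := pexp_norm_sub_sq hμ π x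
  rw [hx, sub_self, inner_zero_left, mul_zero, pexp_eq_sum hμ.toFinset (by simp)] at h0
  have h1 := (sum_eq_zero_iff_of_nonneg fun s _ =>
    mul_nonneg ENNReal.toReal_nonneg (sq_nonneg _)).1 h0
  have h2 : ∀ s ∈ μ.support, ‖π s x - x‖ ≤ 0 := fun s hs => by
    have := (mul_eq_zero.1 (h1 s (by simpa using hs))).resolve_left (toReal_pos_of_mem hs).ne'
    exact (pow_eq_zero_iff two_ne_zero |>.1 this).le
  have h3 := norm_cocycle_le (A := μ.support)
    (fun a ha => by rw [PMF.mem_support_iff, hμs]; exact (PMF.mem_support_iff _ _).1 ha) hμcl h2 g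
  rw [mul_zero] at h3
  exact sub_eq_zero.1 (norm_le_zero_iff.1 h3)

/-- If `1 - P` has no spectral gap, then the random walk is diffusive. -/
theorem exists_sqrt_le_meanNorm_of_no_gap {A : Set Λ} (hAf : A.Finite) (hA : ∀ a ∈ A, a⁻¹ ∈ A)
    (hcl : Subgroup.closure A = ⊤) (hμs : ∀ a, μ a⁻¹ = μ a)
    (hμcl : Subgroup.closure μ.support = ⊤)
    (h : ∀ δ : ℝ, 0 < δ → ∃ f, ‖f - avgOp hμ π f‖ ^ 2 < δ * ⟪f - avgOp hμ π f, f⟫_ℝ) :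
    ∃ c : ℝ, 0 < c ∧ ∀ t : ℕ, c * √t ≤ meanNorm A μ t := by
  -- Once the energy is normalized to `1`, an increment along `s` has squared length at most `1 / μ
  -- s`. Thus `b` bounds all increments independently of the vector, which will vary with `t`.
  obtain ⟨b, hb0, hb⟩ : ∃ b : ℝ, 0 < b ∧ ∀ s ∈ μ.support, 1 ≤ b ^ 2 * (μ s).toReal := by
    refine ⟨∑ s ∈ hμ.toFinset, (1 + (μ s).toReal⁻¹), ?_, fun s hs => ?_⟩
    · refine sum_pos (fun s _ => ?_) (hμ.toFinset_nonempty.2 μ.support_nonempty)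
      have : 0 ≤ (μ s).toReal⁻¹ := inv_nonneg.2 ENNReal.toReal_nonneg
      linarith
    · have hs0 := toReal_pos_of_mem hs
      have h1 : 1 + (μ s).toReal⁻¹ ≤ ∑ s ∈ hμ.toFinset, (1 + (μ s).toReal⁻¹) :=
        single_le_sum (f := fun s => 1 + (μ s).toReal⁻¹)
          (fun s _ => add_nonneg zero_le_one (inv_nonneg.2 ENNReal.toReal_nonneg))
          (by simpa using hs)
      have h2 : 0 < (μ s).toReal⁻¹ := inv_pos.2 hs0
      have h3 : (μ s).toReal⁻¹ ≤ (∑ s ∈ hμ.toFinset, (1 + (μ s).toReal⁻¹)) ^ 2 := by nlinarith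
      calc (1 : ℝ) = (μ s).toReal⁻¹ * (μ s).toReal := (inv_mul_cancel₀ hs0.ne').symm
        _ ≤ _ := mul_le_mul_of_nonneg_right h3 hs0.le
  have hμi : ∀ a ∈ μ.support, a⁻¹ ∈ μ.support := fun a ha => by
    rw [PMF.mem_support_iff, hμs]
    exact (PMF.mem_support_iff _ _).1 ha
  obtain ⟨W, hW0, hW⟩ : ∃ W : ℝ, 0 < W ∧ ∀ a ∈ A, (wordNorm μ.support a : ℝ) ≤ W := by
    refine ⟨∑ a ∈ hAf.toFinset, (wordNorm μ.support a : ℝ) + 1, by positivity, fun a ha => ?_⟩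
    have := single_le_sum (f := fun a => (wordNorm μ.support a : ℝ))
      (fun a _ => Nat.cast_nonneg _) (hAf.mem_toFinset.2 ha)
    linarith
  refine ⟨1 / (8 * √(9 + 2 * b ^ 2) * (W * b)), by positivity, fun t => ?_⟩
  -- Small enough for the drift to stay below `1/4` until time `t`. The vector depends on `t`, but
  -- the final constant involves only `b` and `W`.
  set ε : ℝ := 1 / (4 * (t + 1) * b) with hε
  have hε0 : 0 < ε := by positivity
  obtain ⟨f, hf⟩ := h (2 * ε ^ 2) (by positivity)
  have hf0 : 0 < ⟪f - avgOp hμ π f, f⟫_ℝ :=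
    pos_of_mul_pos_right ((sq_nonneg _).trans_lt hf) (by positivity)
  set z := (√(2 * ⟪f - avgOp hμ π f, f⟫_ℝ))⁻¹ with hz
  have hz2 : z ^ 2 * (2 * ⟪f - avgOp hμ π f, f⟫_ℝ) = 1 := by
    rw [hz, inv_pow, Real.sq_sqrt (by positivity)]
    exact inv_mul_cancel₀ (by positivity)
  have hz0 : 0 ≤ z := by positivity
  have hv : z • f - avgOp hμ π (z • f) = z • (f - avgOp hμ π f) := by rw [map_smul, smul_sub]
  have h1 : pexp μ (fun s => ‖π s (z • f) - z • f‖ ^ 2) = 1 := by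
    rw [pexp_norm_sub_sq hμ, hv, real_inner_smul_left, real_inner_smul_right, ← hz2]
    ring
  have hvb : ∀ s ∈ μ.support, ‖π s (z • f) - z • f‖ ≤ b := by
    intro s hs
    have h2 : (μ s).toReal * ‖π s (z • f) - z • f‖ ^ 2 ≤ 1 := by
      rw [← h1, pexp_eq_sum hμ.toFinset (by simp)]
      exact single_le_sum (f := fun s => (μ s).toReal * ‖π s (z • f) - z • f‖ ^ 2)
        (fun s _ => mul_nonneg ENNReal.toReal_nonneg (sq_nonneg _)) (by simpa using hs)
    have h3 : (μ s).toReal * ‖π s (z • f) - z • f‖ ^ 2 ≤ (μ s).toReal * b ^ 2 := by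
      linarith [hb s hs]
    exact (pow_le_pow_iff_left₀ (norm_nonneg _) hb0.le two_ne_zero).1
      (le_of_mul_le_mul_left h3 (toReal_pos_of_mem hs))
  have hw : ∀ u : E, |pexp μ fun s => ⟪u, π s (z • f) - z • f⟫_ℝ| ≤ ε * ‖u‖ := by
    intro u
    have h2 : (pexp μ fun s => ⟪u, π s (z • f) - z • f⟫_ℝ)
        = -⟪u, z • (f - avgOp hμ π f)⟫_ℝ := by
      simp only [inner_sub_right u]
      rw [pexp_sub hμ, pexp_const hμ, ← inner_avgOp hμ, ← hv, inner_sub_right]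
      ring
    rw [h2, abs_neg, mul_comm]
    refine (abs_real_inner_le_norm _ _).trans (mul_le_mul_of_nonneg_left ?_ (norm_nonneg _))
    refine (pow_le_pow_iff_left₀ (norm_nonneg _) hε0.le two_ne_zero).1 ?_
    rw [norm_smul, mul_pow, Real.norm_eq_abs, sq_abs]
    have h3 := mul_le_mul_of_nonneg_left hf.le (sq_nonneg z)
    calc z ^ 2 * ‖f - avgOp hμ π f‖ ^ 2 ≤ z ^ 2 * (2 * ε ^ 2 * ⟪f - avgOp hμ π f, f⟫_ℝ) := h3
      _ = ε ^ 2 * (z ^ 2 * (2 * ⟪f - avgOp hμ π f, f⟫_ℝ)) := by ring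
      _ = ε ^ 2 := by rw [hz2, mul_one]
  have ht : ε * (t * b) ≤ 1 / 4 := by
    rw [hε, div_mul_eq_mul_div, div_le_iff₀ (by positivity)]
    nlinarith
  have h5 := sqrt_le_pexp_norm_cocycle hμ hb0.le hε0.le h1 hw hvb ht
  have h6 : pexp (walkLaw μ t) (fun g => ‖π g (z • f) - z • f‖) ≤ meanNorm A μ t * (W * b) := by
    rw [meanNorm_eq, ← pexp_mul_right]
    refine pexp_mono (finite_support_walkLaw hμ t) fun g _ => norm_cocycle_le hA hcl ?_ g
    intro a ha
    exact (norm_cocycle_le hμi hμcl hvb a).trans (mul_le_mul_of_nonneg_right (hW a ha) hb0.le)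
  rw [one_div_mul_eq_div, ← div_div, div_le_iff₀ (by positivity)]
  exact h5.trans h6

end Averaging

/-! ### The regular representation and the diffusive lower bound -/

section Regular

open scoped Pointwise

variable {Λ : Type*} [Group Λ]

theorem two_toReal_pos : 0 < (2 : ENNReal).toReal := by norm_num

/-- The left translation by `g` of a square summable function. -/
def translate (g : Λ) (f : lp (fun _ : Λ => ℝ) 2) : lp (fun _ : Λ => ℝ) 2 :=
  ⟨fun x => f (g⁻¹ * x), (memℓp_gen_iff two_toReal_pos).2 <|
    (Equiv.mulLeft g⁻¹).summable_iff.2 ((memℓp_gen_iff two_toReal_pos).1 (lp.memℓp f))⟩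

theorem translate_apply (g : Λ) (f : lp (fun _ : Λ => ℝ) 2) (x : Λ) :
    translate g f x = f (g⁻¹ * x) := rfl

theorem norm_translate (g : Λ) (f : lp (fun _ : Λ => ℝ) 2) : ‖translate g f‖ = ‖f‖ := by
  rw [lp.norm_eq_tsum_rpow two_toReal_pos, lp.norm_eq_tsum_rpow two_toReal_pos]
  congr 1
  exact (Equiv.mulLeft g⁻¹).tsum_eq fun x => ‖f x‖ ^ (2 : ENNReal).toReal

variable (Λ) in
/-- The left regular representation on square summable functions. -/
def regularRep : Λ →* (lp (fun _ : Λ => ℝ) 2 ≃ₗᵢ[ℝ] lp (fun _ : Λ => ℝ) 2) :=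
  MonoidHom.mk'
    (fun g =>
      { toFun := translate g
        invFun := translate g⁻¹
        map_add' := fun _ _ => rfl
        map_smul' := fun _ _ => rfl
        left_inv := fun f => by ext x; simp [translate_apply]
        right_inv := fun f => by ext x; simp [translate_apply]
        norm_map' := norm_translate g })
    fun g h => by
      ext f x
      change f ((g * h)⁻¹ * x) = f (h⁻¹ * (g⁻¹ * x))
      rw [mul_inv_rev, mul_assoc]

theorem regularRep_apply (g : Λ) (f : lp (fun _ : Λ => ℝ) 2) (x : Λ) :
    regularRep Λ g f x = f (g⁻¹ * x) := rfl

/-- A fixed function is constant, and a square summable constant on an infinite group vanishes. This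
is where the infinitude of `Λ` enters. -/
theorem eq_zero_of_regularRep_fixed [Infinite Λ] {f : lp (fun _ : Λ => ℝ) 2}
    (h : ∀ g, regularRep Λ g f = f) : f = 0 := by
  have hconst : ∀ x, f x = f 1 := fun x => by
    have := congrArg (fun f : lp (fun _ : Λ => ℝ) 2 => f x) (h x)
    simp only [regularRep_apply, inv_mul_cancel] at this
    exact this.symm
  have hs := (memℓp_gen_iff two_toReal_pos).1 (lp.memℓp f)
  simp only [hconst] at hs
  have h0 := (summable_const_iff _).1 hs
  ext x
  rw [hconst]
  simpa using h0

variable {A : Set Λ} {μ : PMF Λ}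

open Classical in
/-- If the lazy operator is a strict contraction of the regular representation, then the random
walk escapes linearly. -/
theorem exists_linear_le_runMax (hAf : A.Finite) (hA : ∀ a ∈ A, a⁻¹ ∈ A)
    (hcl : Subgroup.closure A = ⊤) (hμ : μ.support.Finite) {l : ℝ} (hl0 : 0 ≤ l) (hl1 : l < 1)
    (hl : ∀ f, ‖(2⁻¹ : ℝ) • (f + avgOp hμ (regularRep Λ) f)‖ ≤ l * ‖f‖) :
    ∃ c : ℝ, 0 < c ∧ ∀ t : ℕ, c * t ≤ runMax (meanNorm A μ) t := by
  set P := avgOp hμ (regularRep Λ) with hP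
  set T : Finset Λ := insert 1 hAf.toFinset with hT
  have hT0 : (0 : ℝ) < T.card := by exact_mod_cast card_pos.2 ⟨1, mem_insert_self _ _⟩
  -- Over `N` steps the contraction outweighs the growth of balls: `T ^ r` contains the ball of
  -- radius `r`, and `l ^ (N * r) * |T ^ r| ≤ 2 ^ (-r)`.
  obtain ⟨N, hN⟩ := exists_pow_lt_of_lt_one (div_pos one_half_pos hT0) hl1
  have hN : l ^ N * T.card ≤ 1 / 2 := ((lt_div_iff₀ hT0).1 hN).le
  have hball : ∀ (r : ℕ) (g : Λ), g ∉ T ^ r → r ≤ wordNorm A g := by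
    intro r g hg
    by_contra! hlt
    obtain ⟨w, hw, hwA, rfl⟩ := exists_word_of_length (exists_word hA hcl g)
    refine hg (Finset.pow_subset_pow_right (mem_insert_self _ _) hlt.le ?_)
    rw [← hw]
    clear hw hg hlt
    induction w with
    | nil => simp
    | cons a w ih =>
      rw [List.prod_cons, List.length_cons, pow_succ']
      exact Finset.mul_mem_mul
        (mem_insert_of_mem (hAf.mem_toFinset.2 (hwA a List.mem_cons_self)))
        (ih fun x hx => hwA x (List.mem_cons_of_mem _ hx))
  have main : ∀ r : ℕ, (r : ℝ) / 2 ≤ runMax (meanNorm A μ) (N * r) := by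
    intro r
    rcases Nat.eq_zero_or_pos r with rfl | hr
    · rw [Nat.cast_zero, zero_div]
      exact (meanNorm_nonneg A μ 0).trans (le_runMax _ (Nat.zero_le _))
    have hr0 : (0 : ℝ) < r := by exact_mod_cast hr
    set M := runMax (meanNorm A μ) (N * r)
    set φ : lp (fun _ : Λ => ℝ) 2 →ₗ[ℝ] ℝ :=
      { toFun := fun f => ∑ x ∈ T ^ r, f x
        map_add' := fun f f' => sum_add_distrib (f := fun x => f x) (g := fun x => f' x)
        map_smul' := fun a f => by simp [mul_sum] } with hφ
    have hφa : ∀ f, φ f = ∑ x ∈ T ^ r, f x := fun f => rfl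
    set e : lp (fun _ : Λ => ℝ) 2 := lp.single 2 (1 : Λ) (1 : ℝ)
    have hφe : ∀ g, φ (regularRep Λ g e) = if g ∈ T ^ r then 1 else 0 := by
      intro g
      rw [hφa, ← sum_ite_eq' (T ^ r) g fun _ => (1 : ℝ)]
      refine sum_congr rfl fun x _ => ?_
      rw [regularRep_apply, lp.single_apply, Pi.single_apply]
      exact if_congr (by rw [inv_mul_eq_one, eq_comm]) rfl rfl
    -- A Markov bound: the walk is still in `T ^ r` at time `j` with probability at least `1 - M /
    -- r`.
    have hlow : ∀ j ≤ N * r, 1 - M / r ≤ φ ((P ^ j) e) := by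
      intro j hj
      have hf := finite_support_walkLaw hμ j
      rw [hP, map_avgOp_pow]
      have h1 : pexp (walkLaw μ j) (fun g => 1 - (wordNorm A g : ℝ) * (1 / r))
          ≤ pexp (walkLaw μ j) fun g => φ (regularRep Λ g e) := by
        refine pexp_mono hf fun g _ => ?_
        rw [hφe]
        split_ifs with hg
        · have : 0 ≤ (wordNorm A g : ℝ) * (1 / r) := by positivity
          linarith
        · have : (1 : ℝ) ≤ (wordNorm A g : ℝ) * (1 / r) := by
            rw [mul_one_div, le_div_iff₀ hr0, one_mul]
            exact_mod_cast hball r g hg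
          linarith
      refine le_trans ?_ h1
      rw [pexp_sub hf, pexp_const hf, pexp_mul_right, ← meanNorm_eq, mul_one_div]
      have := le_runMax (meanNorm A μ) hj
      gcongr
    set Q : lp (fun _ : Λ => ℝ) 2 →L[ℝ] lp (fun _ : Λ => ℝ) 2 :=
      (2⁻¹ : ℝ) • (ContinuousLinearMap.id ℝ _ + P) with hQ
    have hQa : ∀ f, Q f = (2⁻¹ : ℝ) • (f + P f) := fun f => rfl
    -- A power of the lazy operator averages powers of `P` with all smaller exponents, so every time
    -- up to `N * r` is involved; hence the running maximum in place of the mean norm at a single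
    -- time.
    have hlow' : ∀ i j, i + j ≤ N * r → 1 - M / r ≤ φ ((Q ^ i) ((P ^ j) e)) := by
      intro i
      induction i with
      | zero => exact fun j hj => hlow j (by omega)
      | succ i ih =>
        intro j hj
        have h1 := ih j (by omega)
        have h2 := ih (j + 1) (by omega)
        rw [pow_succ, mul_apply_eq_comp, hQa, map_smul, map_smul, map_add, map_add,
          smul_eq_mul]
        rw [pow_succ' P, mul_apply_eq_comp] at h2
        linarith
    have hup : ∀ i, ‖(Q ^ i) e‖ ≤ l ^ i := by
      intro i
      induction i with
      | zero => simp [e, lp.norm_single]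
      | succ i ih =>
        rw [pow_succ', mul_apply_eq_comp, hQa, pow_succ']
        exact (hl _).trans (mul_le_mul_of_nonneg_left ih hl0)
    have hupφ : φ ((Q ^ (N * r)) e) ≤ 1 / 2 := by
      rw [hφa]
      calc ∑ x ∈ T ^ r, (Q ^ (N * r)) e x ≤ ∑ x ∈ T ^ r, l ^ (N * r) :=
            sum_le_sum fun x _ => (le_abs_self _).trans
              ((lp.norm_apply_le_norm two_ne_zero _ x).trans (hup _))
        _ = (T ^ r).card * l ^ (N * r) := by rw [sum_const, nsmul_eq_mul]
        _ ≤ (T.card : ℝ) ^ r * l ^ (N * r) := by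
            gcongr
            exact_mod_cast Finset.card_pow_le
        _ = (l ^ N * T.card) ^ r := by rw [pow_mul, mul_pow, mul_comm]
        _ ≤ (1 / 2) ^ r := pow_le_pow_left₀ (by positivity) hN r
        _ ≤ 1 / 2 := pow_le_of_le_one (by norm_num) (by norm_num) hr.ne'
    have h1 := (hlow' (N * r) 0 (by omega)).trans hupφ
    rw [sub_le_iff_le_add, ← sub_le_iff_le_add', le_div_iff₀ hr0] at h1
    linarith
  refine ⟨1 / (2 * (N + 1)), by positivity, fun t => ?_⟩
  have h1 := main t
  have h2 : runMax (meanNorm A μ) (N * t) ≤ N * runMax (meanNorm A μ) t :=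
    le_nat_mul_of_subadditive (by rw [runMax_zero, meanNorm_zero])
      (runMax_add_le (meanNorm_add_le hA hcl hμ)) N t
  have h3 : 0 ≤ runMax (meanNorm A μ) t :=
    (meanNorm_nonneg A μ 0).trans (le_runMax _ (Nat.zero_le _))
  rw [one_div_mul_eq_div, div_le_iff₀ (by positivity)]
  linarith

/-- The maximal expected displacement of a random walk on an infinite group is at least
diffusive. -/
theorem exists_sqrt_le_runMax [Infinite Λ] (hAf : A.Finite) (hA : ∀ a ∈ A, a⁻¹ ∈ A)
    (hcl : Subgroup.closure A = ⊤) (hμ : μ.support.Finite) (hμs : ∀ a, μ a⁻¹ = μ a)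
    (hμcl : Subgroup.closure μ.support = ⊤) :
    ∃ c : ℝ, 0 < c ∧ ∀ k : ℕ, c * √k ≤ runMax (meanNorm A μ) k := by
  by_cases h : ∀ δ : ℝ, 0 < δ → ∃ f, ‖f - avgOp hμ (regularRep Λ) f‖ ^ 2
      < δ * ⟪f - avgOp hμ (regularRep Λ) f, f⟫_ℝ
  · obtain ⟨c, hc, hc'⟩ :=
      exists_sqrt_le_meanNorm_of_no_gap hμ (regularRep Λ) hAf hA hcl hμs hμcl h
    exact ⟨c, hc, fun k => (hc' k).trans (le_runMax _ le_rfl)⟩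
  · push Not at h
    obtain ⟨δ, hδ, h⟩ := h
    obtain ⟨l, hl0, hl1, hl⟩ := exists_norm_add_le (inner_avgOp_left hμ (regularRep Λ) hμs)
      (norm_avgOp_le hμ (regularRep Λ))
      (fun x hx => eq_zero_of_regularRep_fixed (avgOp_fixed hμ (regularRep Λ) hμs hμcl hx)) hδ h
    obtain ⟨c, hc, hc'⟩ := exists_linear_le_runMax hAf hA hcl hμ hl0 hl1 hl
    refine ⟨c, hc, fun k => le_trans (mul_le_mul_of_nonneg_left ?_ hc.le) (hc' k)⟩
    rw [Real.sqrt_le_left (Nat.cast_nonneg k)]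
    exact_mod_cast Nat.le_self_pow two_ne_zero k

end Regular

end SwitchWalk
end

noncomputable section

namespace SwitchWalk

open Finset

/-! ### The upper bounds in terms of `q` -/

section UpperBounds

variable {Λ Γ S : Type*} [Group Λ] [Group Γ] [MulAction Γ S] {o : S} {A : Set Λ} {μ : PMF Λ}
  {γ : PMF Γ} {B : Set Γ} {θ : ℝ}

theorem log_two_mul_add_one_le (n : ℕ) :
    Real.log (2 * n + 1) ≤ 2 * Real.log (n + 1) := by
  have : (2 * n + 1 : ℝ) ≤ (n + 1) ^ 2 := by nlinarith [(n.cast_nonneg : (0 : ℝ) ≤ n)]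
  calc Real.log (2 * n + 1) ≤ Real.log ((n + 1 : ℝ) ^ 2) := Real.log_le_log (by positivity) this
    _ = 2 * Real.log (n + 1) := by rw [Real.log_pow]; norm_cast

theorem one_le_of_sum_returnTail_le {n : ℕ} {q : ℝ}
    (hq : ∑ i ∈ range (n + 1), returnTail o γ i ≤ q) : 1 ≤ q := by
  refine le_trans ?_ hq
  rw [sum_range_succ', returnTail_zero]
  have : 0 ≤ ∑ i ∈ range n, returnTail o γ (i + 1) := sum_nonneg fun i _ => returnTail_nonneg _
  linarith

theorem walkEntropy_le_entropyFun (hμ : μ.support.Finite) (hγ : γ.support.Finite)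
    (hB : γ.support ⊆ B) (hθ : 0 < θ) (hθ1 : θ ≤ 1) (hK : KraftBound o B θ) (n : ℕ) {q : ℝ}
    (hq : ∑ i ∈ range (n + 1), returnTail o γ i ≤ q) :
    walkEntropy (swsStep o μ γ) n
      ≤ (-Real.log θ / Real.log 2 + 5) * (q * (entropyFun μ (n / q) + Real.log (n + 1))) := by
  have hq1 := one_le_of_sum_returnTail_le hq
  have hlog2 : 0 < Real.log 2 := Real.log_pos one_lt_two
  have hlogθ : 0 ≤ -Real.log θ := neg_nonneg.2 (Real.log_nonpos hθ.le hθ1)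
  have hI : 0 ≤ entropyFun μ (n / q) := (walkEntropy_nonneg μ _).trans
    (le_interp_of_monotone (walkEntropy_mono hμ) (by positivity))
  have hlog : 0 ≤ Real.log (n + 1) := Real.log_nonneg (by linarith [(n.cast_nonneg : (0 : ℝ) ≤ n)])
  rcases Nat.eq_zero_or_pos n with rfl | hn
  · rw [walkEntropy_zero]
    positivity
  refine (walkEntropy_swsStep_le hμ hγ hB hθ hK n).trans ?_
  have h1 := pexp_sum_le_mul_interp (o := o) hγ (walkEntropy_zero μ) (walkEntropy_add_le hμ)
    (walkEntropy_mono hμ) n hq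
  -- For `n ≥ 1` one has `log (n + 1) ≥ log 2`, so the constant cost per site is absorbed into the
  -- logarithm.
  have h2 : -Real.log θ ≤ -Real.log θ / Real.log 2 * Real.log (n + 1) := by
    rw [div_mul_eq_mul_div, le_div_iff₀ hlog2]
    refine mul_le_mul_of_nonneg_left (Real.log_le_log two_pos ?_) hlogθ
    have : (1 : ℝ) ≤ n := by exact_mod_cast hn
    linarith
  have h3 := log_two_mul_add_one_le n
  have h4 : (-Real.log θ + Real.log (2 * n + 1)) * ∑ i ∈ range (n + 1), returnTail o γ i
      ≤ (-Real.log θ / Real.log 2 * Real.log (n + 1) + 2 * Real.log (n + 1)) * q :=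
    mul_le_mul (by linarith) hq (sum_nonneg fun i _ => returnTail_nonneg _) (by positivity)
  have h5 : 0 ≤ -Real.log θ / Real.log 2 * (q * entropyFun μ (n / q)) := by positivity
  have h6 : 0 ≤ q * Real.log (n + 1) := by positivity
  change _ ≤ 5 * (q * entropyFun μ (n / q)) at h1
  linarith

/-- For `n ≥ q` the covering word has mean length `O(√(nq))`, that is `O(q√(n/q))`, and `c√k ≤ U k`
converts the root. For `n < q` the trivial length `n` is enough, as the right side is then linear in
`n`. -/
theorem pexp_coverLength_le_interp (hγ : γ.support.Finite) (hγs : ∀ g, γ g⁻¹ = γ g)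
    (hB : ∀ g ∈ B, g⁻¹ ∈ B) (hγB : γ.support ⊆ B) (hθ : 0 < θ) (hθ1 : θ ≤ 1)
    (hK : KraftBound o B θ) {U : ℕ → ℝ} (hU : Monotone U) (hU0 : U 0 = 0) {c : ℝ} (hc : 0 < c)
    (hcU : ∀ k : ℕ, c * √k ≤ U k) (n : ℕ) {q : ℝ}
    (hq : ∑ i ∈ range (n + 1), returnTail o γ i ≤ q) :
    pexp (iid γ n) (fun w => (coverLength o B w : ℝ))
      ≤ (6 + 12 * √(-Real.log θ + Real.log 2)) / c * (q * interp U (n / q)) := by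
  have hq1 := one_le_of_sum_returnTail_le hq
  have hL : 0 ≤ -Real.log θ + Real.log 2 :=
    add_nonneg (neg_nonneg.2 (Real.log_nonpos hθ.le hθ1)) (Real.log_nonneg one_le_two)
  set L := -Real.log θ + Real.log 2
  rw [div_mul_eq_mul_div, le_div_iff₀ hc]
  have hU0' : ∀ k, 0 ≤ U k := fun k => hU0 ▸ hU (Nat.zero_le k)
  have hI : 0 ≤ interp U (n / q) := (hU0' _).trans (le_interp_of_monotone hU (by positivity))
  have htriv : pexp (iid γ n) (fun w => (coverLength o B w : ℝ)) ≤ n := by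
    have hf := finite_support_iid hγ n
    rw [← pexp_const hf (n : ℝ)]
    refine pexp_mono hf fun w hw => ?_
    have h := coverLength_le_length (o := o) fun g hg => hγB ((mem_support_iid hw).2 g hg)
    rw [(mem_support_iid hw).1] at h
    exact_mod_cast h
  rcases lt_or_ge (n : ℝ) q with hnq | hnq
  · have h1 : q * interp U (n / q) = n * U 1 := by
      rw [interp_of_lt_one hU0 ((div_lt_one (by linarith)).2 hnq)]
      field_simp
    have h2 : c ≤ U 1 := by simpa using hcU 1
    have h3 : (n : ℝ) * c ≤ n * U 1 := mul_le_mul_of_nonneg_left h2 n.cast_nonneg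
    have h4 : 0 ≤ (5 + 12 * √L) * (q * interp U (n / q)) := by positivity
    have h5 := mul_le_mul_of_nonneg_right htriv hc.le
    linarith
  · have hn : n ≠ 0 := by
      rintro rfl
      rw [Nat.cast_zero] at hnq
      linarith
    have hx : 1 ≤ (n : ℝ) / q := (one_le_div (by linarith)).2 hnq
    have h1 : 1 ≤ √(n * q) := Real.one_le_sqrt.2 (by nlinarith)
    have h2 : √(n * q) = q * √(n / q) := by
      rw [show (n * q : ℝ) = q ^ 2 * (n / q) by field_simp, Real.sqrt_mul (by positivity),
        Real.sqrt_sq (by linarith)]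
    have h3 : c * √(n / q) ≤ 2 * interp U (n / q) := by
      have h : √(n / q) ≤ 2 * √(⌊(n / q : ℝ)⌋₊ : ℝ) := by
        rw [Real.sqrt_le_left (by positivity), mul_pow, Real.sq_sqrt (Nat.cast_nonneg _)]
        linarith [half_le_floor hx]
      calc c * √(n / q) ≤ c * (2 * √(⌊(n / q : ℝ)⌋₊ : ℝ)) := mul_le_mul_of_nonneg_left h hc.le
        _ = 2 * (c * √(⌊(n / q : ℝ)⌋₊ : ℝ)) := by ring
        _ ≤ 2 * interp U (n / q) := mul_le_mul_of_nonneg_left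
            ((hcU _).trans (le_interp_of_monotone hU (by positivity))) two_pos.le
    have h4 : pexp (iid γ n) (fun w => (coverLength o B w : ℝ)) ≤ (3 + 6 * √L) * √(n * q) := by
      refine (pexp_coverLength_le hγ hγs hB hγB hθ hK hn).trans ?_
      have : √(n * (L * ∑ i ∈ range (n + 1), returnTail o γ i)) ≤ √L * √(n * q) := by
        rw [← Real.sqrt_mul hL]
        refine Real.sqrt_le_sqrt ?_
        calc n * (L * ∑ i ∈ range (n + 1), returnTail o γ i) ≤ n * (L * q) := by gcongr
          _ = L * (n * q) := by ring
      linarith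
    calc pexp (iid γ n) (fun w => (coverLength o B w : ℝ)) * c
        ≤ (3 + 6 * √L) * √(n * q) * c := mul_le_mul_of_nonneg_right h4 hc.le
      _ = (3 + 6 * √L) * q * (c * √(n / q)) := by rw [h2]; ring
      _ ≤ (3 + 6 * √L) * q * (2 * interp U (n / q)) := by gcongr
      _ = _ := by ring

theorem meanNorm_le_upperSpeed (hA : ∀ a ∈ A, a⁻¹ ∈ A) (hcl : Subgroup.closure A = ⊤)
    (hμ : μ.support.Finite) (hγ : γ.support.Finite) (hγs : ∀ g, γ g⁻¹ = γ g)
    (hB : ∀ g ∈ B, g⁻¹ ∈ B) (hγB : γ.support ⊆ B) (hθ : 0 < θ) (hθ1 : θ ≤ 1)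
    (hK : KraftBound o B θ) {c : ℝ} (hc : 0 < c)
    (hcU : ∀ k : ℕ, c * √k ≤ runMax (meanNorm A μ) k) (n : ℕ) {q : ℝ}
    (hq : ∑ i ∈ range (n + 1), returnTail o γ i ≤ q) :
    meanNorm (wreathGens o A B) (swsStep o μ γ) n
      ≤ ((6 + 12 * √(-Real.log θ + Real.log 2)) / c + 5) * (q * upperSpeed A μ (n / q)) := by
  have hU0 : runMax (meanNorm A μ) 0 = 0 := by rw [runMax_zero, meanNorm_zero]
  have hU := runMax_mono (meanNorm A μ)
  refine (meanNorm_le_pexp hA hcl hμ hγ hγB n).trans ?_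
  rw [upperSpeed_eq, add_mul]
  refine add_le_add (pexp_coverLength_le_interp hγ hγs hB hγB hθ hθ1 hK hU hU0 hc hcU n hq)
    (le_trans ?_ (pexp_sum_le_mul_interp (o := o) hγ hU0
      (runMax_add_le (meanNorm_add_le hA hcl hμ)) hU n hq))
  exact pexp_mono (finite_support_iid hγ n) fun w _ => sum_le_sum fun s _ => le_runMax _ le_rfl

end UpperBounds

/-! ### Symmetry and support of the step law on the mother group -/

namespace DegreeSeq

variable (m : DegreeSeq)

theorem deg_dvd_period (i : ℕ) : m.deg (i + 1) ∣ m.period := by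
  have h : {k | 0 < k ∧ ∀ i, m.deg (i + 1) ∣ k}.Nonempty :=
    ⟨(m.maxDeg).factorial, Nat.factorial_pos _, fun i =>
      Nat.dvd_factorial (lt_of_lt_of_le Nat.zero_lt_two (m.two_le _)) (deg_le_maxDeg _)⟩
  exact (Nat.sInf_mem h).2 i

theorem rhoElt_pow_period : m.rhoElt ^ m.period = 1 :=
  Subtype.ext (rho_pow_eq_one m.deg_dvd_period)

theorem rootElt_inv (σ : Equiv.Perm (Fin (m.deg 0))) : (m.rootElt σ)⁻¹ = m.rootElt σ⁻¹ := by
  rw [inv_eq_iff_mul_eq_one]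
  refine Subtype.ext ?_
  change m.rootPerm σ * m.rootPerm σ⁻¹ = 1
  rw [← rootPerm_mul, mul_inv_cancel, rootPerm_one]

theorem rhoElt_pow_inv {i : ℕ} (hi : i ≤ m.period) :
    (m.rhoElt ^ i)⁻¹ = m.rhoElt ^ ((m.period - i) % m.period) := by
  rw [inv_eq_iff_mul_eq_one, ← pow_mod_orderOf, ← pow_mod_orderOf _ ((m.period - i) % m.period),
    Nat.mod_mod_of_dvd _ (orderOf_dvd_of_pow_eq_one m.rhoElt_pow_period), pow_mod_orderOf,
    pow_mod_orderOf, ← pow_add, Nat.add_sub_cancel' hi, rhoElt_pow_period]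

theorem inv_mem_motherGens {g : m.motherGroup} (hg : g ∈ m.motherGens) : g⁻¹ ∈ m.motherGens := by
  rcases hg with ⟨σ, rfl⟩ | ⟨i, rfl⟩
  · exact Or.inl ⟨σ⁻¹, (m.rootElt_inv σ).symm⟩
  · refine Or.inr ⟨(m.period - i % m.period) % m.period, ?_⟩
    have h : m.rhoElt ^ i = m.rhoElt ^ (i % m.period) := by
      rw [← pow_mod_orderOf, ← pow_mod_orderOf _ (i % m.period),
        Nat.mod_mod_of_dvd _ (orderOf_dvd_of_pow_eq_one m.rhoElt_pow_period)]
    change m.rhoElt ^ _ = (m.rhoElt ^ i)⁻¹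
    rw [h, m.rhoElt_pow_inv (Nat.mod_lt _ m.period_pos).le]

theorem finite_support_motherStep : m.motherStep.support.Finite := by
  refine finite_support_bind (Set.toFinite (PMF.uniformOfFintype Bool).support) fun b _ => ?_
  split_ifs
  · exact finite_support_map _ (Set.toFinite (PMF.support _))
  · refine finite_support_map _ ?_
    rw [PMF.support_uniformOfFinset]
    exact (range m.period).finite_toSet

theorem support_motherStep_subset : m.motherStep.support ⊆ m.motherGens := by
  intro g hg
  rw [motherStep, PMF.mem_support_bind_iff] at hg
  obtain ⟨b, -, hb⟩ := hg
  split_ifs at hb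
  · obtain ⟨σ, -, rfl⟩ := (PMF.mem_support_map_iff _ _ _).1 hb
    exact Or.inl ⟨σ, rfl⟩
  · obtain ⟨i, -, rfl⟩ := (PMF.mem_support_map_iff _ _ _).1 hb
    exact Or.inr ⟨i, rfl⟩

theorem sub_sub_mod_mod {k i : ℕ} (hi : i < k) : (k - (k - i) % k) % k = i := by
  rcases Nat.eq_zero_or_pos i with rfl | h
  · simp
  · rw [Nat.mod_eq_of_lt (by omega : k - i < k), Nat.mod_eq_of_lt (by omega)]
    omega

theorem motherStep_inv (g : m.motherGroup) : m.motherStep g⁻¹ = m.motherStep g := by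
  classical
  rw [motherStep, PMF.bind_apply, PMF.bind_apply]
  refine tsum_congr fun b => congrArg _ ?_
  split_ifs
  · rw [PMF.map_apply, PMF.map_apply, ← (Equiv.inv (Equiv.Perm (Fin (m.deg 0)))).tsum_eq]
    refine tsum_congr fun σ => ?_
    simp only [Equiv.inv_apply, ← rootElt_inv, inv_inj, PMF.uniformOfFintype_apply]
  · rw [PMF.map_apply, PMF.map_apply, tsum_eq_sum (s := range m.period),
      tsum_eq_sum (s := range m.period)]
    -- Reduction modulo the period keeps the exponent in range: it sends `i = 0` to `0` instead of
    -- to the period.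
    · refine sum_nbij' (fun i => (m.period - i) % m.period) (fun i => (m.period - i) % m.period)
        ?_ ?_ ?_ ?_ ?_
      · exact fun i _ => mem_range.2 (Nat.mod_lt _ m.period_pos)
      · exact fun i _ => mem_range.2 (Nat.mod_lt _ m.period_pos)
      · exact fun i hi => sub_sub_mod_mod (mem_range.1 hi)
      · exact fun i hi => sub_sub_mod_mod (mem_range.1 hi)
      · intro i hi
        rw [← rhoElt_pow_inv _ (mem_range.1 hi).le, PMF.uniformOfFinset_apply,
          PMF.uniformOfFinset_apply, if_pos hi,
          if_pos (mem_range.2 (Nat.mod_lt _ m.period_pos))]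
        simp only [inv_eq_iff_eq_inv]
        congr
    · intro i hi
      rw [PMF.uniformOfFinset_apply, if_neg hi, ite_self]
    · intro i hi
      rw [PMF.uniformOfFinset_apply, if_neg hi, ite_self]
end DegreeSeq

end SwitchWalk

/-! ### The theorem -/

theorem proposition4 :
    ∃ C : ℕ → ℝ, (∀ M, 0 < C M) ∧
      ∀ (Λ : Type*) [Group Λ] [Infinite Λ]
        (A : Set Λ) (_ : A.Finite) (_ : ∀ a ∈ A, a⁻¹ ∈ A) (_ : Subgroup.closure A = ⊤)
        (μ : PMF Λ) (_ : μ.support.Finite) (_ : ∀ a, μ a⁻¹ = μ a)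
        (_ : Subgroup.closure μ.support = ⊤),
        ∃ K : ℕ → ℝ, (∀ M, 0 < K M) ∧
          ∀ (m : SwitchWalk.DegreeSeq) (n : ℕ),
            (∀ p : ℝ, 0 < p → p ≤ m.tail n →
              n * p * SwitchWalk.lowerSpeed A μ (1 / p)
                  ≤ C m.maxDeg *
                    SwitchWalk.meanNorm (SwitchWalk.walkGens m A) (SwitchWalk.walkStep m μ) n ∧
              n * p * SwitchWalk.entropyFun μ (1 / p)
                  ≤ C m.maxDeg * SwitchWalk.walkEntropy (SwitchWalk.walkStep m μ) n) ∧
            (∀ q : ℝ, ∑ i ∈ Finset.range (n + 1), m.tail i ≤ q →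
              SwitchWalk.meanNorm (SwitchWalk.walkGens m A) (SwitchWalk.walkStep m μ) n
                  ≤ K m.maxDeg * (q * SwitchWalk.upperSpeed A μ (n / q)) ∧
              SwitchWalk.walkEntropy (SwitchWalk.walkStep m μ) n
                  ≤ C m.maxDeg * (q * (SwitchWalk.entropyFun μ (n / q) + Real.log (n + 1)))) := by
  open SwitchWalk SwitchWalk.DegreeSeq in
  have hlog : ∀ M, 0 ≤ -Real.log (siteWeight M) := fun M =>
    neg_nonneg.2 (Real.log_nonpos (siteWeight_pos M).le (siteWeight_le_one M))
  have hlog2 : 0 < Real.log 2 := Real.log_pos one_lt_two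
  -- The `34` comes from the lower bounds and exceeds the `5` of the entropy upper bound; the
  -- quotient is the cost per site from Kraft's inequality.
  refine ⟨fun M => -Real.log (siteWeight M) / Real.log 2 + 34, fun M => ?_, ?_⟩
  · have := div_nonneg (hlog M) hlog2.le
    linarith
  intro Λ _ _ A hAf hA hcl μ hμ hμs hμcl
  obtain ⟨c, hc, hcU⟩ := exists_sqrt_le_runMax hAf hA hcl hμ hμs hμcl
  -- Through `c`, the diffusive constant of the walk on `Λ`, this is the only constant that sees
  -- `(Λ, A, μ)`.
  refine ⟨fun M => (6 + 12 * √(-Real.log (siteWeight M) + Real.log 2)) / c + 5,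
    fun M => by positivity, fun m n => ⟨fun p hp0 hp => ?_, fun q hq => ?_⟩⟩
  · have h34 : (34 : ℝ) ≤ -Real.log (siteWeight m.maxDeg) / Real.log 2 + 34 := by
      have := div_nonneg (hlog m.maxDeg) hlog2.le
      linarith
    exact ⟨(lowerSpeed_le_meanNorm hA hcl hμ m.finite_support_motherStep
        m.support_motherStep_subset n hp0 hp).trans
        (mul_le_mul_of_nonneg_right h34 (meanNorm_nonneg _ _ _)),
      (entropyFun_le_walkEntropy hμ m.finite_support_motherStep n hp0 hp).trans
        (mul_le_mul_of_nonneg_right h34 (walkEntropy_nonneg _ _))⟩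
  · refine ⟨meanNorm_le_upperSpeed hA hcl hμ m.finite_support_motherStep m.motherStep_inv
      (fun g => m.inv_mem_motherGens) m.support_motherStep_subset (siteWeight_pos _)
      (siteWeight_le_one _) sum_siteWeight_pow_le_one hc hcU n hq, ?_⟩
    refine (walkEntropy_le_entropyFun hμ m.finite_support_motherStep
      m.support_motherStep_subset (siteWeight_pos _) (siteWeight_le_one _)
      sum_siteWeight_pow_le_one n hq).trans ?_
    have hq1 := one_le_of_sum_returnTail_le hq
    have hI : 0 ≤ entropyFun μ (n / q) := (walkEntropy_nonneg μ _).trans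
      (le_interp_of_monotone (walkEntropy_mono hμ) (by positivity))
    have hlogn : 0 ≤ Real.log (n + 1) :=
      Real.log_nonneg (by linarith [(n.cast_nonneg : (0 : ℝ) ≤ n)])
    refine mul_le_mul_of_nonneg_right (by linarith) (by positivity)
end
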